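/- Let $d\ge 1$, let $|\cdot|$ denote the $1$-norm on $\mathbb Z^d$, and for $L\ge 1$ let $\Lambda_L=[-L,L]^d\cap\mathbb Z^d$. Let the masses $m_x$, the spring constants $k_x$ ($x\in\mathbb Z^d$) and the couplings $\lambda_{x,y}=\lambda_{y,x}$ ($|x-y|=1$) be real random variables on a probability space $(\Omega,\mathbb P)$ such that, with deterministic constants $m_{\min},m_{\max},k_{\max},\lambda_{\max}$, almost surely $$0<m_{\min}\le m_x\le m_{\max},\qquad 0\le k_x\le k_{\max},\qquad 0\le\lambda_{x,y}\le\lambda_{\max}$$ for all sites and all nearest-neighbour pairs. Let $$H_L=\sum_{x\in\Lambda_L}\Big(\frac{1}{2m_x}p_x^2+\frac{k_x}{2}q_x^2\Big)+\sum_{\{x,y\}\subset\Lambda_L,\ |x-y|=1}\lambda_{x,y}(q_x-q_y)^2$$ be the self-adjoint operator on $L^2(\mathbb R^{\Lambda_L})$ obtained as closure from the Schwartz functions, where $q_x$ is multiplication by the coordinate $q_x$ and $p_x=-i\,\partial/\partial q_x$. Let $\tau_t(A)=e^{itH_L}Ae^{-itH_L}$ for bounded operators $A$, and for $f:\Lambda_L\to\mathbb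 C$ let $W(f)=\exp\big[i\sum_{x\in\Lambda_L}(\mathrm{Re}f(x)\,q_x+\mathrm{Im}f(x)\,p_x)\big]$ be the Weyl operator. Let $h_{0,L}$ be the real symmetric matrix on $\ell^2(\Lambda_L)$ with diagonal entries $\frac{k_x}{2}+\sum_{u\in\Lambda_L:|u-x|=1}\lambda_{x,u}$, entries $-\lambda_{x,y}$ for $|x-y|=1$, and all other entries $0$; assume that almost surely $h_{0,L}$ is positive definite for all $L\ge1$. Let $h_L=\mu^{1/2}h_{0,L}\mu^{1/2}$, where $\mu$ is the diagonal matrix with entries $\frac1{2m_x}$. Let $r\in(0,1]$ and assume that $h_L$ has exponentially decaying $(-1/2,r)$-eigenfunction correlators, i.e. there exist $C<\infty$ and $\eta>0$ such that $$\mathbb E\Big(\sup_{|u|\le1}\big|\langle\delta_x,h_L^{-1/2}u(h_L)\delta_y\rangle\big|^r\Big)\le Ce^{-\eta|x-y|}$$ for all integers $L\ge1$ and all $x,y\in\Lambda_L$, where the supremum is over all functions $u:\mathbb R\to\mathbb C$ with $|u|\le1$ pointwise. Then there exist $C'<\infty$ and $\mu'>0$ such that $$\mathbb E\Big(\sup_{t\in\mathbb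 R}\big\|[\tau_t(W(f)),W(g)]\big\|\Big)\le C'\sum_{x,y\in\Lambda_L}|f(x)|^r|g(y)|^re^{-\mu'|x-y|}$$ for all $L\ge1$ and all $f,g:\Lambda_L\to\mathbb C$. -/

import Mathlib

open MeasureTheory
open scoped SchwartzMap LineDeriv ENNReal

noncomputable section

namespace OscillatorSystem

/-! ### One-parameter unitary groups -/

section UnitaryGroup

variable {E : Type*} [NormedAddCommGroup E] [InnerProductSpace ℂ E] [CompleteSpace E]

/-- `U` is the strongly continuous one-parameter unitary group with (Stone) generator `A`, that is,
`U t = exp (i t A)`. The last field says that the domain of `A` is exactly the set of `ψ` for which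
`t ↦ U t ψ` is differentiable at `0`, and that the derivative is then `i A ψ`. -/
structure IsUnitaryGroupOf (A : E →ₗ.[ℂ] E) (U : ℝ → E →L[ℂ] E) : Prop where
  unitary_mem : ∀ t, U t ∈ unitary (E →L[ℂ] E)
  map_zero : U 0 = 1
  map_add : ∀ s t, U (s + t) = U s * U t
  continuous_apply : ∀ ψ, Continuous fun t => U t ψ
  mem_graph_iff : ∀ ψ χ, (ψ, χ) ∈ A.graph ↔ HasDerivAt (fun t => U t ψ) (Complex.I • χ) 0

open Classical in
/-- `expI A t = exp (i t A)` for a self-adjoint operator `A`: by Stone's theorem there is exactly one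
unitary group with generator `A`. (If `A` is not self-adjoint there is none, and the value is the
identity by convention; this does not occur for the operators used below.) -/
def expI (A : E →ₗ.[ℂ] E) (t : ℝ) : E →L[ℂ] E :=
  if h : ∃ U : ℝ → E →L[ℂ] E, IsUnitaryGroupOf A U then h.choose t else 1

end UnitaryGroup

/-! ### The lattice, the boxes and the parameters -/

/-- The lattice `ℤ^d`. -/
abbrev Site (d : ℕ) : Type := Fin d → ℤ

/-- The distance `|x - y|` in the `1`-norm. -/
def siteDist {d : ℕ} (x y : Site d) : ℕ := ∑ i, (x i - y i).natAbs

theorem siteDist_comm {d : ℕ} (x y : Site d) : siteDist x y = siteDist y x := by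
  unfold siteDist
  exact Finset.sum_congr rfl fun i _ => by omega

/-- The cube `Λ_L = [-L, L]^d ∩ ℤ^d`. -/
abbrev Box (d L : ℕ) : Type :=
  ↥(Finset.Icc (fun _ : Fin d => -(L : ℤ)) (fun _ : Fin d => (L : ℤ)))

/-- A (deterministic) choice of masses `m_x`, spring constants `k_x` and couplings `λ_{x,y}`, the
latter indexed by unordered pairs; only the couplings of nearest neighbours are ever used. -/
structure Params (d : ℕ) where
  m : Site d → ℝ
  k : Site d → ℝ
  lam : Sym2 (Site d) → ℝ

/-- The parameters satisfy the uniform bounds with the given constants. -/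
structure Params.Bounds {d : ℕ} (p : Params d) (mMin mMax kMax lamMax : ℝ) : Prop where
  mMin_pos : 0 < mMin
  m_mem : ∀ x, p.m x ∈ Set.Icc mMin mMax
  k_mem : ∀ x, p.k x ∈ Set.Icc 0 kMax
  lam_mem : ∀ x y, siteDist x y = 1 → p.lam s(x, y) ∈ Set.Icc 0 lamMax

variable {d : ℕ}

/-! ### The one-particle operators -/

/-- The matrix `h_{0,L}` on `ℓ²(Λ_L)`. -/
def h0 (p : Params d) (L : ℕ) : Matrix (Box d L) (Box d L) ℝ :=
  Matrix.of fun x y =>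
    if x = y then
      p.k x / 2 + ∑ u : Box d L, if siteDist (x : Site d) u = 1 then p.lam s(↑x, ↑u) else 0
    else if siteDist (x : Site d) y = 1 then -p.lam s(↑x, ↑y)
    else 0

/-- The diagonal matrix `μ^{1/2}`, where `μ` has the diagonal entries `1 / (2 m_x)`. -/
def sqrtMu (p : Params d) (L : ℕ) : Matrix (Box d L) (Box d L) ℝ :=
  Matrix.diagonal fun x => Real.sqrt (1 / (2 * p.m x))

/-- The effective one-particle operator `h_L = μ^{1/2} h_{0,L} μ^{1/2}`. -/
def hL (p : Params d) (L : ℕ) : Matrix (Box d L) (Box d L) ℝ :=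
  sqrtMu p L * h0 p L * sqrtMu p L

theorem h0_isHermitian (p : Params d) (L : ℕ) : (h0 p L).IsHermitian := by
  ext x y
  simp only [h0, Matrix.conjTranspose_apply, Matrix.of_apply, star_trivial]
  by_cases h : x = y
  · subst h; rfl
  · rw [if_neg h, if_neg (Ne.symm h), siteDist_comm, Sym2.eq_swap]

theorem hL_isHermitian (p : Params d) (L : ℕ) : (hL p L).IsHermitian := by
  have hD : (sqrtMu p L).conjTranspose = sqrtMu p L := by
    simp [sqrtMu]
  have h0' : (h0 p L).conjTranspose = h0 p L := h0_isHermitian p L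
  simp only [Matrix.IsHermitian, hL, Matrix.conjTranspose_mul, hD, h0', Matrix.mul_assoc]

/-- The functional calculus of a real symmetric matrix, as an eigenfunction expansion: the matrix
element `⟨δ_x, φ(A) δ_y⟩ = ∑_k φ(E_k) v_k(x) v_k(y)`. -/
def matFun {n : Type*} [Fintype n] [DecidableEq n] {A : Matrix n n ℝ} (hA : A.IsHermitian)
    (φ : ℝ → ℂ) : Matrix n n ℂ :=
  Matrix.of fun x y =>
    ∑ j, φ (hA.eigenvalues j) * (hA.eigenvectorBasis j x : ℂ) * (hA.eigenvectorBasis j y : ℂ)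

/-- `sup_{|u| ≤ 1} |⟨δ_x, h_L^α u(h_L) δ_y⟩|^r`, over all functions `u : ℝ → ℂ` with `|u| ≤ 1`. -/
def eigenCorrelator (α r : ℝ) (p : Params d) (L : ℕ) (x y : Box d L) : ℝ≥0∞ :=
  ⨆ (u : ℝ → ℂ) (_ : ∀ s, ‖u s‖ ≤ 1),
    ‖matFun (hL_isHermitian p L) (fun s => ((s ^ α : ℝ) : ℂ) * u s) x y‖ₑ ^ r

/-- For random parameters `p`, the operators `h_L` have exponentially decaying
`(α, r)`-eigenfunction correlators. -/
def ExpDecayingCorrelators {Ω : Type*} [MeasurableSpace Ω] (P : Measure Ω) (p : Ω → Params d)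
    (α r : ℝ) : Prop :=
  ∃ C μ : ℝ, 0 < μ ∧ ∀ L : ℕ, 1 ≤ L → ∀ x y : Box d L,
    ∫⁻ ω, eigenCorrelator α r (p ω) L x y ∂P
      ≤ ENNReal.ofReal (C * Real.exp (-μ * siteDist (x : Site d) y))

/-! ### The many-body operators -/

/-- Configuration space `ℝ^{Λ_L}`. -/
abbrev Config (d L : ℕ) : Type := EuclideanSpace ℝ (Box d L)

/-- The Hilbert space `L²(ℝ^{Λ_L})`. -/
abbrev HilbertL (d L : ℕ) : Type := Lp ℂ 2 (volume : Measure (Config d L))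

/-- The position operator `q_x` on Schwartz functions: multiplication by the coordinate `q_x`. -/
def posOp {L : ℕ} (x : Box d L) : Module.End ℂ 𝓢(Config d L, ℂ) :=
  (SchwartzMap.smulLeftCLM ℂ fun q : Config d L => ((q x : ℝ) : ℂ)).toLinearMap

/-- The momentum operator `p_x = -i ∂/∂q_x` on Schwartz functions. -/
def momOp {L : ℕ} (x : Box d L) : Module.End ℂ 𝓢(Config d L, ℂ) :=
  (-Complex.I) •
    (LineDeriv.lineDerivOpCLM ℂ 𝓢(Config d L, ℂ) (EuclideanSpace.single x (1 : ℝ))).toLinearMap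

theorem posOp_apply {L : ℕ} (x : Box d L) (φ : 𝓢(Config d L, ℂ)) (q : Config d L) :
    posOp x φ q = (q x : ℂ) * φ q := by
  have hg : (fun q : Config d L => ((q x : ℝ) : ℂ)).HasTemperateGrowth :=
    ((Complex.ofRealCLM.comp (EuclideanSpace.proj x : Config d L →L[ℝ] ℝ))).hasTemperateGrowth
  exact SchwartzMap.smulLeftCLM_apply_apply hg φ q

theorem momOp_apply {L : ℕ} (x : Box d L) (φ : 𝓢(Config d L, ℂ)) (q : Config d L) :
    momOp x φ q = -Complex.I * lineDeriv ℝ φ q (EuclideanSpace.single x 1) := by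
  simp [momOp, SchwartzMap.lineDerivOp_apply]

/-- The operator on `L²` whose domain is the Schwartz space and which acts there as `T`. -/
def schwartzPMap {L : ℕ} (T : Module.End ℂ 𝓢(Config d L, ℂ)) :
    HilbertL d L →ₗ.[ℂ] HilbertL d L where
  domain := LinearMap.range (SchwartzMap.toLpCLM ℂ ℂ 2 (volume : Measure (Config d L))).toLinearMap
  toFun :=
    (SchwartzMap.toLpCLM ℂ ℂ 2 (volume : Measure (Config d L))).toLinearMap ∘ₗ T ∘ₗ
      (LinearEquiv.ofInjective
        (SchwartzMap.toLpCLM ℂ ℂ 2 (volume : Measure (Config d L))).toLinearMap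
        (SchwartzMap.injective_toLp 2 (volume : Measure (Config d L)))).symm.toLinearMap

/-- The Hamiltonian
`∑_x (p_x² / (2 m_x) + (k_x / 2) q_x²) + ∑_{{x,y}, |x-y|=1} λ_{x,y} (q_x - q_y)²`
on Schwartz functions; the second sum runs over unordered pairs. -/
def hamiltonianOp (p : Params d) (L : ℕ) : Module.End ℂ 𝓢(Config d L, ℂ) :=
  ∑ x : Box d L,
      (((1 / (2 * p.m x) : ℝ) : ℂ) • momOp x ^ 2 + ((p.k x / 2 : ℝ) : ℂ) • posOp x ^ 2) +
    ∑ e : Sym2 (Box d L),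
      Sym2.lift ⟨fun x y : Box d L =>
        if siteDist (x : Site d) y = 1 then
          ((p.lam s(↑x, ↑y) : ℝ) : ℂ) • (posOp x - posOp y) ^ 2
        else 0, fun x y => by
          beta_reduce
          rw [siteDist_comm, Sym2.eq_swap, ← neg_sub (posOp y) (posOp x), neg_sq]⟩ e

/-- The self-adjoint Hamiltonian `H_L`: the closure of the Hamiltonian on Schwartz functions. -/
def hamiltonian (p : Params d) (L : ℕ) : HilbertL d L →ₗ.[ℂ] HilbertL d L :=
  (schwartzPMap (hamiltonianOp p L)).closure

/-- The Heisenberg dynamics `τ_t(A) = exp(i t H_L) A exp(-i t H_L)`. -/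
def heisenberg (p : Params d) (L : ℕ) (t : ℝ) (A : HilbertL d L →L[ℂ] HilbertL d L) :
    HilbertL d L →L[ℂ] HilbertL d L :=
  expI (hamiltonian p L) t * A * expI (hamiltonian p L) (-t)

/-- The self-adjoint operator `∑_x (Re f(x) q_x + Im f(x) p_x)`, as a closure from Schwartz
functions. -/
def fieldOp {L : ℕ} (f : Box d L → ℂ) : HilbertL d L →ₗ.[ℂ] HilbertL d L :=
  (schwartzPMap (∑ x, (((f x).re : ℂ) • posOp x + ((f x).im : ℂ) • momOp x))).closure

/-- The Weyl operator `W(f) = exp (i ∑_x (Re f(x) q_x + Im f(x) p_x))`. -/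
def weyl {L : ℕ} (f : Box d L → ℂ) : HilbertL d L →L[ℂ] HilbertL d L :=
  expI (fieldOp f) 1

end OscillatorSystem

end

open OscillatorSystem

noncomputable section

namespace OscillatorSystem

open Filter Topology
open scoped InnerProductSpace

/-! The Hamiltonian is quadratic, so conjugation by its unitary group moves Weyl operators along the
classical linear flow: `τ_t (W(f)) = W(f_t)`. The Weyl relations then make the commutator `[W(f_t),
W(g)]` equal to `(exp(iσ) - 1)` times a product of Weyl operators, where `σ` is the symplectic
pairing of `f_t` with `g`. So everything reduces to bounding `|σ|`, which is a bilinear form in `f`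
and `g` whose coefficients are matrix elements of one-particle functions. Those functions are
`cos(2t h^{1/2})`, `h^{-1/2} sin(2t h^{1/2})` and `h^{1/2} sin(2t h^{1/2})` with `h = h_L`. Each of
them is `h^{-1/2} u(h)` with `u` bounded on the spectrum, uniformly in `t` and `L`, because the
spectrum of `h_L` lies in `(0, B]` with a deterministic `B` (`eigenvalues_hL_le`). Hence the
eigenfunction correlator dominates them (`enorm_flowKernel_rpow_le`). Since `r ≤ 1`, one has
`|exp(iσ) - 1| ≤ 2|σ|^r`, and the power `r` may be taken inside the sum over sites. Taking
expectations gives the decay, with the same rate as in the hypothesis. Two points need real work.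
The first is that the unitary groups are those generated by the closures of the given operators.
Symmetric operators are treated by an invariant-domain criterion (`isUnitaryGroupOf_closure`): for
the field operators the Schwartz space itself is invariant, and for the Hamiltonian the domain is
the span of the Hermite-type eigenfunctions, whose totality follows from uniqueness of Fourier
transforms (`dense_span_excited`). The flow identity `heisenberg_weylL2` is then obtained by
differentiating on these eigenfunctions. The second is measurability. Eigenvectors are not chosen
measurably, but the three functions are entire in `h`, so the kernels are limits of polynomials in
the matrix entries (`aemeasurable_flowKernel`), and continuity in `t` replaces the supremum by one
over the rationals. -/

/-! ### Strongly continuous unitary groups and their generators -/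

section UnitaryGroupTheory

variable {E : Type*} [NormedAddCommGroup E] [InnerProductSpace ℂ E] [CompleteSpace E]

/-- A strongly continuous one-parameter unitary group. -/
structure IsUnitaryGroup (U : ℝ → E →L[ℂ] E) : Prop where
  unitary_mem : ∀ t, U t ∈ unitary (E →L[ℂ] E)
  map_zero : U 0 = 1
  map_add : ∀ s t, U (s + t) = U s * U t
  continuous_apply : ∀ ψ, Continuous fun t => U t ψ

theorem IsUnitaryGroupOf.isUnitaryGroup {A : E →ₗ.[ℂ] E} {U : ℝ → E →L[ℂ] E}
    (h : IsUnitaryGroupOf A U) : IsUnitaryGroup U :=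
  ⟨h.unitary_mem, h.map_zero, h.map_add, h.continuous_apply⟩

namespace IsUnitaryGroup

variable {U : ℝ → E →L[ℂ] E} (hU : IsUnitaryGroup U)
include hU

theorem map_add_apply (s t : ℝ) (ψ : E) : U (s + t) ψ = U s (U t ψ) := by
  rw [hU.map_add]; rfl

theorem apply_neg_apply (t : ℝ) (ψ : E) : U t (U (-t) ψ) = ψ := by
  rw [← hU.map_add_apply, add_neg_cancel, hU.map_zero]; rfl

theorem inner_apply_apply (t : ℝ) (ψ χ : E) : ⟪U t ψ, U t χ⟫_ℂ = ⟪ψ, χ⟫_ℂ := by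
  have h := Unitary.star_mul_self_of_mem (hU.unitary_mem t)
  rw [← ContinuousLinearMap.adjoint_inner_right, ← ContinuousLinearMap.star_eq_adjoint]
  change ⟪ψ, (star (U t) * U t) χ⟫_ℂ = _
  rw [h]; rfl

theorem norm_apply (t : ℝ) (ψ : E) : ‖U t ψ‖ = ‖ψ‖ := by
  rw [@norm_eq_sqrt_re_inner ℂ, @norm_eq_sqrt_re_inner ℂ _ _ _ _ ψ, hU.inner_apply_apply]

theorem hasDerivAt_apply {ψ χ : E} (h : HasDerivAt (fun t => U t ψ) χ 0) (t : ℝ) :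
    HasDerivAt (fun s => U s ψ) (U t χ) t := by
  have h1 : HasDerivAt (fun s => U (s - t) ψ) χ t := by
    have : HasDerivAt (fun t => U t ψ) χ (t - t) := by simpa using h
    simpa using this.comp_sub_const t t
  have h2 := ((U t).restrictScalars ℝ).hasFDerivAt.comp_hasDerivAt t h1
  refine h2.congr_of_eventuallyEq (Eventually.of_forall fun s => ?_)
  change U s ψ = U t (U (s - t) ψ)
  rw [← hU.map_add_apply, add_sub_cancel]

theorem comp_neg_hasDerivAt {ψ χ : E} (h : HasDerivAt (fun t => U t ψ) χ 0) (t : ℝ) :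
    HasDerivAt (fun s => U (-s) ψ) (-U (-t) χ) t := by
  simpa [Function.comp_def] using (hU.hasDerivAt_apply h (-t)).scomp t (hasDerivAt_neg t)

/-- The product rule for a curve moved by a unitary group run backwards. -/
theorem hasDerivAt_neg_apply_curve {u : ℝ → E} {u' χ : E} {t : ℝ} (hu : HasDerivAt u u' t)
    (hχ : HasDerivAt (fun s => U s (u t)) χ 0) :
    HasDerivAt (fun s => U (-s) (u s)) (U (-t) (u' - χ)) t := by
  have h1 := hU.comp_neg_hasDerivAt hχ t
  have h2 : HasDerivAt (fun s => U (-s) (u s - u t)) (U (-t) u') t := by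
    rw [hasDerivAt_iff_tendsto_slope] at hu ⊢
    have hc : Continuous fun s => U (-s) u' := (hU.continuous_apply u').comp continuous_neg
    have h3 : Tendsto (fun s => U (-s) (slope u t s - u')) (𝓝[≠] t) (𝓝 0) := by
      rw [tendsto_zero_iff_norm_tendsto_zero]
      simp only [hU.norm_apply]
      rw [← tendsto_zero_iff_norm_tendsto_zero]
      simpa using hu.sub_const u'
    have h4 := h3.add ((hc.tendsto t).mono_left nhdsWithin_le_nhds)
    rw [zero_add] at h4
    refine h4.congr fun s => ?_
    simp [slope_def_module]
  have h5 := h2.add h1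
  have e : U (-t) (u' - χ) = U (-t) u' + -U (-t) χ := by rw [map_sub, sub_eq_add_neg]
  rw [e]
  refine h5.congr_of_eventuallyEq (Eventually.of_forall fun s => ?_)
  simp

/-- The generator is symmetric. -/
theorem generator_symm {ψ χ ψ' χ' : E} (h : HasDerivAt (fun t => U t ψ) (Complex.I • χ) 0)
    (h' : HasDerivAt (fun t => U t ψ') (Complex.I • χ') 0) : ⟪χ, ψ'⟫_ℂ = ⟪ψ, χ'⟫_ℂ := by
  have h1 := h.inner ℂ h'
  simp only [hU.inner_apply_apply, hU.map_zero] at h1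
  have h2 := h1.unique (hasDerivAt_const _ _)
  simp only [one_apply_eq_self, inner_smul_right, inner_smul_left,
    Complex.conj_I] at h2
  have h3 : Complex.I * (⟪ψ, χ'⟫_ℂ - ⟪χ, ψ'⟫_ℂ) = 0 := by linear_combination h2
  rcases mul_eq_zero.1 h3 with h | h
  · exact absurd h Complex.I_ne_zero
  · exact (sub_eq_zero.1 h).symm

/-- The generator is closed. -/
theorem generator_closed {ι : Type*} {l : Filter ι} [l.NeBot] {x : ι → E × E} {ψ χ : E}
    (hx : ∀ n, HasDerivAt (fun t => U t (x n).1) (Complex.I • (x n).2) 0)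
    (hlim : Tendsto x l (𝓝 (ψ, χ))) : HasDerivAt (fun t => U t ψ) (Complex.I • χ) 0 := by
  have h1 : Tendsto (fun n => (x n).1) l (𝓝 ψ) := (continuous_fst.tendsto _).comp hlim
  have h2 : Tendsto (fun n => (x n).2) l (𝓝 χ) := (continuous_snd.tendsto _).comp hlim
  have key := hasDerivAt_of_tendstoUniformly (l := l) (f := fun n t => U t (x n).1)
    (f' := fun n t => U t (Complex.I • (x n).2)) (g := fun t => U t ψ)
    (g' := fun t => U t (Complex.I • χ)) (𝕜 := ℝ) ?_
    (Eventually.of_forall fun n t => hU.hasDerivAt_apply (hx n) t)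
    (fun t => ((U t).continuous.tendsto _).comp h1) 0
  · simpa [hU.map_zero] using key
  · rw [Metric.tendstoUniformly_iff]
    intro ε hε
    filter_upwards [Metric.tendsto_nhds.1 h2 ε hε] with n hn t
    rw [dist_eq_norm, ← map_sub, hU.norm_apply, ← smul_sub, norm_smul, Complex.norm_I, one_mul,
      ← dist_eq_norm, dist_comm]
    exact hn

/-- A deficiency vector `η` would make `t ↦ ⟪η, U t x⟫` satisfy `g' = g`, hence grow like `exp t`,
while unitarity keeps it bounded. Invariance of `G` is what propagates the orthogonality to all
times. -/
theorem eq_zero_of_orthogonal_range {G : Submodule ℂ (E × E)}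
    (hder : ∀ x ∈ G, HasDerivAt (fun t => U t x.1) (Complex.I • x.2) 0)
    (hinv : ∀ x ∈ G, ∀ t, (U t x.1, U t x.2) ∈ G)
    (hdense : Dense (Prod.fst '' (G : Set (E × E)))) {η : E}
    (hη : ∀ x ∈ G, ⟪η, x.2 + Complex.I • x.1⟫_ℂ = 0) : η = 0 := by
  have h0 : ∀ x ∈ G, ⟪η, x.1⟫_ℂ = 0 := by
    intro x hx
    have hg : ∀ t : ℝ, HasDerivAt (fun t => ⟪η, U t x.1⟫_ℂ) ⟪η, U t x.1⟫_ℂ t := by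
      intro t
      have h1 := (hasDerivAt_const t η).inner ℂ (hU.hasDerivAt_apply (hder x hx) t)
      have h2 := hη _ (hinv x hx t)
      refine h1.congr_deriv ?_
      simp only [inner_add_right, inner_smul_right, inner_zero_left, map_smul, add_zero] at h2 ⊢
      linear_combination Complex.I * h2 - ⟪η, U t x.1⟫_ℂ * Complex.I_mul_I
    have hexp : ∀ t : ℝ, ⟪η, U t x.1⟫_ℂ = Complex.exp t * ⟪η, x.1⟫_ℂ := by
      intro t
      have hd : ∀ s : ℝ, HasDerivAt (fun s : ℝ => Complex.exp (-s) * ⟪η, U s x.1⟫_ℂ) 0 s := by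
        intro s
        have h1 : HasDerivAt (fun s : ℝ => Complex.exp (-s)) (-Complex.exp (-s)) s := by
          have := ((hasDerivAt_id s).ofReal_comp.neg).cexp
          simpa using this
        refine (h1.mul (hg s)).congr_deriv ?_
        ring
      have hc := is_const_of_deriv_eq_zero (fun s => (hd s).differentiableAt)
        (fun s => (hd s).deriv) t 0
      simp only [hU.map_zero, Complex.ofReal_zero, neg_zero, Complex.exp_zero, one_mul,
        one_apply_eq_self] at hc
      rw [← hc, ← mul_assoc, ← Complex.exp_add]
      simp
    by_contra hne
    have hpos : 0 < ‖⟪η, x.1⟫_ℂ‖ := norm_pos_iff.2 hne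
    have hb : ∀ t : ℝ, Real.exp t ≤ ‖η‖ * ‖x.1‖ / ‖⟪η, x.1⟫_ℂ‖ := by
      intro t
      rw [le_div_iff₀ hpos]
      have h1 := norm_inner_le_norm (𝕜 := ℂ) η (U t x.1)
      rw [hexp, norm_mul, Complex.norm_exp, hU.norm_apply] at h1
      simpa using h1
    obtain ⟨t, ht⟩ := (Real.tendsto_exp_atTop.eventually_gt_atTop
      (‖η‖ * ‖x.1‖ / ‖⟪η, x.1⟫_ℂ‖)).exists
    exact absurd (hb t) (not_le.2 ht)
  have h1 : (fun y => ⟪η, y⟫_ℂ) = fun _ => 0 :=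
    Continuous.ext_on hdense (by fun_prop) continuous_const
      (by rintro _ ⟨x, hx, rfl⟩; exact h0 x hx)
  exact inner_self_eq_zero.1 (congrFun h1 η)

-- For a symmetric pair the cross term is purely imaginary, so the norm of `(A + i)x` controls the
-- graph norm. This turns density of the range of `A + i` into density in the graph.
omit hU [CompleteSpace E] in
theorem norm_sq_snd_add_I_smul_fst {x : E × E} (hx : ⟪x.2, x.1⟫_ℂ = ⟪x.1, x.2⟫_ℂ) :
    ‖x.2 + Complex.I • x.1‖ ^ 2 = ‖x.2‖ ^ 2 + ‖x.1‖ ^ 2 := by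
  rw [@norm_add_sq ℂ, norm_smul, Complex.norm_I, one_mul, inner_smul_right]
  have : (⟪x.2, x.1⟫_ℂ).im = 0 := by
    have h := congrArg Complex.im hx
    rw [← inner_conj_symm x.1 x.2, Complex.conj_im] at h
    linarith
  simp [this]

/-- The graph of the generator is the closure of any symmetric relation which extends the
restriction of the generator to a dense invariant subspace. -/
theorem mem_topologicalClosure_iff {G₀ G : Submodule ℂ (E × E)} (hle : G₀ ≤ G)
    (hsymm : ∀ x ∈ G, ∀ y ∈ G, ⟪x.2, y.1⟫_ℂ = ⟪x.1, y.2⟫_ℂ)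
    (hder : ∀ x ∈ G₀, HasDerivAt (fun t => U t x.1) (Complex.I • x.2) 0)
    (hinv : ∀ x ∈ G₀, ∀ t, (U t x.1, U t x.2) ∈ G₀)
    (hdense : Dense (Prod.fst '' (G₀ : Set (E × E)))) (ψ χ : E) :
    (ψ, χ) ∈ G.topologicalClosure ↔ HasDerivAt (fun t => U t ψ) (Complex.I • χ) 0 := by
  set R : Submodule ℂ E := G₀.map (LinearMap.snd ℂ E E + Complex.I • LinearMap.fst ℂ E E) with hR
  have hRdense : R.topologicalClosure = ⊤ := by
    rw [Submodule.topologicalClosure_eq_top_iff, Submodule.eq_bot_iff]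
    intro η hη
    refine hU.eq_zero_of_orthogonal_range hder hinv hdense fun x hx => ?_
    exact Submodule.inner_left_of_mem_orthogonal (K := R) ⟨x, hx, by simp⟩ hη
  -- Choose `y` in `G₀` whose image under `A + i` is close to that of `x`; since `y - x` is a
  -- symmetric pair, `y` is then close to `x` in the graph norm.
  have approx : ∀ x : E × E, (∀ y ∈ G₀, ⟪(y - x).2, (y - x).1⟫_ℂ = ⟪(y - x).1, (y - x).2⟫_ℂ) →
      x ∈ G₀.topologicalClosure := by
    intro x hx
    have hmem : x.2 + Complex.I • x.1 ∈ closure (R : Set E) := by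
      rw [← Submodule.topologicalClosure_coe, hRdense]; trivial
    rw [← SetLike.mem_coe, Submodule.topologicalClosure_coe, Metric.mem_closure_iff]
    intro ε hε
    obtain ⟨_, ⟨y, hy, rfl⟩, hyd⟩ := Metric.mem_closure_iff.1 hmem ε hε
    refine ⟨y, hy, ?_⟩
    rw [dist_comm, dist_eq_norm] at hyd ⊢
    have h1 : (LinearMap.snd ℂ E E + Complex.I • LinearMap.fst ℂ E E) y
        - (x.2 + Complex.I • x.1) = (y - x).2 + Complex.I • (y - x).1 := by
      simp only [LinearMap.add_apply, LinearMap.snd_apply, LinearMap.smul_apply,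
        LinearMap.fst_apply, Prod.snd_sub, Prod.fst_sub, smul_sub]
      abel
    rw [h1] at hyd
    have h2 := norm_sq_snd_add_I_smul_fst (hx y hy)
    rw [Prod.norm_def, max_lt_iff]
    constructor
    · refine lt_of_le_of_lt (abs_le_of_sq_le_sq' ?_ (norm_nonneg _)).2 hyd
      nlinarith [sq_nonneg ‖(y - x).2‖]
    · refine lt_of_le_of_lt (abs_le_of_sq_le_sq' ?_ (norm_nonneg _)).2 hyd
      nlinarith [sq_nonneg ‖(y - x).1‖]
  constructor
  · intro h
    have hsymm' : ∀ x ∈ G.topologicalClosure, ∀ y ∈ G, ⟪x.2, y.1⟫_ℂ = ⟪x.1, y.2⟫_ℂ := by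
      intro x hx y hy
      exact closure_minimal (t := {x : E × E | ⟪x.2, y.1⟫_ℂ = ⟪x.1, y.2⟫_ℂ})
        (fun x hx => hsymm x hx y hy) (isClosed_eq (by fun_prop) (by fun_prop)) hx
    have hsymm'' : ∀ x ∈ G.topologicalClosure, ∀ y ∈ G.topologicalClosure,
        ⟪x.2, y.1⟫_ℂ = ⟪x.1, y.2⟫_ℂ := by
      intro x hx y hy
      exact closure_minimal (t := {y : E × E | ⟪x.2, y.1⟫_ℂ = ⟪x.1, y.2⟫_ℂ})
        (fun y hy => hsymm' x hx y hy) (isClosed_eq (by fun_prop) (by fun_prop)) hy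
    have h1 := approx (ψ, χ) fun y hy => by
      have hm : y - (ψ, χ) ∈ G.topologicalClosure :=
        sub_mem (G.le_topologicalClosure (hle hy)) h
      exact hsymm'' _ hm _ hm
    obtain ⟨x, hx, hlim⟩ := mem_closure_iff_seq_limit.1 h1
    exact hU.generator_closed (fun n => hder _ (hx n)) hlim
  · intro h
    refine Submodule.topologicalClosure_mono hle (approx (ψ, χ) fun y hy => ?_)
    have hd : HasDerivAt (fun t => U t (y - (ψ, χ)).1) (Complex.I • (y - (ψ, χ)).2) 0 := by
      simpa [smul_sub, Pi.sub_def] using (hder y hy).sub h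
    exact hU.generator_symm hd hd

/-- A symmetric operator whose restriction to a dense invariant subspace is the generator of `U`
there is essentially self-adjoint, and `U` is generated by its closure. -/
theorem isUnitaryGroupOf_closure {T : E →ₗ.[ℂ] E} {G₀ : Submodule ℂ (E × E)} (hle : G₀ ≤ T.graph)
    (hsymm : ∀ x ∈ T.graph, ∀ y ∈ T.graph, ⟪x.2, y.1⟫_ℂ = ⟪x.1, y.2⟫_ℂ)
    (hder : ∀ x ∈ G₀, HasDerivAt (fun t => U t x.1) (Complex.I • x.2) 0)
    (hinv : ∀ x ∈ G₀, ∀ t, (U t x.1, U t x.2) ∈ G₀)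
    (hdense : Dense (Prod.fst '' (G₀ : Set (E × E)))) : IsUnitaryGroupOf T.closure U := by
  have key := hU.mem_topologicalClosure_iff hle hsymm hder hinv hdense
  -- A limit pair `(0, χ)` of the graph says that the constant curve `0` has derivative `iχ`, so `χ
  -- = 0`.
  have hclos : T.IsClosable := by
    refine ⟨T.graph.topologicalClosure.toLinearPMap, ?_⟩
    rw [Submodule.toLinearPMap_graph_eq]
    rintro ⟨ψ, χ⟩ hx rfl
    have h1 := (key _ _).1 hx
    have h3 : HasDerivAt (fun t => U t 0) (0 : E) 0 := by
      simpa using hasDerivAt_const (0 : ℝ) (0 : E)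
    have h2 := h1.unique h3
    exact (smul_eq_zero.1 h2).resolve_left Complex.I_ne_zero
  refine ⟨hU.unitary_mem, hU.map_zero, hU.map_add, hU.continuous_apply, fun ψ χ => ?_⟩
  rw [← hclos.graph_closure_eq_closure_graph]
  exact key ψ χ

end IsUnitaryGroup

theorem IsUnitaryGroupOf.apply_mem_graph {A : E →ₗ.[ℂ] E} {U : ℝ → E →L[ℂ] E}
    (hU : IsUnitaryGroupOf A U) {ψ χ : E} (h : (ψ, χ) ∈ A.graph) (t : ℝ) :
    (U t ψ, U t χ) ∈ A.graph := by
  rw [hU.mem_graph_iff] at h ⊢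
  have h2 := ((U t).restrictScalars ℝ).hasFDerivAt.comp_hasDerivAt 0 h
  rw [ContinuousLinearMap.coe_restrictScalars', map_smul] at h2
  refine h2.congr_of_eventuallyEq (Eventually.of_forall fun s => ?_)
  change U s (U t ψ) = U t (U s ψ)
  rw [← hU.isUnitaryGroup.map_add_apply, ← hU.isUnitaryGroup.map_add_apply, add_comm]

/-- A densely defined operator generates at most one unitary group. -/
theorem IsUnitaryGroupOf.unique {A : E →ₗ.[ℂ] E} {U V : ℝ → E →L[ℂ] E}
    (hU : IsUnitaryGroupOf A U) (hV : IsUnitaryGroupOf A V) (hA : Dense (A.domain : Set E)) :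
    U = V := by
  have key : ∀ ψ ∈ A.domain, ∀ t, U t ψ = V t ψ := by
    intro ψ hψ t
    have hg : (ψ, A ⟨ψ, hψ⟩) ∈ A.graph := A.mem_graph ⟨ψ, hψ⟩
    -- `U s ψ` stays in the domain, so the two generator terms cancel and `V (-s) (U s ψ)` is
    -- constant.
    have hd : ∀ s, HasDerivAt (fun s => V (-s) (U s ψ)) 0 s := by
      intro s
      have h1 := hU.isUnitaryGroup.hasDerivAt_apply ((hU.mem_graph_iff _ _).1 hg) s
      have h2 := (hV.mem_graph_iff _ _).1 (hU.apply_mem_graph hg s)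
      simpa using hV.isUnitaryGroup.hasDerivAt_neg_apply_curve h1 h2
    have hc := is_const_of_deriv_eq_zero (fun s => (hd s).differentiableAt)
      (fun s => (hd s).deriv) t 0
    simp only [hU.map_zero, hV.map_zero, neg_zero, one_apply_eq_self] at hc
    rw [← hV.isUnitaryGroup.apply_neg_apply t (U t ψ), hc]
  funext t
  refine ContinuousLinearMap.ext fun ψ => ?_
  exact congrFun (Continuous.ext_on hA (U t).continuous (V t).continuous
    fun ψ hψ => key ψ hψ t) ψ

theorem IsUnitaryGroupOf.expI_eq {A : E →ₗ.[ℂ] E} {U : ℝ → E →L[ℂ] E}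
    (hU : IsUnitaryGroupOf A U) (hA : Dense (A.domain : Set E)) : expI A = U := by
  funext t
  have h : ∃ U : ℝ → E →L[ℂ] E, IsUnitaryGroupOf A U := ⟨U, hU⟩
  rw [expI, dif_pos h, h.choose_spec.unique hU hA]

theorem mem_unitary_of_norm_apply {U V : E →L[ℂ] E} (hU : ∀ ψ, ‖U ψ‖ = ‖ψ‖) (hUV : U * V = 1) :
    U ∈ unitary (E →L[ℂ] E) := by
  have h1 : star U * U = 1 := (ContinuousLinearMap.norm_map_iff_adjoint_comp_self U).1 hU
  have h2 : star U = V := by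
    calc star U = star U * (U * V) := by rw [hUV, mul_one]
      _ = V := by rw [← mul_assoc, h1, one_mul]
  rw [Unitary.mem_iff]
  exact ⟨h1, h2 ▸ hUV⟩

-- Isometry makes the approximation of `ψ` by vectors of `D` uniform in `t`.
omit [CompleteSpace E] in
theorem continuous_apply_of_dense {U : ℝ → E →L[ℂ] E} (hU : ∀ t ψ, ‖U t ψ‖ = ‖ψ‖) {D : Set E}
    (hD : Dense D) (h : ∀ ψ ∈ D, Continuous fun t => U t ψ) (ψ : E) :
    Continuous fun t => U t ψ := by
  refine continuous_of_uniform_approx_of_continuous fun u hu => ?_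
  obtain ⟨ε, hε, hεu⟩ := Metric.mem_uniformity_dist.1 hu
  obtain ⟨φ, hφ, hd⟩ := hD.exists_dist_lt ψ hε
  refine ⟨fun t => U t φ, h φ hφ, fun t => hεu ?_⟩
  rwa [dist_eq_norm, ← map_sub, hU, ← dist_eq_norm]

/-! ### Unitary groups defined by a total family of eigenvectors -/

section Eigenvectors

variable {ι : Type*} {e : ι → E} {w : ι → ℝ}

-- Expanding the square, the phases cancel between equal eigenvalues and the inner product vanishes
-- between different ones. No orthogonality inside an eigenspace is required, so degenerate families
-- such as products of raising operators are allowed.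
omit [CompleteSpace E] in
theorem norm_linearCombination_phase (horth : ∀ i j, w i ≠ w j → ⟪e i, e j⟫_ℂ = 0) (t : ℝ)
    (c : ι →₀ ℂ) :
    ‖Finsupp.linearCombination ℂ (fun i => Complex.exp (Complex.I * t * w i) • e i) c‖
      = ‖Finsupp.linearCombination ℂ e c‖ := by
  rw [@norm_eq_sqrt_re_inner ℂ, @norm_eq_sqrt_re_inner ℂ _ _ _ _ (Finsupp.linearCombination ℂ e c)]
  congr 2
  simp only [Finsupp.linearCombination_apply, Finsupp.sum, sum_inner, inner_sum]
  refine Finset.sum_congr rfl fun i _ => Finset.sum_congr rfl fun j _ => ?_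
  simp only [inner_smul_left, inner_smul_right]
  by_cases h : w j = w i
  · have h1 : (starRingEnd ℂ) (Complex.exp (Complex.I * t * w i)) *
        Complex.exp (Complex.I * t * w i) = 1 := by
      rw [← Complex.exp_conj, ← Complex.exp_add]
      simp
    rw [h]
    linear_combination c i * (starRingEnd ℂ) (c j) * ⟪e j, e i⟫_ℂ * h1
  · simp [horth j i h]

/-- Orthogonal eigenvectors with dense span diagonalise a unitary group. -/
theorem exists_isUnitaryGroup_of_eigenvectors
    (horth : ∀ i j, w i ≠ w j → ⟪e i, e j⟫_ℂ = 0)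
    (hdense : Dense (Submodule.span ℂ (Set.range e) : Set E)) :
    ∃ U : ℝ → E →L[ℂ] E, IsUnitaryGroup U ∧
      ∀ t i, U t (e i) = Complex.exp (Complex.I * t * w i) • e i := by
  have hdr : DenseRange (Finsupp.linearCombination ℂ e) := by
    rw [DenseRange, ← LinearMap.coe_range, Finsupp.range_linearCombination]
    exact hdense
  have hn := norm_linearCombination_phase horth
  let f : ℝ → (ι →₀ ℂ) →ₗ[ℂ] E := fun t =>
    Finsupp.linearCombination ℂ (fun i => Complex.exp (Complex.I * t * w i) • e i)
  -- The `e i` may be linearly dependent; the equality of norms `hn` makes `f t` vanish wherever the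
  -- plain combination does, so it descends to the span and extends continuously.
  let U : ℝ → E →L[ℂ] E := fun t => (f t).extendOfNorm (Finsupp.linearCombination ℂ e)
  have hUf : ∀ t c, U t (Finsupp.linearCombination ℂ e c) = f t c := fun t c =>
    LinearMap.extendOfNorm_eq hdr ⟨1, fun c => by rw [one_mul]; exact (hn t c).le⟩ c
  have hUe : ∀ t i, U t (e i) = Complex.exp (Complex.I * t * w i) • e i := by
    intro t i
    simpa [f] using hUf t (Finsupp.single i 1)
  have hext : ∀ A B : E →L[ℂ] E, (∀ i, A (e i) = B (e i)) → A = B := fun A B h =>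
    ContinuousLinearMap.ext_on hdense (by rintro _ ⟨i, rfl⟩; exact h i)
  have hnorm : ∀ t ψ, ‖U t ψ‖ = ‖ψ‖ := by
    intro t ψ
    refine hdr.induction_on (p := fun ψ => ‖U t ψ‖ = ‖ψ‖) ψ
      (isClosed_eq (by fun_prop) (by fun_prop)) fun c => ?_
    rw [hUf]
    exact hn t c
  have hadd : ∀ s t, U (s + t) = U s * U t := by
    intro s t
    refine hext _ _ fun i => ?_
    change _ = U s (U t (e i))
    rw [hUe, hUe, map_smul, hUe, smul_smul, ← Complex.exp_add]
    congr 2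
    push_cast
    ring
  have hzero : U 0 = 1 := hext _ _ fun i => by simp [hUe]
  refine ⟨U, ⟨fun t => mem_unitary_of_norm_apply (V := U (-t)) (hnorm t) ?_, hzero, hadd,
    continuous_apply_of_dense hnorm hdr ?_⟩, hUe⟩
  · rw [← hadd, add_neg_cancel, hzero]
  · rintro _ ⟨c, rfl⟩
    have : (fun t => U t (Finsupp.linearCombination ℂ e c)) = fun t : ℝ =>
        ∑ i ∈ c.support, c i • Complex.exp (Complex.I * t * w i) • e i := by
      funext t
      rw [hUf]
      rfl
    rw [this]
    fun_prop

/-- A symmetric operator with a total family of eigenvectors is essentially self-adjoint, and the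
group generated by its closure acts diagonally on the eigenvectors. -/
theorem isUnitaryGroupOf_expI_of_eigenvectors {T : E →ₗ.[ℂ] E}
    (hsymm : ∀ x ∈ T.graph, ∀ y ∈ T.graph, ⟪x.2, y.1⟫_ℂ = ⟪x.1, y.2⟫_ℂ)
    (he : ∀ i, (e i, (w i : ℂ) • e i) ∈ T.graph)
    (hdense : Dense (Submodule.span ℂ (Set.range e) : Set E)) :
    IsUnitaryGroupOf T.closure (expI T.closure) ∧
      ∀ t i, expI T.closure t (e i) = Complex.exp (Complex.I * t * w i) • e i := by
  have horth : ∀ i j, w i ≠ w j → ⟪e i, e j⟫_ℂ = 0 := by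
    intro i j hij
    have h := hsymm _ (he i) _ (he j)
    simp only [inner_smul_left, inner_smul_right, Complex.conj_ofReal] at h
    have h2 : ((w i : ℂ) - w j) * ⟪e i, e j⟫_ℂ = 0 := by linear_combination h
    exact (mul_eq_zero.1 h2).resolve_left (sub_ne_zero.2 (by exact_mod_cast hij))
  obtain ⟨U, hU, hUe⟩ := exists_isUnitaryGroup_of_eigenvectors horth hdense
  have hder : ∀ i, HasDerivAt (fun t => U t (e i)) (Complex.I • (w i : ℂ) • e i) 0 := by
    intro i
    simp only [hUe]
    have h1 : HasDerivAt (fun t : ℝ => Complex.exp (Complex.I * t * w i)) (Complex.I * w i) 0 := by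
      have := (((hasDerivAt_id (0 : ℝ)).ofReal_comp.const_mul Complex.I).mul_const (w i : ℂ)).cexp
      simpa using this
    rw [smul_smul]
    exact h1.smul_const (e i)
  have hG : IsUnitaryGroupOf T.closure U := by
    -- The invariant core is the span of the eigenpairs, on which `U t` acts by scalars.
    refine hU.isUnitaryGroupOf_closure
      (G₀ := Submodule.span ℂ (Set.range fun i => (e i, (w i : ℂ) • e i))) ?_ hsymm ?_ ?_ ?_
    · rw [Submodule.span_le]
      rintro _ ⟨i, rfl⟩
      exact he i
    · intro x hx
      induction hx using Submodule.span_induction with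
      | mem x hx => obtain ⟨i, rfl⟩ := hx; exact hder i
      | zero => simpa using hasDerivAt_const (0 : ℝ) (0 : E)
      | add x y _ _ hx hy => simpa [Pi.add_def] using hx.add hy
      | smul c x _ hx => simpa [smul_comm c Complex.I, Pi.smul_def] using hx.const_smul c
    · intro x hx t
      induction hx using Submodule.span_induction with
      | mem x hx =>
        obtain ⟨i, rfl⟩ := hx
        simp only [map_smul, hUe]
        rw [smul_comm, ← Prod.smul_mk]
        exact Submodule.smul_mem _ _ (Submodule.subset_span ⟨i, rfl⟩)
      | zero =>
        simp only [Prod.fst_zero, Prod.snd_zero, map_zero]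
        exact Submodule.zero_mem _
      | add x y _ _ hx hy => simpa using add_mem hx hy
      | smul c x _ hx => simpa using Submodule.smul_mem _ c hx
    · have : Prod.fst '' ((Submodule.span ℂ (Set.range fun i => (e i, (w i : ℂ) • e i)) :
          Submodule ℂ (E × E)) : Set (E × E)) = Submodule.span ℂ (Set.range e) := by
        rw [← LinearMap.coe_fst (R := ℂ), ← Submodule.map_coe, Submodule.map_span,
          ← Set.range_comp]
        rfl
      rw [this]
      exact hdense
  have hdom : Dense (T.closure.domain : Set E) := by
    refine hdense.mono ?_
    rw [SetLike.coe_subset_coe, Submodule.span_le]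
    rintro _ ⟨i, rfl⟩
    exact T.le_closure.1 (LinearPMap.mem_domain_of_mem_graph (he i))
  rw [hG.expI_eq hdom]
  exact ⟨hG, hUe⟩

end Eigenvectors

end UnitaryGroupTheory

/-! ### Operators on Schwartz functions as operators on `L²` -/

section SchwartzOperators

variable {d L : ℕ}

/-- The embedding of the Schwartz functions into `L²`. -/
def toL2 : 𝓢(Config d L, ℂ) →ₗ[ℂ] HilbertL d L :=
  (SchwartzMap.toLpCLM ℂ ℂ 2 (volume : Measure (Config d L))).toLinearMap

theorem denseRange_toL2 : DenseRange (toL2 : 𝓢(Config d L, ℂ) → HilbertL d L) :=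
  SchwartzMap.denseRange_toLpCLM (E := Config d L) (F := ℂ) (μ := volume) ENNReal.ofNat_ne_top

theorem inner_toL2 (φ χ : 𝓢(Config d L, ℂ)) :
    ⟪toL2 φ, toL2 χ⟫_ℂ = ∫ q, ⟪φ q, χ q⟫_ℂ :=
  SchwartzMap.inner_toL2_toL2_eq φ χ volume

theorem norm_toL2_sq (φ : 𝓢(Config d L, ℂ)) : ‖toL2 φ‖ ^ 2 = ∫ q, ‖φ q‖ ^ 2 := by
  have h : ((‖toL2 φ‖ ^ 2 : ℝ) : ℂ) = ((∫ q, ‖φ q‖ ^ 2 : ℝ) : ℂ) := by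
    rw [Complex.ofReal_pow, ← integral_complex_ofReal]
    have := inner_self_eq_norm_sq_to_K (𝕜 := ℂ) (toL2 φ)
    rw [inner_toL2] at this
    refine Eq.trans this.symm (integral_congr_ae (Eventually.of_forall fun q => ?_))
    simp [inner_self_eq_norm_sq_to_K]
  exact_mod_cast h

theorem mem_graph_schwartzPMap {T : Module.End ℂ 𝓢(Config d L, ℂ)} {x : HilbertL d L × HilbertL d L} :
    x ∈ (schwartzPMap T).graph ↔ ∃ φ, x = (toL2 φ, toL2 (T φ)) := by
  have hval : ∀ φ (hφ : toL2 φ ∈ (schwartzPMap T).domain),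
      schwartzPMap T ⟨toL2 φ, hφ⟩ = toL2 (T φ) := by
    intro φ hφ
    have : (LinearEquiv.ofInjective
        (SchwartzMap.toLpCLM ℂ ℂ 2 (volume : Measure (Config d L))).toLinearMap
        (SchwartzMap.injective_toLp 2 (volume : Measure (Config d L)))).symm ⟨toL2 φ, hφ⟩ = φ := by
      rw [LinearEquiv.symm_apply_eq]
      rfl
    change toL2 (T _) = _
    exact congrArg (fun φ => toL2 (T φ)) this
  rw [LinearPMap.mem_graph_iff]
  constructor
  · rintro ⟨⟨_, ⟨φ, rfl⟩⟩, h1, h2⟩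
    exact ⟨φ, Prod.ext h1.symm (h2.symm.trans (hval φ _))⟩
  · rintro ⟨φ, rfl⟩
    exact ⟨⟨toL2 φ, ⟨φ, rfl⟩⟩, rfl, hval φ _⟩

theorem toL2_mem_graph (T : Module.End ℂ 𝓢(Config d L, ℂ)) (φ : 𝓢(Config d L, ℂ)) :
    (toL2 φ, toL2 (T φ)) ∈ (schwartzPMap T).graph :=
  mem_graph_schwartzPMap.2 ⟨φ, rfl⟩

/-- Density is what makes the group chosen in `expI` unique. No closability is needed, since
`le_closure` holds for every partial map. -/
theorem dense_domain_closure_schwartzPMap (T : Module.End ℂ 𝓢(Config d L, ℂ)) :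
    Dense ((schwartzPMap T).closure.domain : Set (HilbertL d L)) := by
  refine denseRange_toL2.mono ?_
  rintro _ ⟨φ, rfl⟩
  exact (schwartzPMap T).le_closure.1 (LinearPMap.mem_domain_of_mem_graph (toL2_mem_graph T φ))

/-- `T` is symmetric with respect to the inner product of `L²`. -/
def IsSymmOp (T : Module.End ℂ 𝓢(Config d L, ℂ)) : Prop :=
  ∀ φ χ, ⟪toL2 (T φ), toL2 χ⟫_ℂ = ⟪toL2 φ, toL2 (T χ)⟫_ℂ

namespace IsSymmOp

variable {S T : Module.End ℂ 𝓢(Config d L, ℂ)}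

theorem zero : IsSymmOp (0 : Module.End ℂ 𝓢(Config d L, ℂ)) := fun φ χ => by simp

theorem add (hS : IsSymmOp S) (hT : IsSymmOp T) : IsSymmOp (S + T) := fun φ χ => by
  simp [inner_add_left, inner_add_right, hS φ χ, hT φ χ]

theorem smul (hT : IsSymmOp T) (c : ℝ) : IsSymmOp ((c : ℂ) • T) := fun φ χ => by
  rw [LinearMap.smul_apply, LinearMap.smul_apply, map_smul, map_smul, inner_smul_left,
    inner_smul_right, Complex.conj_ofReal, hT φ χ]

theorem sq (hT : IsSymmOp T) : IsSymmOp (T ^ 2) := fun φ χ => by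
  rw [pow_two, Module.End.mul_apply, Module.End.mul_apply, hT, hT]

theorem sum {ι : Type*} {s : Finset ι} {T : ι → Module.End ℂ 𝓢(Config d L, ℂ)}
    (hT : ∀ i ∈ s, IsSymmOp (T i)) : IsSymmOp (∑ i ∈ s, T i) :=
  Finset.sum_induction _ _ (fun _ _ => add) zero hT

theorem graph_symm (hT : IsSymmOp T) : ∀ x ∈ (schwartzPMap T).graph,
    ∀ y ∈ (schwartzPMap T).graph, ⟪x.2, y.1⟫_ℂ = ⟪x.1, y.2⟫_ℂ := by
  intro x hx y hy
  obtain ⟨φ, rfl⟩ := mem_graph_schwartzPMap.1 hx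
  obtain ⟨χ, rfl⟩ := mem_graph_schwartzPMap.1 hy
  exact hT φ χ

end IsSymmOp

theorem isSymmOp_posOp (x : Box d L) : IsSymmOp (posOp x) := by
  intro φ χ
  rw [inner_toL2, inner_toL2]
  refine integral_congr_ae (Eventually.of_forall fun q => ?_)
  simp only [posOp_apply, RCLike.inner_apply, map_mul, Complex.conj_ofReal]
  ring

theorem momOp_eq (x : Box d L) (φ : 𝓢(Config d L, ℂ)) :
    momOp x φ = (-Complex.I) • ∂_{(EuclideanSpace.single x (1 : ℝ) : Config d L)} φ := rfl

/-- Integration by parts: its minus sign is compensated by conjugating the factor `-i`. -/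
theorem isSymmOp_momOp (x : Box d L) : IsSymmOp (momOp x) := by
  intro φ χ
  rw [momOp_eq, momOp_eq, map_smul, map_smul, inner_smul_left, inner_smul_right, inner_toL2,
    inner_toL2]
  have h := SchwartzMap.integral_bilinear_lineDerivOp_right_eq_neg_left (μ := volume) φ χ
    ((ContinuousLinearMap.mul ℝ ℂ).comp (Complex.conjCLE : ℂ →L[ℝ] ℂ))
    (EuclideanSpace.single x (1 : ℝ) : Config d L)
  simp only [RCLike.inner_apply']
  simp only [ContinuousLinearMap.comp_apply, ContinuousLinearMap.mul_apply',
    ContinuousLinearEquiv.coe_coe, Complex.conjCLE_apply] at h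
  rw [h]
  simp

end SchwartzOperators

/-! ### Differentiation in `L²` -/

section Differentiation

variable {d L : ℕ}

/-- The curve `u` in the complex space `E` has derivative `u'` at `t`, with respect to the real
structure obtained by restriction of scalars. -/
abbrev CurveHasDerivAt {E : Type*} [NormedAddCommGroup E] [NormedSpace ℂ E] (u : ℝ → E) (u' : E)
    (t : ℝ) : Prop :=
  HasDerivAt u u' t

/-- Difference quotients with complex scalars can be pulled through the complex-linear map `toL2`.
-/
theorem curveHasDerivAt_iff {E : Type*} [NormedAddCommGroup E] [NormedSpace ℂ E] {u : ℝ → E}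
    {u' : E} {t : ℝ} : CurveHasDerivAt u u' t ↔
      Tendsto (fun s : ℝ => ((s - t)⁻¹ : ℂ) • (u s - u t)) (𝓝[≠] t) (𝓝 u') := by
  rw [CurveHasDerivAt, hasDerivAt_iff_tendsto_slope]
  refine tendsto_congr fun s => ?_
  rw [slope_def_module]
  norm_cast

/-- Dominated differentiation in `L²`. -/
theorem hasDerivAt_toL2 {F : ℝ → 𝓢(Config d L, ℂ)} {D : ℝ → Config d L → ℂ}
    {F' : 𝓢(Config d L, ℂ)} {t δ : ℝ} {g : Config d L → ℝ} (hδ : 0 < δ)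
    (hF : ∀ q, ∀ s ∈ Metric.ball t δ, HasDerivAt (fun s => F s q) (D s q) s)
    (hD : ∀ q, ∀ s ∈ Metric.ball t δ, ‖D s q‖ ≤ g q) (hg : Integrable fun q => g q ^ 2)
    (hF' : ∀ q, F' q = D t q) :
    CurveHasDerivAt (fun s => toL2 (F s)) (toL2 F') t := by
  rw [curveHasDerivAt_iff, tendsto_iff_norm_sub_tendsto_zero]
  have ht : t ∈ Metric.ball t δ := Metric.mem_ball_self hδ
  have key : Tendsto (fun s : ℝ => ∫ q, ‖(((s - t)⁻¹ : ℂ) • (F s - F t) - F') q‖ ^ 2) (𝓝[≠] t)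
      (𝓝 (∫ _ : Config d L, (0 : ℝ))) := by
    -- By the mean value inequality the difference quotient is at most `g`, and so is `F'`; the
    -- squared error is thus at most `(2g)²`.
    refine tendsto_integral_filter_of_dominated_convergence (fun q => 4 * g q ^ 2) ?_ ?_
      (hg.const_mul 4) ?_
    · exact Eventually.of_forall fun s => (by fun_prop : Continuous _).aestronglyMeasurable
    · have hev : ∀ᶠ s in 𝓝[≠] t, s ∈ Metric.ball t δ ∧ s ≠ t :=
        (eventually_nhdsWithin_of_eventually_nhds (Metric.ball_mem_nhds t hδ)).and
          eventually_mem_nhdsWithin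
      filter_upwards [hev] with s hs
      refine Eventually.of_forall fun q => ?_
      have h1 : ‖F s q - F t q‖ ≤ g q * ‖s - t‖ :=
        (convex_ball t δ).norm_image_sub_le_of_norm_hasDerivWithin_le
          (fun s hs => (hF q s hs).hasDerivWithinAt) (fun s hs => hD q s hs) ht hs.1
      have h2 : 0 < ‖s - t‖ := norm_pos_iff.2 (sub_ne_zero.2 hs.2)
      have h3 : ‖(((s - t)⁻¹ : ℂ) • (F s - F t) - F') q‖ ≤ 2 * g q := by
        have e : (((s - t)⁻¹ : ℂ) • (F s - F t) - F') q
            = ((s - t)⁻¹ : ℂ) * (F s q - F t q) - F' q := by simp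
        rw [e]
        refine (norm_sub_le _ _).trans ?_
        have h4 : ‖((s - t)⁻¹ : ℂ) * (F s q - F t q)‖ ≤ g q := by
          rw [norm_mul, norm_inv, ← Complex.ofReal_sub, Complex.norm_real, inv_mul_le_iff₀ h2,
            mul_comm]
          exact h1
        have h5 : ‖F' q‖ ≤ g q := by rw [hF']; exact hD q t ht
        linarith
      rw [norm_pow, norm_norm]
      calc _ ≤ (2 * g q) ^ 2 := pow_le_pow_left₀ (norm_nonneg _) h3 2
        _ = _ := by ring
    · refine Eventually.of_forall fun q => ?_
      have h1 := (hasDerivAt_iff_tendsto_slope.1 (hF q t ht)).sub_const (F' q)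
      rw [hF' q, sub_self] at h1
      have h2 := (h1.norm).pow 2
      rw [norm_zero, zero_pow two_ne_zero] at h2
      refine h2.congr fun s => ?_
      simp [slope_def_module, hF']
  rw [integral_zero] at key
  have h2 := key.sqrt
  rw [Real.sqrt_zero] at h2
  refine h2.congr fun s => ?_
  rw [← norm_toL2_sq, Real.sqrt_sq (norm_nonneg _), map_sub, map_smul, map_sub]

end Differentiation

/-! ### Weyl operators -/

section Weyl

variable {d L : ℕ}

theorem iteratedDeriv_cexp_I_mul (n : ℕ) :
    iteratedDeriv n (fun s : ℝ => Complex.exp (Complex.I * s))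
      = fun s : ℝ => Complex.I ^ n * Complex.exp (Complex.I * s) := by
  induction n with
  | zero => simp
  | succ n ih =>
    rw [iteratedDeriv_succ, ih]
    funext s
    have h : HasDerivAt (fun s : ℝ => Complex.exp (Complex.I * s))
        (Complex.exp (Complex.I * s) * Complex.I) s := by
      simpa using ((hasDerivAt_id s).ofReal_comp.const_mul Complex.I).cexp
    rw [(h.const_mul _).deriv]
    ring

theorem hasTemperateGrowth_cexp_I_mul :
    Function.HasTemperateGrowth fun s : ℝ => Complex.exp (Complex.I * s) := by
  refine ⟨?_, fun n => ⟨0, 1, fun s => ?_⟩⟩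
  · exact (contDiff_const.mul Complex.ofRealCLM.contDiff).cexp
  · rw [norm_iteratedFDeriv_eq_norm_iteratedDeriv, iteratedDeriv_cexp_I_mul]
    simp [Complex.norm_exp]

theorem hasTemperateGrowth_phase (a : Config d L) (c : ℝ) :
    Function.HasTemperateGrowth
      fun q : Config d L => Complex.exp (Complex.I * ((⟪a, q⟫_ℝ + c : ℝ) : ℂ)) :=
  hasTemperateGrowth_cexp_I_mul.comp
    ((innerSL ℝ a).hasTemperateGrowth.add (Function.HasTemperateGrowth.const c))

/-- The operator `φ ↦ exp (i (a · q + c)) φ (q + b)` on Schwartz functions. -/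
def weylSch (a b : Config d L) (c : ℝ) : Module.End ℂ 𝓢(Config d L, ℂ) :=
  (SchwartzMap.smulLeftCLM ℂ fun q : Config d L =>
      Complex.exp (Complex.I * ((⟪a, q⟫_ℝ + c : ℝ) : ℂ))).toLinearMap ∘ₗ
    (SchwartzMap.compSubConstCLM ℂ (-b)).toLinearMap

theorem weylSch_apply (a b : Config d L) (c : ℝ) (φ : 𝓢(Config d L, ℂ)) (q : Config d L) :
    weylSch a b c φ q = Complex.exp (Complex.I * ((⟪a, q⟫_ℝ + c : ℝ) : ℂ)) * φ (q + b) := by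
  refine (SchwartzMap.smulLeftCLM_apply_apply (hasTemperateGrowth_phase a c) _ q).trans ?_
  rw [smul_eq_mul, ContinuousLinearMap.coe_coe, SchwartzMap.compSubConstCLM_apply, sub_neg_eq_add]

theorem norm_cexp_I_mul (s : ℝ) : ‖Complex.exp (Complex.I * (s : ℂ))‖ = 1 := by
  simp [Complex.norm_exp]

theorem norm_toL2_weylSch (a b : Config d L) (c : ℝ) (φ : 𝓢(Config d L, ℂ)) :
    ‖toL2 (weylSch a b c φ)‖ = ‖toL2 φ‖ := by
  refine (sq_eq_sq₀ (norm_nonneg _) (norm_nonneg _)).1 ?_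
  rw [norm_toL2_sq, norm_toL2_sq, ← integral_add_right_eq_self (fun q => ‖φ q‖ ^ 2) b]
  refine integral_congr_ae (Eventually.of_forall fun q => ?_)
  simp only [weylSch_apply, norm_mul, norm_cexp_I_mul, one_mul]

/-- The extension of `weylSch` to `L²`. -/
def weylL2 (a b : Config d L) (c : ℝ) : HilbertL d L →L[ℂ] HilbertL d L :=
  (toL2 ∘ₗ weylSch a b c).extendOfNorm toL2

theorem weylL2_toL2 (a b : Config d L) (c : ℝ) (φ : 𝓢(Config d L, ℂ)) :
    weylL2 a b c (toL2 φ) = toL2 (weylSch a b c φ) :=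
  LinearMap.extendOfNorm_eq denseRange_toL2
    ⟨1, fun φ => by rw [one_mul]; exact (norm_toL2_weylSch a b c φ).le⟩ φ

theorem clm_ext_toL2 {A B : HilbertL d L →L[ℂ] HilbertL d L}
    (h : ∀ φ : 𝓢(Config d L, ℂ), A (toL2 φ) = B (toL2 φ)) : A = B :=
  ContinuousLinearMap.ext fun ψ => congrFun
    (denseRange_toL2.equalizer A.continuous B.continuous (funext h)) ψ

theorem norm_weylL2_apply (a b : Config d L) (c : ℝ) (ψ : HilbertL d L) :
    ‖weylL2 a b c ψ‖ = ‖ψ‖ := by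
  refine denseRange_toL2.induction_on (p := fun ψ => ‖weylL2 a b c ψ‖ = ‖ψ‖) ψ
    (isClosed_eq (by fun_prop) (by fun_prop)) fun φ => ?_
  rw [weylL2_toL2, norm_toL2_weylSch]

/-- The Weyl relation: translating the phase of the right factor by `b` produces the cocycle `⟪a',
b⟫`. -/
theorem weylL2_mul (a b a' b' : Config d L) (c c' : ℝ) :
    weylL2 a b c * weylL2 a' b' c' = weylL2 (a + a') (b + b') (c + c' + ⟪a', b⟫_ℝ) := by
  refine clm_ext_toL2 fun φ => ?_
  change weylL2 a b c (weylL2 a' b' c' (toL2 φ)) = _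
  rw [weylL2_toL2, weylL2_toL2, weylL2_toL2]
  congr 1
  ext q
  simp only [weylSch_apply, ← mul_assoc, ← Complex.exp_add, inner_add_left, inner_add_right,
    add_assoc]
  congr 2
  push_cast
  ring

theorem weylL2_zero : weylL2 (0 : Config d L) 0 0 = 1 := by
  refine clm_ext_toL2 fun φ => ?_
  rw [weylL2_toL2, one_apply_eq_self]
  congr 1
  ext q
  simp [weylSch_apply]

theorem weylL2_add_phase (a b : Config d L) (c c' : ℝ) :
    weylL2 a b (c + c') = Complex.exp (Complex.I * c') • weylL2 a b c := by
  refine clm_ext_toL2 fun φ => ?_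
  rw [smul_apply, weylL2_toL2, weylL2_toL2, ← map_smul]
  congr 1
  ext q
  rw [smul_apply, weylSch_apply, weylSch_apply, smul_eq_mul, ← mul_assoc, ← Complex.exp_add]
  congr 2
  push_cast
  ring

theorem hasLineDerivAt_schwartz (φ : 𝓢(Config d L, ℂ)) (q v : Config d L) :
    HasLineDerivAt ℝ φ (lineDeriv ℝ φ q v) q v :=
  (φ.differentiableAt).lineDifferentiableAt.hasLineDerivAt

/-- Together with `momOp_weylSch` this says that conjugation by a displacement shifts `q` by `-b`
and `p` by `a`. Every later commutator with a displacement is computed from these two rules. -/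
theorem posOp_weylSch (a b : Config d L) (c : ℝ) (x : Box d L) (φ : 𝓢(Config d L, ℂ)) :
    posOp x (weylSch a b c φ) = weylSch a b c (posOp x φ) - (b x : ℂ) • weylSch a b c φ := by
  ext q
  simp only [posOp_apply, weylSch_apply, sub_apply, smul_apply, smul_eq_mul, PiLp.add_apply]
  push_cast
  ring

theorem momOp_weylSch (a b : Config d L) (c : ℝ) (x : Box d L) (φ : 𝓢(Config d L, ℂ)) :
    momOp x (weylSch a b c φ) = weylSch a b c (momOp x φ) + (a x : ℂ) • weylSch a b c φ := by
  ext q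
  simp only [momOp_apply, weylSch_apply, add_apply, smul_apply, smul_eq_mul]
  set v : Config d L := EuclideanSpace.single x 1 with hv
  have h1 : HasDerivAt (fun t : ℝ => φ (q + b + t • v)) (lineDeriv ℝ φ (q + b) v) 0 :=
    hasLineDerivAt_schwartz φ (q + b) v
  have h2 : HasDerivAt (fun t : ℝ => Complex.exp (Complex.I * ((⟪a, q + t • v⟫_ℝ + c : ℝ) : ℂ)))
      (Complex.exp (Complex.I * ((⟪a, q⟫_ℝ + c : ℝ) : ℂ)) * (Complex.I * a x)) 0 := by
    have h3 : HasDerivAt (fun t : ℝ => ⟪a, q + t • v⟫_ℝ + c) (a x) 0 := by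
      have : (fun t : ℝ => ⟪a, q + t • v⟫_ℝ + c) = fun t : ℝ => (⟪a, q⟫_ℝ + c) + t * a x := by
        funext t
        rw [inner_add_right, inner_smul_right, hv, EuclideanSpace.inner_single_right]
        simp
        ring
      rw [this]
      simpa using ((hasDerivAt_id (0 : ℝ)).mul_const (a x)).const_add (⟪a, q⟫_ℝ + c)
    simpa using (h3.ofReal_comp.const_mul Complex.I).cexp
  have h4 : HasLineDerivAt ℝ (weylSch a b c φ)
      (Complex.exp (Complex.I * ((⟪a, q⟫_ℝ + c : ℝ) : ℂ)) * (Complex.I * a x) * φ (q + b)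
        + Complex.exp (Complex.I * ((⟪a, q⟫_ℝ + c : ℝ) : ℂ)) * lineDeriv ℝ φ (q + b) v) q v := by
    unfold HasLineDerivAt
    have h5 := h2.mul h1
    simp only [zero_smul, add_zero] at h5
    refine h5.congr_of_eventuallyEq (Eventually.of_forall fun t => ?_)
    simp only [weylSch_apply, Pi.mul_apply]
    congr 2
    abel
  rw [h4.lineDeriv]
  linear_combination (-(Complex.exp (Complex.I * ((⟪a, q⟫_ℝ + c : ℝ) : ℂ)) * (a x : ℂ) *
    φ (q + b))) * Complex.I_mul_I

/-- The operator `∑ a_x q_x`. -/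
def posV (a : Config d L) : Module.End ℂ 𝓢(Config d L, ℂ) := ∑ x, (a x : ℂ) • posOp x

/-- The operator `∑ b_x p_x`. -/
def momV (b : Config d L) : Module.End ℂ 𝓢(Config d L, ℂ) := ∑ x, (b x : ℂ) • momOp x

theorem posV_apply (a : Config d L) (φ : 𝓢(Config d L, ℂ)) (q : Config d L) :
    posV a φ q = (⟪a, q⟫_ℝ : ℂ) * φ q := by
  simp only [posV, LinearMap.sum_apply, LinearMap.smul_apply, sum_apply, smul_apply, posOp_apply,
    smul_eq_mul, PiLp.inner_apply, RCLike.inner_apply, conj_trivial]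
  push_cast
  rw [Finset.sum_mul]
  exact Finset.sum_congr rfl fun x _ => by ring

theorem momV_apply (b : Config d L) (φ : 𝓢(Config d L, ℂ)) (q : Config d L) :
    momV b φ q = -Complex.I * fderiv ℝ φ q b := by
  have hb : b = ∑ x, b x • (EuclideanSpace.single x (1 : ℝ) : Config d L) := by
    conv_lhs => rw [← (EuclideanSpace.basisFun (Box d L) ℝ).sum_repr b]
    simp
  conv_rhs => rw [hb]
  simp only [momV, LinearMap.sum_apply, LinearMap.smul_apply, sum_apply, smul_apply, momOp_apply,
    smul_eq_mul, map_sum, map_smul, Finset.mul_sum, φ.differentiableAt.lineDeriv_eq_fderiv]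
  refine Finset.sum_congr rfl fun x _ => ?_
  rw [Complex.real_smul]
  ring

theorem posV_weylSch (u a b : Config d L) (c : ℝ) (φ : 𝓢(Config d L, ℂ)) :
    posV u (weylSch a b c φ) = weylSch a b c (posV u φ) - (⟪u, b⟫_ℝ : ℂ) • weylSch a b c φ := by
  simp only [posV, LinearMap.sum_apply, LinearMap.smul_apply, posOp_weylSch, map_sum, map_smul,
    smul_sub, Finset.sum_sub_distrib, smul_smul, ← Finset.sum_smul]
  congr 2
  simp [PiLp.inner_apply, mul_comm]

theorem momV_weylSch (u a b : Config d L) (c : ℝ) (φ : 𝓢(Config d L, ℂ)) :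
    momV u (weylSch a b c φ) = weylSch a b c (momV u φ) + (⟪u, a⟫_ℝ : ℂ) • weylSch a b c φ := by
  simp only [momV, LinearMap.sum_apply, LinearMap.smul_apply, momOp_weylSch, map_sum, map_smul,
    smul_add, Finset.sum_add_distrib, smul_smul, ← Finset.sum_smul]
  congr 2
  simp [PiLp.inner_apply, mul_comm]

theorem isSymmOp_posV (a : Config d L) : IsSymmOp (posV a) :=
  IsSymmOp.sum fun x _ => (isSymmOp_posOp x).smul _

theorem isSymmOp_momV (b : Config d L) : IsSymmOp (momV b) :=
  IsSymmOp.sum fun x _ => (isSymmOp_momOp x).smul _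

/-- The bound dominating the derivative of a curve of displaced Schwartz functions. -/
theorem exists_bound_displaced (φ : 𝓢(Config d L, ℂ)) {M : ℝ} (hM : 0 ≤ M) :
    ∃ g : Config d L → ℝ, (Integrable fun q => g q ^ 2) ∧
      ∀ q b : Config d L, ‖b‖ ≤ M →
        M * (1 + ‖q‖) * ‖φ (q + b)‖ + M * ‖fderiv ℝ φ (q + b)‖ ≤ g q := by
  -- The square of `(1 + ‖q‖)^(-N)` is integrable because `2N` exceeds the dimension; decay of order
  -- `N + 1` is requested since one power is spent on the factor `1 + ‖q‖`.
  set N : ℕ := Module.finrank ℝ (Config d L) + 1 with hN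
  set K : ℝ := 2 ^ (N + 1) *
    (Finset.Iic (N + 1, 1)).sup (fun m => SchwartzMap.seminorm ℝ m.1 m.2) φ with hK
  have h0 : ∀ y, (1 + ‖y‖) ^ (N + 1) * ‖φ y‖ ≤ K := fun y => by
    have := SchwartzMap.one_add_le_sup_seminorm_apply (𝕜 := ℝ) (m := (N + 1, 1)) (k := N + 1)
      (n := 0) le_rfl (by norm_num) φ y
    rwa [norm_iteratedFDeriv_zero] at this
  have h1 : ∀ y, (1 + ‖y‖) ^ (N + 1) * ‖fderiv ℝ φ y‖ ≤ K := fun y => by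
    have := SchwartzMap.one_add_le_sup_seminorm_apply (𝕜 := ℝ) (m := (N + 1, 1)) (k := N + 1)
      (n := 1) le_rfl le_rfl φ y
    rwa [norm_iteratedFDeriv_one] at this
  refine ⟨fun q => 2 * M * (1 + M) ^ (N + 1) * K * (1 + ‖q‖) ^ (-(N : ℝ)), ?_, ?_⟩
  · have hint : Integrable fun q : Config d L => (1 + ‖q‖) ^ (-((2 * N : ℕ) : ℝ)) := by
      refine integrable_one_add_norm ?_
      rw [hN]
      push_cast
      have : (0 : ℝ) ≤ Module.finrank ℝ (Config d L) := by positivity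
      linarith
    refine (hint.const_mul ((2 * M * (1 + M) ^ (N + 1) * K) ^ 2)).congr
      (Eventually.of_forall fun q => ?_)
    have hq : (0 : ℝ) ≤ 1 + ‖q‖ := by positivity
    simp only [Real.rpow_neg hq, Real.rpow_natCast]
    rw [pow_mul', mul_pow _ ((1 + ‖q‖) ^ N)⁻¹, inv_pow]
  · intro q b hb
    set y := q + b with hy
    have hq : (1 : ℝ) + ‖q‖ ≤ (1 + M) * (1 + ‖y‖) := by
      have : ‖q‖ ≤ ‖y‖ + ‖b‖ := by
        have := norm_sub_le y b
        rwa [hy, add_sub_cancel_right] at this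
      nlinarith [norm_nonneg y]
    have hq0 : (0 : ℝ) < 1 + ‖q‖ := by positivity
    have hpow : (1 + ‖q‖) ^ (N + 1) ≤ (1 + M) ^ (N + 1) * (1 + ‖y‖) ^ (N + 1) := by
      rw [← mul_pow]
      exact pow_le_pow_left₀ hq0.le hq _
    have e0 : (1 + ‖q‖) ^ (N + 1) * ‖φ y‖ ≤ (1 + M) ^ (N + 1) * K := by
      calc (1 + ‖q‖) ^ (N + 1) * ‖φ y‖ ≤ (1 + M) ^ (N + 1) * (1 + ‖y‖) ^ (N + 1) * ‖φ y‖ := by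
            gcongr
        _ ≤ _ := by rw [mul_assoc]; gcongr; exact h0 y
    have e1 : (1 + ‖q‖) ^ N * ‖fderiv ℝ φ y‖ ≤ (1 + M) ^ (N + 1) * K := by
      calc (1 + ‖q‖) ^ N * ‖fderiv ℝ φ y‖ ≤ (1 + ‖q‖) ^ (N + 1) * ‖fderiv ℝ φ y‖ := by
            gcongr
            · linarith [norm_nonneg q]
            · omega
        _ ≤ (1 + M) ^ (N + 1) * (1 + ‖y‖) ^ (N + 1) * ‖fderiv ℝ φ y‖ := by gcongr
        _ ≤ _ := by rw [mul_assoc]; gcongr; exact h1 y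
    beta_reduce
    rw [Real.rpow_neg hq0.le, Real.rpow_natCast, ← div_eq_mul_inv, le_div_iff₀ (by positivity)]
    calc (M * (1 + ‖q‖) * ‖φ y‖ + M * ‖fderiv ℝ φ y‖) * (1 + ‖q‖) ^ N
        = M * ((1 + ‖q‖) ^ (N + 1) * ‖φ y‖) + M * ((1 + ‖q‖) ^ N * ‖fderiv ℝ φ y‖) := by ring
      _ ≤ M * ((1 + M) ^ (N + 1) * K) + M * ((1 + M) ^ (N + 1) * K) := by gcongr
      _ = _ := by ring

/-- The derivative in `L²` of a Schwartz function displaced along a smooth curve. -/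
theorem hasDerivAt_toL2_weylSch {a b a' b' : ℝ → Config d L} {c c' : ℝ → ℝ}
    (ha : ∀ s, HasDerivAt a (a' s) s) (hb : ∀ s, HasDerivAt b (b' s) s)
    (hc : ∀ s, HasDerivAt c (c' s) s) (ha' : Continuous a') (hb' : Continuous b')
    (hc' : Continuous c') (φ : 𝓢(Config d L, ℂ)) (t : ℝ) :
    CurveHasDerivAt (fun s => toL2 (weylSch (a s) (b s) (c s) φ))
      (toL2 (Complex.I • (posV (a' t) (weylSch (a t) (b t) (c t) φ)
        + (c' t : ℂ) • weylSch (a t) (b t) (c t) φ + weylSch (a t) (b t) (c t) (momV (b' t) φ))))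
      t := by
  have hbc : Continuous b := continuous_iff_continuousAt.2 fun s => (hb s).continuousAt
  -- One constant for the velocities and the displacement on the unit time interval around `t` makes
  -- the dominating function independent of time.
  obtain ⟨M, hM⟩ := (isCompact_closedBall t 1).exists_bound_of_continuousOn
    (f := fun s => (a' s, b' s, c' s, b s)) (by fun_prop)
  have hM0 : 0 ≤ M := (norm_nonneg _).trans (hM t (Metric.mem_closedBall_self zero_le_one))
  obtain ⟨g, hg, hgb⟩ := exists_bound_displaced φ hM0
  refine hasDerivAt_toL2 (δ := 1) (g := g) one_pos (D := fun s q =>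
    Complex.exp (Complex.I * ((⟪a s, q⟫_ℝ + c s : ℝ) : ℂ)) *
        (Complex.I * ((⟪a' s, q⟫_ℝ + c' s : ℝ) : ℂ)) * φ (q + b s) +
      Complex.exp (Complex.I * ((⟪a s, q⟫_ℝ + c s : ℝ) : ℂ)) * fderiv ℝ φ (q + b s) (b' s))
    ?_ ?_ hg ?_
  · intro q s _
    simp only [weylSch_apply]
    have h1 : HasDerivAt (fun s => φ (q + b s)) (fderiv ℝ φ (q + b s) (b' s)) s :=
      (φ.hasFDerivAt (q + b s)).comp_hasDerivAt s ((hb s).const_add q)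
    have h2 : HasDerivAt (fun s => ⟪a s, q⟫_ℝ + c s) (⟪a' s, q⟫_ℝ + c' s) s := by
      have := ((ha s).inner ℝ (hasDerivAt_const s q)).add (hc s)
      simpa [Pi.add_def] using this
    exact (h2.ofReal_comp.const_mul Complex.I).cexp.mul h1
  · intro q s hs
    have h := hM s (Metric.ball_subset_closedBall hs)
    simp only [Prod.norm_def, max_le_iff] at h
    obtain ⟨h1, h2, h3, h4⟩ := h
    refine le_trans ?_ (hgb q (b s) h4)
    refine (norm_add_le _ _).trans ?_
    rw [norm_mul, norm_mul, norm_mul, norm_mul, norm_cexp_I_mul, one_mul, one_mul, Complex.norm_I,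
      one_mul, Complex.norm_real]
    gcongr
    · refine (norm_add_le _ _).trans ?_
      have := norm_inner_le_norm (𝕜 := ℝ) (a' s) q
      nlinarith [norm_nonneg q]
    · refine (ContinuousLinearMap.le_opNorm _ _).trans ?_
      rw [mul_comm]
      gcongr
  · intro q
    simp only [smul_apply, add_apply, posV_apply, weylSch_apply, momV_apply, smul_eq_mul]
    push_cast
    linear_combination (-(Complex.exp (Complex.I * ((⟪a t, q⟫_ℝ : ℂ) + (c t : ℂ))) *
      fderiv ℝ φ (q + b t) (b' t))) * Complex.I_mul_I

/-- The position part `Re f` of a phase space vector. -/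
def reV (f : Box d L → ℂ) : Config d L := WithLp.toLp 2 fun x => (f x).re

/-- The momentum part `Im f` of a phase space vector. -/
def imV (f : Box d L → ℂ) : Config d L := WithLp.toLp 2 fun x => (f x).im

theorem fieldOp_eq (f : Box d L → ℂ) :
    fieldOp f = (schwartzPMap (posV (reV f) + momV (imV f))).closure := by
  rw [fieldOp, posV, momV, ← Finset.sum_add_distrib]
  rfl

/-- The phase `t²⟪a, b⟫/2` is the one for which the cocycle `st⟪a, b⟫` of `weylL2_mul` is absorbed
and the group law holds; its derivative vanishes at `0`, so the generator has no scalar part. The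
whole Schwartz graph is invariant, because the shifts of `posV a` and `momV b` cancel, so it serves
as its own core. -/
theorem isUnitaryGroupOf_weylL2 (a b : Config d L) :
    IsUnitaryGroupOf (schwartzPMap (posV a + momV b)).closure
      fun t => weylL2 (t • a) (t • b) (t ^ 2 * (⟪a, b⟫_ℝ / 2)) := by
  set U : ℝ → HilbertL d L →L[ℂ] HilbertL d L :=
    fun t => weylL2 (t • a) (t • b) (t ^ 2 * (⟪a, b⟫_ℝ / 2)) with hUdef
  have hder : ∀ φ t, CurveHasDerivAt (fun t => U t (toL2 φ)) (toL2 (Complex.I •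
      (posV a (weylSch (t • a) (t • b) (t ^ 2 * (⟪a, b⟫_ℝ / 2)) φ)
        + ((2 * t * (⟪a, b⟫_ℝ / 2) : ℝ) : ℂ) • weylSch (t • a) (t • b) (t ^ 2 * (⟪a, b⟫_ℝ / 2)) φ
        + weylSch (t • a) (t • b) (t ^ 2 * (⟪a, b⟫_ℝ / 2)) (momV b φ)))) t := by
    intro φ t
    simp only [hUdef, weylL2_toL2]
    refine hasDerivAt_toL2_weylSch (a := fun s => s • a) (b := fun s => s • b)
      (a' := fun _ => a) (b' := fun _ => b) (c := fun s => s ^ 2 * (⟪a, b⟫_ℝ / 2))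
      (c' := fun s => 2 * s * (⟪a, b⟫_ℝ / 2)) ?_ ?_ ?_ continuous_const continuous_const
      (by fun_prop) φ t
    · intro s; simpa using (hasDerivAt_id s).smul_const a
    · intro s; simpa using (hasDerivAt_id s).smul_const b
    · intro s; simpa using (hasDerivAt_pow 2 s).mul_const (⟪a, b⟫_ℝ / 2)
  have hzero : U 0 = 1 := by simp [hUdef, weylL2_zero]
  have hadd : ∀ s t, U (s + t) = U s * U t := by
    intro s t
    simp only [hUdef, weylL2_mul, ← add_smul, inner_smul_left, inner_smul_right]
    congr 1
    simp only [conj_trivial]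
    ring
  have hU : IsUnitaryGroup U := by
    refine ⟨fun t => mem_unitary_of_norm_apply (V := U (-t)) (norm_weylL2_apply _ _ _) ?_, hzero,
      hadd, continuous_apply_of_dense (fun t => norm_weylL2_apply _ _ _) denseRange_toL2 ?_⟩
    · rw [← hadd, add_neg_cancel, hzero]
    · rintro _ ⟨φ, rfl⟩
      exact continuous_iff_continuousAt.2 fun t => (hder φ t).continuousAt
  refine hU.isUnitaryGroupOf_closure le_rfl ((isSymmOp_posV a).add (isSymmOp_momV b)).graph_symm
    ?_ ?_ ?_
  · intro x hx
    obtain ⟨φ, rfl⟩ := mem_graph_schwartzPMap.1 hx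
    have h := hder φ 0
    have hW : ∀ φ : 𝓢(Config d L, ℂ), weylSch 0 0 0 φ = φ := fun φ => by
      ext q; simp [weylSch_apply]
    simpa [hW] using h
  · intro x hx t
    obtain ⟨φ, rfl⟩ := mem_graph_schwartzPMap.1 hx
    refine mem_graph_schwartzPMap.2
      ⟨weylSch (t • a) (t • b) (t ^ 2 * (⟪a, b⟫_ℝ / 2)) φ, Prod.ext (weylL2_toL2 _ _ _ _) ?_⟩
    refine (weylL2_toL2 _ _ _ _).trans (congrArg toL2 ?_)
    rw [LinearMap.add_apply, LinearMap.add_apply, posV_weylSch, momV_weylSch, inner_smul_right,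
      inner_smul_right, real_inner_comm b a, map_add]
    abel
  · refine denseRange_toL2.mono ?_
    rintro _ ⟨φ, rfl⟩
    exact ⟨_, toL2_mem_graph _ φ, rfl⟩

/-- The explicit form of the Weyl operators. -/
theorem weyl_eq (f : Box d L → ℂ) :
    weyl f = weylL2 (reV f) (imV f) (⟪reV f, imV f⟫_ℝ / 2) := by
  rw [weyl, fieldOp_eq, (isUnitaryGroupOf_weylL2 (reV f) (imV f)).expI_eq
    (dense_domain_closure_schwartzPMap _)]
  simp

theorem norm_weylL2_le (a b : Config d L) (c : ℝ) : ‖weylL2 a b c‖ ≤ 1 :=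
  ContinuousLinearMap.opNorm_le_bound _ zero_le_one fun ψ => by
    rw [norm_weylL2_apply, one_mul]

/-- The two orders of multiplication differ by the scalar `exp(iσ)`, so the commutator is `exp(iσ) -
1` times a product of contractions. -/
theorem norm_lie_weylL2_le (a b a' b' : Config d L) (c c' : ℝ) :
    ‖⁅weylL2 a b c, weylL2 a' b' c'⁆‖
      ≤ ‖Complex.exp (Complex.I * ((⟪a', b⟫_ℝ - ⟪a, b'⟫_ℝ : ℝ) : ℂ)) - 1‖ := by
  have h : weylL2 a b c * weylL2 a' b' c' =
      Complex.exp (Complex.I * ((⟪a', b⟫_ℝ - ⟪a, b'⟫_ℝ : ℝ) : ℂ)) •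
        (weylL2 a' b' c' * weylL2 a b c) := by
    rw [weylL2_mul, weylL2_mul, ← weylL2_add_phase, add_comm a, add_comm b]
    congr 1
    ring
  rw [Ring.lie_def, h, sub_eq_add_neg, ← neg_one_smul ℂ (weylL2 a' b' c' * weylL2 a b c),
    ← add_smul, ← sub_eq_add_neg]
  refine (norm_smul_le _ _).trans (mul_le_of_le_one_right (norm_nonneg _) ?_)
  exact (norm_mul_le _ _).trans
    (mul_le_one₀ (norm_weylL2_le _ _ _) (norm_nonneg _) (norm_weylL2_le _ _ _))

end Weyl

/-! ### Canonical commutation relations -/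

section CCR

variable {d L : ℕ}

theorem momV_posV (u w : Config d L) (φ : 𝓢(Config d L, ℂ)) :
    momV u (posV w φ) = posV w (momV u φ) - (Complex.I * (⟪w, u⟫_ℝ : ℂ)) • φ := by
  ext q
  have h1 : HasFDerivAt (fun q : Config d L => (⟪w, q⟫_ℝ : ℂ))
      (Complex.ofRealCLM.comp (innerSL ℝ w)) q :=
    Complex.ofRealCLM.hasFDerivAt.comp q (innerSL ℝ w).hasFDerivAt
  have h2 := h1.mul (φ.hasFDerivAt q)
  have h3 : (posV w φ : Config d L → ℂ) = (fun q : Config d L => (⟪w, q⟫_ℝ : ℂ)) * φ :=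
    funext fun q => posV_apply w φ q
  rw [← h3] at h2
  simp only [momV_apply, sub_apply, smul_apply, posV_apply, h2.fderiv, add_apply, smul_eq_mul,
    ContinuousLinearMap.comp_apply, Complex.ofRealCLM_apply, innerSL_apply_apply]
  ring

theorem posV_comm (u w : Config d L) (φ : 𝓢(Config d L, ℂ)) :
    posV u (posV w φ) = posV w (posV u φ) := by
  ext q
  simp only [posV_apply]
  ring

theorem momV_comm (u w : Config d L) (φ : 𝓢(Config d L, ℂ)) :
    momV u (momV w φ) = momV w (momV u φ) := by
  have key : ∀ (u w q : Config d L), momV u (momV w φ) q = -(fderiv ℝ (fderiv ℝ φ) q u w) := by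
    intro u w q
    have h1 : HasFDerivAt (fderiv ℝ φ) (fderiv ℝ (fderiv ℝ φ) q) q :=
      ((φ.smooth 2).fderiv_right (m := 1) le_rfl).differentiable one_ne_zero q |>.hasFDerivAt
    have h2 := (h1.clm_apply (hasFDerivAt_const w q)).const_mul (-Complex.I)
    have h3 : (momV w φ : Config d L → ℂ) = fun q => -Complex.I * fderiv ℝ φ q w :=
      funext fun q => momV_apply w φ q
    rw [← h3] at h2
    rw [momV_apply, h2.fderiv]
    simp only [smul_apply, add_apply, ContinuousLinearMap.comp_apply,
      ContinuousLinearMap.flip_apply, zero_apply, map_zero, zero_add, smul_eq_mul]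
    linear_combination (fderiv ℝ (fderiv ℝ φ) q u w) * Complex.I_mul_I
  ext q
  rw [key, key]
  have hs : IsSymmSndFDerivAt ℝ φ q := (φ.smooth 2).contDiffAt.isSymmSndFDerivAt (by simp)
  rw [hs.eq]

end CCR

/-! ### Gaussian functions -/

section Gaussian

/-- Bound the power by `N! exp(1 + s)` and complete the square in `s - ε s²`, whose maximum is
`1/(4ε)`. -/
theorem exists_one_add_pow_mul_exp_le (N : ℕ) {ε : ℝ} (hε : 0 < ε) :
    ∃ C : ℝ, ∀ s : ℝ, 0 ≤ s → (1 + s) ^ N * Real.exp (-ε * s ^ 2) ≤ C := by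
  refine ⟨N.factorial * Real.exp (1 + 1 / (4 * ε)), fun s hs => ?_⟩
  have h1 : (1 + s) ^ N ≤ N.factorial * Real.exp (1 + s) := by
    have := Real.pow_div_factorial_le_exp (1 + s) (by positivity) N
    rwa [div_le_iff₀ (by positivity), mul_comm] at this
  calc (1 + s) ^ N * Real.exp (-ε * s ^ 2)
      ≤ N.factorial * Real.exp (1 + s) * Real.exp (-ε * s ^ 2) := by gcongr
    _ = N.factorial * Real.exp (1 + s - ε * s ^ 2) := by
        rw [mul_assoc, ← Real.exp_add]
        congr 2
        ring
    _ ≤ N.factorial * Real.exp (1 + 1 / (4 * ε)) := by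
        gcongr
        have : 0 ≤ ε * (s - 1 / (2 * ε)) ^ 2 := by positivity
        have e : ε * (s - 1 / (2 * ε)) ^ 2 = ε * s ^ 2 - s + 1 / (4 * ε) := by
          field_simp
          ring
        linarith

variable {V : Type*} [NormedAddCommGroup V] [NormedSpace ℝ V]

/-- The exponential of a function of temperate growth which is at most `-ε ‖x‖²` is a Schwartz
function. -/
def expSchwartz (f : V → ℝ) (hf : f.HasTemperateGrowth) {ε : ℝ} (hε : 0 < ε)
    (hle : ∀ x, f x ≤ -ε * ‖x‖ ^ 2) : 𝓢(V, ℝ) where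
  toFun := Real.exp ∘ f
  smooth' := Real.contDiff_exp.comp hf.1
  decay' := by
    intro k n
    obtain ⟨m, C, hC, hCb⟩ := hf.norm_iteratedFDeriv_le_uniform n
    obtain ⟨K, hK⟩ := exists_one_add_pow_mul_exp_le (k + m * n) hε
    refine ⟨n.factorial * (C + 1) ^ n * K, fun x => ?_⟩
    have h1 : (1 : ℝ) ≤ 1 + ‖x‖ := by linarith [norm_nonneg x]
    -- The bound for derivatives of a composition needs the `i`-th derivative of `f` to be at most
    -- the `i`-th power of one base; with `C + 1` the base is at least `1`, so any positive power
    -- dominates it.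
    have h2 : (1 : ℝ) ≤ (C + 1) * (1 + ‖x‖) ^ m := by
      have := one_le_pow₀ h1 (n := m)
      nlinarith
    have h3 : ‖iteratedFDeriv ℝ n (Real.exp ∘ f) x‖
        ≤ n.factorial * Real.exp (f x) * ((C + 1) * (1 + ‖x‖) ^ m) ^ n := by
      refine norm_iteratedFDeriv_comp_le (N := ((⊤ : ℕ∞) : WithTop ℕ∞)) Real.contDiff_exp hf.1
        (by exact_mod_cast le_top) x ?_ ?_
      · intro i _
        rw [norm_iteratedFDeriv_eq_norm_iteratedDeriv, iteratedDeriv_eq_iterate,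
          Real.iter_deriv_exp, Real.norm_eq_abs, Real.abs_exp]
      · intro i hi hin
        calc ‖iteratedFDeriv ℝ i f x‖ ≤ C * (1 + ‖x‖) ^ m := hCb i hin x
          _ ≤ (C + 1) * (1 + ‖x‖) ^ m := by gcongr; linarith
          _ ≤ ((C + 1) * (1 + ‖x‖) ^ m) ^ i := le_self_pow₀ h2 (by omega)
    calc ‖x‖ ^ k * ‖iteratedFDeriv ℝ n (Real.exp ∘ f) x‖
        ≤ (1 + ‖x‖) ^ k * (n.factorial * Real.exp (-ε * ‖x‖ ^ 2) *
            ((C + 1) * (1 + ‖x‖) ^ m) ^ n) := by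
          gcongr
          · linarith
          · refine h3.trans ?_
            gcongr
            exact hle x
      _ = n.factorial * (C + 1) ^ n * ((1 + ‖x‖) ^ (k + m * n) * Real.exp (-ε * ‖x‖ ^ 2)) := by
          rw [mul_pow, pow_add, pow_mul]
          ring
      _ ≤ n.factorial * (C + 1) ^ n * K := by
          gcongr
          exact hK _ (norm_nonneg _)

end Gaussian

/-! ### Normal modes and ladder operators -/

section NormalModes

variable {d L : ℕ}

/-- A symplectic basis in which the Hamiltonian is a sum of one-dimensional oscillators with
frequencies `γ`. -/
structure IsNormalModes (p : Params d) (ξ η : Box d L → Config d L) (γ : Box d L → ℝ) : Prop where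
  pos : ∀ j, 0 < γ j
  inner_eq : ∀ j k, ⟪ξ j, η k⟫_ℝ = if j = k then 1 else 0
  sum_pos : ∀ a, ∑ j, ⟪η j, a⟫_ℝ • ξ j = a
  sum_mom : ∀ b, ∑ j, ⟪ξ j, b⟫_ℝ • η j = b
  hamiltonianOp_apply : ∀ φ, hamiltonianOp p L φ =
    ∑ j, (momV (η j) (momV (η j) φ) + ((γ j : ℂ) ^ 2) • posV (ξ j) (posV (ξ j) φ))

/-- The raising operators. -/
def raiseOp (ξ η : Box d L → Config d L) (γ : Box d L → ℝ) (j : Box d L) :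
    Module.End ℂ 𝓢(Config d L, ℂ) :=
  (γ j : ℂ) • posV (ξ j) - Complex.I • momV (η j)

/-- The lowering operators. -/
def lowerOp (ξ η : Box d L → Config d L) (γ : Box d L → ℝ) (j : Box d L) :
    Module.End ℂ 𝓢(Config d L, ℂ) :=
  (γ j : ℂ) • posV (ξ j) + Complex.I • momV (η j)

theorem raiseOp_apply (ξ η : Box d L → Config d L) (γ : Box d L → ℝ) (j : Box d L)
    (φ : 𝓢(Config d L, ℂ)) :
    raiseOp ξ η γ j φ = (γ j : ℂ) • posV (ξ j) φ - Complex.I • momV (η j) φ := rfl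

theorem lowerOp_apply (ξ η : Box d L → Config d L) (γ : Box d L → ℝ) (j : Box d L)
    (φ : 𝓢(Config d L, ℂ)) :
    lowerOp ξ η γ j φ = (γ j : ℂ) • posV (ξ j) φ + Complex.I • momV (η j) φ := rfl

namespace IsNormalModes

variable {p : Params d} {ξ η : Box d L → Config d L} {γ : Box d L → ℝ}
  (h : IsNormalModes p ξ η γ)
include h

theorem momV_posV_same (j : Box d L) (φ : 𝓢(Config d L, ℂ)) :
    momV (η j) (posV (ξ j) φ) = posV (ξ j) (momV (η j) φ) - Complex.I • φ := by
  rw [momV_posV, h.inner_eq, if_pos rfl]; simp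

theorem momV_posV_ne {j k : Box d L} (hjk : j ≠ k) (φ : 𝓢(Config d L, ℂ)) :
    momV (η k) (posV (ξ j) φ) = posV (ξ j) (momV (η k) φ) := by
  rw [momV_posV, h.inner_eq, if_neg hjk]; simp

/-- The ladder operators are left unnormalised, so their commutator is `2γ` rather than `1`. -/
theorem lowerOp_raiseOp (j k : Box d L) (φ : 𝓢(Config d L, ℂ)) :
    lowerOp ξ η γ k (raiseOp ξ η γ j φ)
      = raiseOp ξ η γ j (lowerOp ξ η γ k φ) + ((if j = k then 2 * γ j else 0 : ℝ) : ℂ) • φ := by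
  have hI := Complex.I_mul_I
  simp only [lowerOp_apply, raiseOp_apply, map_add, map_sub, map_smul]
  by_cases hjk : j = k
  · subst hjk
    rw [h.momV_posV_same, if_pos rfl]
    push_cast
    match_scalars <;> first | ring1 | linear_combination (-2 * γ j : ℂ) * hI
  · rw [h.momV_posV_ne hjk, h.momV_posV_ne (Ne.symm hjk), if_neg hjk, posV_comm, momV_comm]
    push_cast
    module

/-- Only the mode `k` fails to commute with its raising operator. The quantum is `2γ k` because a
mode contributes `P² + γ²Q²` without the usual factor one half. -/
theorem hamiltonianOp_raiseOp (k : Box d L) (φ : 𝓢(Config d L, ℂ)) :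
    hamiltonianOp p L (raiseOp ξ η γ k φ)
      = raiseOp ξ η γ k (hamiltonianOp p L φ) + ((2 * γ k : ℝ) : ℂ) • raiseOp ξ η γ k φ := by
  have hI := Complex.I_mul_I
  rw [h.hamiltonianOp_apply, h.hamiltonianOp_apply, map_sum]
  have key : ∀ j, momV (η j) (momV (η j) (raiseOp ξ η γ k φ)) +
      ((γ j : ℂ) ^ 2) • posV (ξ j) (posV (ξ j) (raiseOp ξ η γ k φ)) =
      raiseOp ξ η γ k (momV (η j) (momV (η j) φ) + ((γ j : ℂ) ^ 2) • posV (ξ j) (posV (ξ j) φ)) +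
        if j = k then ((2 * γ k : ℝ) : ℂ) • raiseOp ξ η γ k φ else 0 := by
    intro j
    simp only [raiseOp_apply, map_add, map_sub, map_smul]
    by_cases hjk : j = k
    · subst hjk
      simp only [h.momV_posV_same, map_sub, map_smul, if_pos]
      push_cast
      match_scalars <;> first | ring1 | linear_combination (-2 * (γ j : ℂ) ^ 2) * hI
    · rw [if_neg hjk, add_zero, h.momV_posV_ne (Ne.symm hjk), h.momV_posV_ne (Ne.symm hjk),
        posV_comm (ξ j) (ξ k), posV_comm (ξ j) (ξ k), h.momV_posV_ne hjk, h.momV_posV_ne hjk,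
        momV_comm (η j) (η k), momV_comm (η j) (η k)]
  rw [Finset.sum_congr rfl fun j _ => key j, Finset.sum_add_distrib, Finset.sum_ite_eq']
  simp

end IsNormalModes

end NormalModes

/-! ### Uniqueness of Fourier transforms and completeness of Gaussian moments -/

section FourierUniqueness

open FourierTransform

variable {V : Type*} [NormedAddCommGroup V] [InnerProductSpace ℝ V] [FiniteDimensional ℝ V]
  [MeasurableSpace V] [BorelSpace V]

/-- An integrable function whose Fourier integrals all vanish is zero almost everywhere. -/
theorem ae_eq_zero_of_forall_integral_cexp_eq_zero {F : V → ℂ} (hF : Integrable F)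
    (h : ∀ a : V, ∫ q, Complex.exp (Complex.I * (⟪a, q⟫_ℝ : ℂ)) * F q = 0) :
    ∀ᵐ q, F q = 0 := by
  have hfour : ∀ w, 𝓕 F w = 0 := by
    intro w
    rw [Real.fourier_eq', ← h ((-2 * Real.pi) • w)]
    refine integral_congr_ae (Eventually.of_forall fun q => ?_)
    simp only [smul_eq_mul, real_inner_smul_left, real_inner_comm w q]
    congr 2
    push_cast
    ring
  refine ae_eq_zero_of_integral_contDiff_smul_eq_zero hF.locallyIntegrable fun g hg hgs => ?_
  have hgs' : HasCompactSupport fun x => (g x : ℂ) := hgs.comp_left Complex.ofReal_zero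
  -- A test function is the Fourier transform of the Schwartz function `𝓕⁻ G`; moving the transform
  -- onto `F` makes its integral against `F` vanish.
  set G : 𝓢(V, ℂ) := hgs'.toSchwartzMap (Complex.ofRealCLM.contDiff.comp hg) with hG
  have h1 := VectorFourier.integral_fourierIntegral_smul_eq_flip (L := innerₗ V)
    (μ := volume) (ν := volume) Real.continuous_fourierChar continuous_inner (𝓕⁻ G).integrable hF
  have h2 : ∫ x, 𝓕 ((𝓕⁻ G : 𝓢(V, ℂ)) : V → ℂ) x • F x = 0 := by
    refine Eq.trans (by simpa using! h1) ?_
    refine integral_eq_zero_of_ae (Eventually.of_forall fun x => ?_)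
    have := hfour x
    change _ * 𝓕 F x = 0
    rw [this, mul_zero]
  rw [← h2]
  refine integral_congr_ae (Eventually.of_forall fun x => ?_)
  have h3 : 𝓕 ((𝓕⁻ G : 𝓢(V, ℂ)) : V → ℂ) x = g x := by
    rw [← SchwartzMap.fourier_coe, FourierTransform.fourier_fourierInv_eq]
    rfl
  simp only [h3, smul_eq_mul, Complex.real_smul]

/-- If `F` is integrable against `exp |⟨a, q⟩|` and all moments of `F` in the direction `a` vanish,
so does the corresponding Fourier integral. -/
theorem integral_cexp_eq_zero_of_moments {F : V → ℂ} (hF : AEStronglyMeasurable F) {a : V}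
    (hint : Integrable fun q => Real.exp |⟪a, q⟫_ℝ| * ‖F q‖)
    (h : ∀ n : ℕ, ∫ q, (⟪a, q⟫_ℝ : ℂ) ^ n * F q = 0) :
    ∫ q, Complex.exp (Complex.I * (⟪a, q⟫_ℝ : ℂ)) * F q = 0 := by
  have hexp : ∀ x : ℝ, HasSum (fun n : ℕ => x ^ n / n.factorial) (Real.exp x) := by
    intro x
    rw [Real.exp_eq_exp_ℝ]
    exact NormedSpace.expSeries_div_hasSum_exp x
  -- The exponential series may be integrated term by term, since its absolute values sum to the
  -- integrable function `exp |⟪a, q⟫| ‖F q‖`.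
  have key := hasSum_integral_of_dominated_convergence (μ := (volume : Measure V))
    (F := fun (n : ℕ) q => (Complex.I * (⟪a, q⟫_ℝ : ℂ)) ^ n / n.factorial * F q)
    (f := fun q => Complex.exp (Complex.I * (⟪a, q⟫_ℝ : ℂ)) * F q)
    (fun n q => |⟪a, q⟫_ℝ| ^ n / n.factorial * ‖F q‖) ?_ ?_ ?_ ?_ ?_
  · refine (key.unique ?_)
    have : ∀ n : ℕ, ∫ q, (Complex.I * (⟪a, q⟫_ℝ : ℂ)) ^ n / n.factorial * F q = 0 := by
      intro n
      have e : (fun q => (Complex.I * (⟪a, q⟫_ℝ : ℂ)) ^ n / n.factorial * F q)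
          = fun q => (Complex.I ^ n / n.factorial) * ((⟪a, q⟫_ℝ : ℂ) ^ n * F q) := by
        funext q
        ring
      rw [e, integral_const_mul, h n, mul_zero]
    simp only [this]
    exact hasSum_zero
  · intro n
    exact (Continuous.aestronglyMeasurable (by fun_prop)).mul hF
  · intro n
    refine Eventually.of_forall fun q => ?_
    simp
  · exact Eventually.of_forall fun q => ((hexp _).mul_right _).summable
  · refine hint.congr (Eventually.of_forall fun q => ?_)
    exact ((hexp _).mul_right _).tsum_eq.symm
  · refine Eventually.of_forall fun q => HasSum.mul_right _ ?_
    rw [Complex.exp_eq_exp_ℂ]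
    exact NormedSpace.expSeries_div_hasSum_exp _

end FourierUniqueness

/-! ### Eigenfunctions of the Hamiltonian -/

section Eigenfunctions

variable {d L : ℕ}

theorem posV_sum_smul {ι : Type*} (s : Finset ι) (c : ι → ℝ) (u : ι → Config d L)
    (φ : 𝓢(Config d L, ℂ)) :
    posV (∑ i ∈ s, c i • u i) φ = ∑ i ∈ s, (c i : ℂ) • posV (u i) φ := by
  ext q
  simp only [posV_apply, sum_apply, smul_apply, smul_eq_mul, sum_inner, real_inner_smul_left]
  push_cast
  rw [Finset.sum_mul]
  exact Finset.sum_congr rfl fun i _ => by ring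

theorem posV_pow_apply (a : Config d L) (n : ℕ) (φ : 𝓢(Config d L, ℂ)) (q : Config d L) :
    (posV a ^ n) φ q = (⟪a, q⟫_ℝ : ℂ) ^ n * φ q := by
  induction n with
  | zero => simp
  | succ n ih => rw [pow_succ', Module.End.mul_apply, posV_apply, ih, pow_succ']; ring

/-- The exponent of the ground state. -/
def groundExponent (ξ : Box d L → Config d L) (γ : Box d L → ℝ) (q : Config d L) : ℝ :=
  -(1 / 2) * ∑ j, γ j * ⟪ξ j, q⟫_ℝ ^ 2

theorem hasTemperateGrowth_groundExponent (ξ : Box d L → Config d L) (γ : Box d L → ℝ) :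
    (groundExponent ξ γ).HasTemperateGrowth := by
  unfold groundExponent
  refine (Function.HasTemperateGrowth.const (-(1 / 2) : ℝ)).mul
    (Function.HasTemperateGrowth.sum fun j _ => ?_)
  exact (Function.HasTemperateGrowth.const (γ j)).mul ((innerSL ℝ (ξ j)).hasTemperateGrowth.pow 2)

/-- The energies of the excited states, indexed by lists of modes. -/
def modeEnergy (γ : Box d L → ℝ) : List (Box d L) → ℝ
  | [] => ∑ j, γ j
  | j :: l => modeEnergy γ l + 2 * γ j

namespace IsNormalModes

variable {p : Params d} {ξ η : Box d L → Config d L} {γ : Box d L → ℝ}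
  (h : IsNormalModes p ξ η γ)
include h

/-- Writing `q` in the basis `η` with coefficients `⟪ξ j, q⟫` and using Cauchy–Schwarz with weights
`√(γ j)` bounds `‖q‖²` by a multiple of the quadratic form. The constant `K + 1` in place of `K`
only ensures strict positivity. -/
theorem exists_groundExponent_le :
    ∃ ε : ℝ, 0 < ε ∧ ∀ q, groundExponent ξ γ q ≤ -ε * ‖q‖ ^ 2 := by
  set K : ℝ := ∑ j, ‖η j‖ ^ 2 / γ j with hK
  have hK0 : 0 ≤ K := Finset.sum_nonneg fun j _ => div_nonneg (sq_nonneg _) (h.pos j).le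
  refine ⟨1 / (2 * (K + 1)), by positivity, fun q => ?_⟩
  set S : ℝ := ∑ j, γ j * ⟪ξ j, q⟫_ℝ ^ 2 with hS
  have hS0 : 0 ≤ S := Finset.sum_nonneg fun j _ => mul_nonneg (h.pos j).le (sq_nonneg _)
  have h1 : ‖q‖ ≤ ∑ j, (‖η j‖ / √(γ j)) * (√(γ j) * |⟪ξ j, q⟫_ℝ|) := by
    conv_lhs => rw [← h.sum_mom q]
    refine (norm_sum_le _ _).trans (Finset.sum_le_sum fun j _ => ?_)
    have : 0 < √(γ j) := Real.sqrt_pos.2 (h.pos j)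
    rw [norm_smul, Real.norm_eq_abs]
    field_simp
    rfl
  have h2 : ‖q‖ ^ 2 ≤ K * S := by
    refine (pow_le_pow_left₀ (norm_nonneg _) h1 2).trans
      ((Finset.sum_mul_sq_le_sq_mul_sq _ _ _).trans (le_of_eq ?_))
    congr 1
    · exact Finset.sum_congr rfl fun j _ => by rw [div_pow, Real.sq_sqrt (h.pos j).le]
    · exact Finset.sum_congr rfl fun j _ => by
        rw [mul_pow, Real.sq_sqrt (h.pos j).le, sq_abs]
  have h3 : ‖q‖ ^ 2 ≤ (K + 1) * S := h2.trans (by nlinarith)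
  have h4 : ‖q‖ ^ 2 / (K + 1) ≤ S := by
    rw [div_le_iff₀ (by positivity), mul_comm]
    exact h3
  have h5 : -(1 / (2 * (K + 1))) * ‖q‖ ^ 2 = -(1 / 2) * (‖q‖ ^ 2 / (K + 1)) := by
    field_simp
  rw [h5, groundExponent]
  linarith

/-- The ground state of the Hamiltonian. -/
def ground : 𝓢(Config d L, ℂ) :=
  SchwartzMap.postcompCLM Complex.ofRealCLM
    (expSchwartz (groundExponent ξ γ) (hasTemperateGrowth_groundExponent ξ γ)
      h.exists_groundExponent_le.choose_spec.1 h.exists_groundExponent_le.choose_spec.2)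

theorem ground_apply (q : Config d L) : h.ground q = (Real.exp (groundExponent ξ γ q) : ℂ) := rfl

theorem momV_ground (b q : Config d L) :
    momV b h.ground q = Complex.I * ((∑ j, γ j * ⟪ξ j, q⟫_ℝ * ⟪ξ j, b⟫_ℝ : ℝ) : ℂ)
      * h.ground q := by
  have h1 : HasDerivAt (fun t : ℝ => groundExponent ξ γ (q + t • b))
      (-∑ j, γ j * ⟪ξ j, q⟫_ℝ * ⟪ξ j, b⟫_ℝ) 0 := by
    unfold groundExponent
    have h2 : ∀ j ∈ Finset.univ, HasDerivAt (fun t : ℝ => γ j * ⟪ξ j, q + t • b⟫_ℝ ^ 2)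
        (γ j * (2 * ⟪ξ j, q⟫_ℝ * ⟪ξ j, b⟫_ℝ)) 0 := by
      intro j _
      have h3 : HasDerivAt (fun t : ℝ => ⟪ξ j, q + t • b⟫_ℝ) ⟪ξ j, b⟫_ℝ 0 := by
        simp only [inner_add_right, real_inner_smul_right]
        simpa using ((hasDerivAt_id (0 : ℝ)).mul_const ⟪ξ j, b⟫_ℝ).const_add ⟪ξ j, q⟫_ℝ
      simpa using (h3.pow 2).const_mul (γ j)
    refine ((HasDerivAt.fun_sum h2).const_mul (-(1 / 2))).congr_deriv ?_
    rw [Finset.mul_sum, ← Finset.sum_neg_distrib]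
    exact Finset.sum_congr rfl fun j _ => by ring
  have h4 : HasLineDerivAt ℝ h.ground
      ((Real.exp (groundExponent ξ γ q) * (-∑ j, γ j * ⟪ξ j, q⟫_ℝ * ⟪ξ j, b⟫_ℝ) : ℝ) : ℂ) q b := by
    have := h1.exp.ofReal_comp
    simpa [HasLineDerivAt, ground_apply] using this
  rw [momV_apply, ← h.ground.differentiableAt.lineDeriv_eq_fderiv, h4.lineDeriv, ground_apply]
  push_cast
  ring

theorem momV_ground_eq (k : Box d L) :
    momV (η k) h.ground = (Complex.I * γ k) • posV (ξ k) h.ground := by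
  ext q
  rw [momV_ground, smul_apply, posV_apply]
  simp only [h.inner_eq, mul_ite, mul_one, mul_zero, Finset.sum_ite_eq', Finset.mem_univ, if_true,
    smul_eq_mul]
  push_cast
  ring

theorem lowerOp_ground (k : Box d L) : lowerOp ξ η γ k h.ground = 0 := by
  rw [lowerOp_apply, momV_ground_eq, smul_smul, ← mul_assoc, Complex.I_mul_I]
  module

/-- In each mode the quadratic terms cancel, and the commutator of `P` with `Q` leaves the
zero-point energy `γ j`. -/
theorem hamiltonianOp_ground :
    hamiltonianOp p L h.ground = ((∑ j, γ j : ℝ) : ℂ) • h.ground := by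
  rw [h.hamiltonianOp_apply]
  push_cast
  rw [Finset.sum_smul]
  refine Finset.sum_congr rfl fun j _ => ?_
  rw [h.momV_ground_eq, map_smul, h.momV_posV_same, h.momV_ground_eq, map_smul]
  have hI := Complex.I_mul_I
  match_scalars
  · linear_combination (γ j : ℂ) ^ 2 * hI
  · linear_combination (-(γ j : ℂ)) * hI

/-- The excited states, indexed by lists of modes. -/
def excited : List (Box d L) → 𝓢(Config d L, ℂ)
  | [] => h.ground
  | j :: l => raiseOp ξ η γ j (excited l)

theorem hamiltonianOp_excited (l : List (Box d L)) :
    hamiltonianOp p L (h.excited l) = (modeEnergy γ l : ℂ) • h.excited l := by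
  induction l with
  | nil => exact h.hamiltonianOp_ground
  | cons j l ih =>
    rw [excited, modeEnergy, h.hamiltonianOp_raiseOp, ih, map_smul]
    push_cast
    module

theorem raiseOp_mem_span (k : Box d L) {φ : 𝓢(Config d L, ℂ)}
    (hφ : φ ∈ Submodule.span ℂ (Set.range h.excited)) :
    raiseOp ξ η γ k φ ∈ Submodule.span ℂ (Set.range h.excited) := by
  induction hφ using Submodule.span_induction with
  | mem φ hφ => obtain ⟨l, rfl⟩ := hφ; exact Submodule.subset_span ⟨k :: l, rfl⟩
  | zero => rw [map_zero]; exact zero_mem _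
  | add φ χ _ _ h1 h2 => rw [map_add]; exact add_mem h1 h2
  | smul c φ _ h1 => rw [map_smul]; exact Submodule.smul_mem _ _ h1

/-- A lowering operator is commuted past the raising operators, each time leaving a shorter word,
until it annihilates the ground state. -/
theorem lowerOp_mem_span (k : Box d L) {φ : 𝓢(Config d L, ℂ)}
    (hφ : φ ∈ Submodule.span ℂ (Set.range h.excited)) :
    lowerOp ξ η γ k φ ∈ Submodule.span ℂ (Set.range h.excited) := by
  induction hφ using Submodule.span_induction with
  | mem φ hφ =>
    obtain ⟨l, rfl⟩ := hφ
    induction l with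
    | nil => rw [excited, h.lowerOp_ground]; exact zero_mem _
    | cons j l ih =>
      rw [excited, h.lowerOp_raiseOp]
      exact add_mem (h.raiseOp_mem_span j ih)
        (Submodule.smul_mem _ _ (Submodule.subset_span ⟨l, rfl⟩))
  | zero => rw [map_zero]; exact zero_mem _
  | add φ χ _ _ h1 h2 => rw [map_add]; exact add_mem h1 h2
  | smul c φ _ h1 => rw [map_smul]; exact Submodule.smul_mem _ _ h1

/-- Positions are sums of raising and lowering operators, so the span contains every polynomial
times the ground state. This is the form in which totality can be tested by moments. -/
theorem posV_mem_span (a : Config d L) {φ : 𝓢(Config d L, ℂ)}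
    (hφ : φ ∈ Submodule.span ℂ (Set.range h.excited)) :
    posV a φ ∈ Submodule.span ℂ (Set.range h.excited) := by
  rw [← h.sum_pos a, posV_sum_smul]
  refine sum_mem fun j _ => Submodule.smul_mem _ _ ?_
  have hγ : (γ j : ℂ) ≠ 0 := by exact_mod_cast (h.pos j).ne'
  have : posV (ξ j) φ = (1 / (2 * γ j) : ℂ) • (raiseOp ξ η γ j φ + lowerOp ξ η γ j φ) := by
    rw [raiseOp_apply, lowerOp_apply]
    match_scalars
    · field_simp
      ring
    · ring
  rw [this]
  exact Submodule.smul_mem _ _ (add_mem (h.raiseOp_mem_span j hφ) (h.lowerOp_mem_span j hφ))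

theorem posV_pow_ground_mem_span (a : Config d L) (n : ℕ) :
    (posV a ^ n) h.ground ∈ Submodule.span ℂ (Set.range h.excited) := by
  induction n with
  | zero => exact Submodule.subset_span ⟨[], rfl⟩
  | succ n ih => rw [pow_succ']; exact h.posV_mem_span a ih

/-- Half of the Gaussian decay absorbs the exponential, by `‖a‖‖q‖ ≤ ‖a‖²/(2ε) + ε‖q‖²/2`. -/
theorem memLp_exp_mul_ground (a : Config d L) :
    MemLp (fun q => Real.exp |⟪a, q⟫_ℝ| * Real.exp (groundExponent ξ γ q)) 2 := by
  obtain ⟨ε, hε, hle⟩ := h.exists_groundExponent_le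
  have hsq : Function.HasTemperateGrowth fun q : Config d L => -(ε / 2) * ‖q‖ ^ 2 :=
    (Function.HasTemperateGrowth.const (-(ε / 2))).mul (Function.hasTemperateGrowth_norm_sq _)
  have hS := (expSchwartz (fun q : Config d L => -(ε / 2) * ‖q‖ ^ 2) hsq (half_pos hε)
    fun q => le_rfl).memLp 2 volume
  refine (hS.const_mul (Real.exp (‖a‖ ^ 2 / (2 * ε)))).mono ?_ (Eventually.of_forall fun q => ?_)
  · refine Continuous.aestronglyMeasurable ?_
    unfold groundExponent
    fun_prop
  · change ‖_‖ ≤ ‖Real.exp (‖a‖ ^ 2 / (2 * ε)) * Real.exp (-(ε / 2) * ‖q‖ ^ 2)‖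
    rw [← Real.exp_add, ← Real.exp_add, Real.norm_eq_abs, Real.norm_eq_abs, Real.abs_exp,
      Real.abs_exp, Real.exp_le_exp]
    have h1 := abs_real_inner_le_norm a q
    have h2 := hle q
    have h3 : ‖a‖ * ‖q‖ ≤ ‖a‖ ^ 2 / (2 * ε) + ε / 2 * ‖q‖ ^ 2 := by
      have e : ‖a‖ ^ 2 / (2 * ε) + ε / 2 * ‖q‖ ^ 2 - ‖a‖ * ‖q‖
          = (‖a‖ - ε * ‖q‖) ^ 2 / (2 * ε) := by
        field_simp
        ring
      have : 0 ≤ (‖a‖ - ε * ‖q‖) ^ 2 / (2 * ε) := by positivity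
      linarith
    nlinarith

/-- The excited states are total in `L²`. -/
theorem dense_span_excited :
    Dense (Submodule.span ℂ (Set.range fun l => toL2 (h.excited l)) : Set (HilbertL d L)) := by
  rw [Submodule.dense_iff_topologicalClosure_eq_top, Submodule.topologicalClosure_eq_top_iff, Submodule.eq_bot_iff]
  intro ψ hψ
  have horth : ∀ φ ∈ Submodule.span ℂ (Set.range h.excited), ⟪toL2 φ, ψ⟫_ℂ = 0 := by
    intro φ hφ
    induction hφ using Submodule.span_induction with
    | mem φ hφ =>
      obtain ⟨l, rfl⟩ := hφ
      exact Submodule.inner_right_of_mem_orthogonal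
        (K := Submodule.span ℂ (Set.range fun l => toL2 (h.excited l)))
        (Submodule.subset_span ⟨l, rfl⟩) hψ
    | zero => simp
    | add φ χ _ _ h1 h2 => rw [map_add, inner_add_left, h1, h2, add_zero]
    | smul c φ _ h1 => rw [map_smul, inner_smul_left, h1, mul_zero]
  -- Orthogonality to the span makes all moments of `F` vanish, hence its Fourier transform; as the
  -- ground state has no zeros, `ψ` vanishes too.
  set F : Config d L → ℂ := fun q => h.ground q * ψ q with hFdef
  have hψm : MemLp ψ 2 := Lp.memLp ψ
  have hFm : AEStronglyMeasurable F :=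
    h.ground.continuous.aestronglyMeasurable.mul hψm.aestronglyMeasurable
  have hnorm : ∀ q, ‖F q‖ = Real.exp (groundExponent ξ γ q) * ‖ψ q‖ := fun q => by
    rw [hFdef]
    simp only [norm_mul, ground_apply, Complex.norm_real, Real.norm_eq_abs, Real.abs_exp]
  have hint : ∀ a : Config d L, Integrable fun q => Real.exp |⟪a, q⟫_ℝ| * ‖F q‖ := by
    intro a
    refine ((h.memLp_exp_mul_ground a).integrable_mul hψm.norm).congr
      (Eventually.of_forall fun q => ?_)
    simp only [Pi.mul_apply, hnorm]
    ring
  have hFint : Integrable F := by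
    have := hint 0
    simp only [inner_zero_left, abs_zero, Real.exp_zero, one_mul] at this
    exact (integrable_norm_iff hFm).1 this
  have hmom : ∀ (a : Config d L) (n : ℕ), ∫ q, (⟪a, q⟫_ℝ : ℂ) ^ n * F q = 0 := by
    intro a n
    rw [← horth _ (h.posV_pow_ground_mem_span a n), L2.inner_def]
    refine integral_congr_ae ?_
    filter_upwards [((posV a ^ n) h.ground).coeFn_toLp 2 volume] with q hq
    have hq' : (toL2 ((posV a ^ n) h.ground) : Config d L → ℂ) q = ((posV a ^ n) h.ground) q := hq
    rw [hq', posV_pow_apply, RCLike.inner_apply', map_mul, map_pow, Complex.conj_ofReal,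
      ground_apply, Complex.conj_ofReal, mul_assoc]
    rfl
  have hzero := ae_eq_zero_of_forall_integral_cexp_eq_zero hFint
    fun a => integral_cexp_eq_zero_of_moments hFm (hint a) (hmom a)
  rw [Lp.eq_zero_iff_ae_eq_zero]
  filter_upwards [hzero] with q hq
  have : h.ground q ≠ 0 := by
    rw [ground_apply]
    exact_mod_cast (Real.exp_pos _).ne'
  exact (mul_eq_zero.1 hq).resolve_left this

end IsNormalModes

end Eigenfunctions

/-! ### The dynamics of the Weyl operators -/

section Dynamics

variable {d L : ℕ}

theorem momV_sum_smul {ι : Type*} (s : Finset ι) (c : ι → ℝ) (u : ι → Config d L)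
    (φ : 𝓢(Config d L, ℂ)) :
    momV (∑ i ∈ s, c i • u i) φ = ∑ i ∈ s, (c i : ℂ) • momV (u i) φ := by
  ext q
  simp only [momV_apply, sum_apply, smul_apply, smul_eq_mul, map_sum, map_smul, Complex.real_smul,
    Finset.mul_sum]
  exact Finset.sum_congr rfl fun i _ => by ring

/-- The coefficient of `ξ j` in the evolved position vector. -/
def posCoeff (ξ η : Box d L → Config d L) (γ : Box d L → ℝ) (a b : Config d L) (t : ℝ)
    (j : Box d L) : ℝ :=
  Real.cos (2 * γ j * t) * ⟪η j, a⟫_ℝ - γ j * Real.sin (2 * γ j * t) * ⟪ξ j, b⟫_ℝ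

/-- The coefficient of `η j` in the evolved momentum vector. -/
def momCoeff (ξ η : Box d L → Config d L) (γ : Box d L → ℝ) (a b : Config d L) (t : ℝ)
    (j : Box d L) : ℝ :=
  Real.cos (2 * γ j * t) * ⟪ξ j, b⟫_ℝ + (γ j)⁻¹ * Real.sin (2 * γ j * t) * ⟪η j, a⟫_ℝ

/-- The position part of the classical flow. -/
def flowPos (ξ η : Box d L → Config d L) (γ : Box d L → ℝ) (a b : Config d L) (t : ℝ) :
    Config d L :=
  ∑ j, posCoeff ξ η γ a b t j • ξ j

/-- The momentum part of the classical flow. -/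
def flowMom (ξ η : Box d L → Config d L) (γ : Box d L → ℝ) (a b : Config d L) (t : ℝ) :
    Config d L :=
  ∑ j, momCoeff ξ η γ a b t j • η j

namespace IsNormalModes

variable {p : Params d} {ξ η : Box d L → Config d L} {γ : Box d L → ℝ}
  (h : IsNormalModes p ξ η γ)
include h

theorem isSymmOp_hamiltonianOp : IsSymmOp (hamiltonianOp p L) := by
  have : hamiltonianOp p L =
      ∑ j, (momV (η j) ^ 2 + ((γ j ^ 2 : ℝ) : ℂ) • posV (ξ j) ^ 2) := by
    ext1 φ
    rw [h.hamiltonianOp_apply, LinearMap.sum_apply]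
    refine Finset.sum_congr rfl fun j _ => ?_
    simp [pow_two]
  rw [this]
  exact IsSymmOp.sum fun j _ => (isSymmOp_momV _).sq.add ((isSymmOp_posV _).sq.smul _)

/-- The Hamiltonian is essentially self-adjoint on the Schwartz functions, and the unitary group
generated by its closure acts diagonally on the excited states. -/
theorem isUnitaryGroupOf_hamiltonian :
    IsUnitaryGroupOf (hamiltonian p L) (expI (hamiltonian p L)) ∧
      ∀ t l, expI (hamiltonian p L) t (toL2 (h.excited l))
        = Complex.exp (Complex.I * t * modeEnergy γ l) • toL2 (h.excited l) := by
  refine isUnitaryGroupOf_expI_of_eigenvectors (w := modeEnergy γ)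
    h.isSymmOp_hamiltonianOp.graph_symm (fun l => ?_) h.dense_span_excited
  rw [← map_smul, ← h.hamiltonianOp_excited]
  exact toL2_mem_graph _ _

theorem inner_mom_sum (α : Box d L → ℝ) (k : Box d L) : ⟪η k, ∑ j, α j • ξ j⟫_ℝ = α k := by
  simp [inner_sum, real_inner_smul_right, real_inner_comm, h.inner_eq]

theorem inner_pos_sum (β : Box d L → ℝ) (k : Box d L) : ⟪ξ k, ∑ j, β j • η j⟫_ℝ = β k := by
  simp [inner_sum, real_inner_smul_right, h.inner_eq]

theorem inner_sum_sum (α β : Box d L → ℝ) :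
    ⟪∑ j, α j • ξ j, ∑ j, β j • η j⟫_ℝ = ∑ j, α j * β j := by
  simp only [sum_inner, real_inner_smul_left, h.inner_pos_sum]

/-- The commutator of a quadratic Hamiltonian with a displacement is of first order in positions and
momenta. Its coefficients are the velocities of the classical flow, `α' = -2γ²β` and `β' = 2α`, and
the scalar is the derivative of half the pairing `∑ αβ`, so it matches `hasDerivAt_toL2_weylSch`
term by term. -/
theorem hamiltonianOp_weylSch (α β : Box d L → ℝ) (c : ℝ) (φ : 𝓢(Config d L, ℂ)) :
    hamiltonianOp p L (weylSch (∑ j, α j • ξ j) (∑ j, β j • η j) c φ)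
      - weylSch (∑ j, α j • ξ j) (∑ j, β j • η j) c (hamiltonianOp p L φ) =
    posV (∑ j, (-2 * γ j ^ 2 * β j) • ξ j) (weylSch (∑ j, α j • ξ j) (∑ j, β j • η j) c φ)
      + ((∑ j, (α j ^ 2 - γ j ^ 2 * β j ^ 2) : ℝ) : ℂ) •
          weylSch (∑ j, α j • ξ j) (∑ j, β j • η j) c φ
      + weylSch (∑ j, α j • ξ j) (∑ j, β j • η j) c (momV (∑ j, (2 * α j) • η j) φ) := by
  rw [h.hamiltonianOp_apply, h.hamiltonianOp_apply, map_sum, posV_sum_smul, momV_sum_smul, map_sum]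
  push_cast
  rw [Finset.sum_smul, ← Finset.sum_add_distrib, ← Finset.sum_add_distrib,
    ← Finset.sum_sub_distrib]
  refine Finset.sum_congr rfl fun j _ => ?_
  simp only [momV_weylSch, posV_weylSch, map_add, map_sub, map_smul, h.inner_mom_sum,
    h.inner_pos_sum]
  module

/-- With `W s` the Weyl operator of the flowed vector, `U (-s) (W s) (U s)` is constant in `s`. It
suffices to test this on the excited states: there `U s` is a scalar, and `W s` maps them to
Schwartz functions, which lie in the domain of the Hamiltonian. -/
theorem heisenberg_weylL2 (a b : Config d L) (t : ℝ) :
    heisenberg p L t (weylL2 a b (⟪a, b⟫_ℝ / 2)) =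
      weylL2 (flowPos ξ η γ a b t) (flowMom ξ η γ a b t)
        (⟪flowPos ξ η γ a b t, flowMom ξ η γ a b t⟫_ℝ / 2) := by
  set A := flowPos ξ η γ a b with hA
  set B := flowMom ξ η γ a b with hB
  set α := posCoeff ξ η γ a b with hα
  set β := momCoeff ξ η γ a b with hβ
  set U := expI (hamiltonian p L) with hUdef
  obtain ⟨hU, hUe⟩ := h.isUnitaryGroupOf_hamiltonian
  have hUg := hU.isUnitaryGroup
  have hU0 : U 0 = 1 := hU.map_zero
  have hα' : ∀ t j, HasDerivAt (fun s => α s j) (-2 * γ j ^ 2 * β t j) t := by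
    intro t j
    have hl : HasDerivAt (fun s : ℝ => 2 * γ j * s) (2 * γ j) t := by
      simpa using (hasDerivAt_id t).const_mul (2 * γ j)
    refine ((hl.cos.mul_const ⟪η j, a⟫_ℝ).sub
      ((hl.sin.const_mul (γ j)).mul_const ⟪ξ j, b⟫_ℝ)).congr_deriv ?_
    have := (h.pos j).ne'
    simp only [hβ, momCoeff]
    field_simp
    ring
  have hβ' : ∀ t j, HasDerivAt (fun s => β s j) (2 * α t j) t := by
    intro t j
    have hl : HasDerivAt (fun s : ℝ => 2 * γ j * s) (2 * γ j) t := by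
      simpa using (hasDerivAt_id t).const_mul (2 * γ j)
    refine ((hl.cos.mul_const ⟪ξ j, b⟫_ℝ).add
      ((hl.sin.const_mul (γ j)⁻¹).mul_const ⟪η j, a⟫_ℝ)).congr_deriv ?_
    have := (h.pos j).ne'
    simp only [hα, posCoeff]
    field_simp
    ring
  have hαc : ∀ j, Continuous fun s => α s j := fun j =>
    continuous_iff_continuousAt.2 fun s => (hα' s j).continuousAt
  have hβc : ∀ j, Continuous fun s => β s j := fun j =>
    continuous_iff_continuousAt.2 fun s => (hβ' s j).continuousAt
  have hA' : ∀ s, HasDerivAt A (∑ j, (-2 * γ j ^ 2 * β s j) • ξ j) s := fun s =>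
    HasDerivAt.fun_sum fun j _ => (hα' s j).smul_const (ξ j)
  have hB' : ∀ s, HasDerivAt B (∑ j, (2 * α s j) • η j) s := fun s =>
    HasDerivAt.fun_sum fun j _ => (hβ' s j).smul_const (η j)
  have hAB : ∀ s, ⟪A s, B s⟫_ℝ = ∑ j, α s j * β s j := fun s => h.inner_sum_sum (α s) (β s)
  have hC' : ∀ s, HasDerivAt (fun s => ⟪A s, B s⟫_ℝ / 2)
      (∑ j, (α s j ^ 2 - γ j ^ 2 * β s j ^ 2)) s := by
    intro s
    simp only [hAB]
    refine ((HasDerivAt.fun_sum fun j _ => (hα' s j).mul (hβ' s j)).div_const 2).congr_deriv ?_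
    rw [Finset.sum_div]
    exact Finset.sum_congr rfl fun j _ => by ring
  have hA0 : A 0 = a := by
    simp only [hA, flowPos, posCoeff, mul_zero, Real.cos_zero, Real.sin_zero, one_mul, zero_mul,
      sub_zero, h.sum_pos]
  have hB0 : B 0 = b := by
    simp only [hB, flowMom, momCoeff, mul_zero, Real.cos_zero, Real.sin_zero, one_mul, zero_mul,
      add_zero, h.sum_mom]
  set W : ℝ → HilbertL d L →L[ℂ] HilbertL d L :=
    fun s => weylL2 (A s) (B s) (⟪A s, B s⟫_ℝ / 2) with hW
  have hW0 : W 0 = weylL2 a b (⟪a, b⟫_ℝ / 2) := by rw [hW]; simp only [hA0, hB0]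
  have key : ∀ l s, U (-s) (W s (U s (toL2 (h.excited l)))) = W 0 (toL2 (h.excited l)) := by
    intro l s
    set φ := h.excited l with hφ
    set w := modeEnergy γ l with hw
    -- The derivative of the displaced state minus `i` times its Hamiltonian leaves `-iw` times that
    -- state, which the derivative of the phase cancels.
    have hd : ∀ s, CurveHasDerivAt (fun s : ℝ => Complex.exp (Complex.I * s * w) •
        U (-s) (toL2 (weylSch (A s) (B s) (⟪A s, B s⟫_ℝ / 2) φ))) 0 s := by
      intro s
      have h1 := hasDerivAt_toL2_weylSch hA' hB' hC' (by fun_prop) (by fun_prop) (by fun_prop) φ s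
      have h2 := h.hamiltonianOp_weylSch (α s) (β s) (⟪A s, B s⟫_ℝ / 2) φ
      rw [hφ, h.hamiltonianOp_excited, map_smul, ← hφ, ← hw] at h2
      have h2' : hamiltonianOp p L (weylSch (A s) (B s) (⟪A s, B s⟫_ℝ / 2) φ)
          - (w : ℂ) • weylSch (A s) (B s) (⟪A s, B s⟫_ℝ / 2) φ
          = posV (∑ j, (-2 * γ j ^ 2 * β s j) • ξ j) (weylSch (A s) (B s) (⟪A s, B s⟫_ℝ / 2) φ)
          + ((∑ j, (α s j ^ 2 - γ j ^ 2 * β s j ^ 2) : ℝ) : ℂ) •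
            weylSch (A s) (B s) (⟪A s, B s⟫_ℝ / 2) φ
          + weylSch (A s) (B s) (⟪A s, B s⟫_ℝ / 2) (momV (∑ j, (2 * α s j) • η j) φ) := h2
      have h3 : (toL2 (weylSch (A s) (B s) (⟪A s, B s⟫_ℝ / 2) φ),
          toL2 (hamiltonianOp p L (weylSch (A s) (B s) (⟪A s, B s⟫_ℝ / 2) φ)))
            ∈ (hamiltonian p L).graph :=
        LinearPMap.le_graph_of_le (LinearPMap.le_closure _) (toL2_mem_graph _ _)
      have h4 := hUg.hasDerivAt_neg_apply_curve h1 ((hU.mem_graph_iff _ _).1 h3)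
      have h5 : CurveHasDerivAt (fun s : ℝ => Complex.exp (Complex.I * s * w))
          (Complex.exp (Complex.I * s * w) * (Complex.I * w)) s := by
        have := (((hasDerivAt_id s).ofReal_comp.const_mul Complex.I).mul_const (w : ℂ)).cexp
        simpa using this
      refine (h5.smul h4).congr_deriv ?_
      have h6 : toL2 (Complex.I • (posV (∑ j, (-2 * γ j ^ 2 * β s j) • ξ j)
            (weylSch (A s) (B s) (⟪A s, B s⟫_ℝ / 2) φ)
          + ((∑ j, (α s j ^ 2 - γ j ^ 2 * β s j ^ 2) : ℝ) : ℂ) •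
            weylSch (A s) (B s) (⟪A s, B s⟫_ℝ / 2) φ
          + weylSch (A s) (B s) (⟪A s, B s⟫_ℝ / 2) (momV (∑ j, (2 * α s j) • η j) φ)))
          - Complex.I • toL2 (hamiltonianOp p L (weylSch (A s) (B s) (⟪A s, B s⟫_ℝ / 2) φ))
          = (-(Complex.I * w)) • toL2 (weylSch (A s) (B s) (⟪A s, B s⟫_ℝ / 2) φ) := by
        rw [← h2', map_smul, map_sub, map_smul]
        module
      rw [h6, map_smul]
      module
    have hc := is_const_of_deriv_eq_zero (fun s => (hd s).differentiableAt)
      (fun s => (hd s).deriv) s 0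
    have e1 : W s (U s (toL2 φ)) = Complex.exp (Complex.I * s * w) •
        toL2 (weylSch (A s) (B s) (⟪A s, B s⟫_ℝ / 2) φ) := by
      rw [hUe, map_smul, hW]
      simp only [weylL2_toL2, hφ, hw]
    rw [e1, map_smul, hc]
    simp only [hW, weylL2_toL2, Complex.ofReal_zero, mul_zero, zero_mul, Complex.exp_zero, one_smul,
      neg_zero, hU0, one_apply_eq_self]
  have hfin : U (-t) * W t * U t = W 0 := by
    refine ContinuousLinearMap.ext_on h.dense_span_excited ?_
    rintro _ ⟨l, rfl⟩
    exact key l t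
  rw [← hW0, ← hfin, heisenberg]
  refine ContinuousLinearMap.ext fun ψ => ?_
  change U t (U (-t) (W t (U t (U (-t) ψ)))) = W t ψ
  rw [hUg.apply_neg_apply, hUg.apply_neg_apply]

end IsNormalModes

end Dynamics

/-! ### Spectral expansion of real symmetric matrices -/

section Spectral

variable {n : Type*} [Fintype n] [DecidableEq n] {A : Matrix n n ℝ} (hA : A.IsHermitian)

theorem sum_eigenvectorBasis_mul (x y : n) :
    ∑ j, hA.eigenvectorBasis j x * hA.eigenvectorBasis j y = if x = y then 1 else 0 := by
  have h := hA.eigenvectorBasis.sum_inner_mul_inner (EuclideanSpace.single x (1 : ℝ))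
    (EuclideanSpace.single y (1 : ℝ))
  simpa [EuclideanSpace.inner_single_left, EuclideanSpace.inner_single_right, Pi.single_apply,
    eq_comm] using h

theorem sum_eigenvectorBasis_mul' (j k : n) :
    ∑ x, hA.eigenvectorBasis j x * hA.eigenvectorBasis k x = if j = k then 1 else 0 := by
  have h := orthonormal_iff_ite.1 hA.eigenvectorBasis.orthonormal j k
  rw [← h]
  simp [PiLp.inner_apply, mul_comm]

/-- Passing from spectral sums to matrix powers removes the dependence on the choice of
eigenvectors; measurability of the kernels rests on this. -/
theorem sum_eigenvalues_pow_mul (m : ℕ) (x y : n) :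
    ∑ j, hA.eigenvalues j ^ m * hA.eigenvectorBasis j x * hA.eigenvectorBasis j y
      = (A ^ m) x y := by
  induction m generalizing x with
  | zero => simpa [Matrix.one_apply] using sum_eigenvectorBasis_mul hA x y
  | succ m ih =>
    rw [pow_succ', Matrix.mul_apply]
    simp only [← ih, Finset.mul_sum]
    rw [Finset.sum_comm]
    refine Finset.sum_congr rfl fun j _ => ?_
    have h := congrFun (hA.mulVec_eigenvectorBasis j) x
    simp only [Matrix.mulVec, dotProduct, Pi.smul_apply, smul_eq_mul] at h
    rw [pow_succ, mul_assoc (hA.eigenvalues j ^ m), ← h, Finset.mul_sum, Finset.sum_mul]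
    exact Finset.sum_congr rfl fun z _ => by ring

theorem sum_eigenvalues_mul (x y : n) :
    ∑ j, hA.eigenvalues j * hA.eigenvectorBasis j x * hA.eigenvectorBasis j y = A x y := by
  simpa using sum_eigenvalues_pow_mul hA 1 x y

end Spectral

/-! ### Normal modes of the oscillator system -/

section Diagonalization

/-- Every off-diagonal unordered pair has two orderings, and the diagonal contributes nothing. -/
theorem sum_sym2_eq {ι : Type*} [Fintype ι] [DecidableEq ι] (f : Sym2 ι → ℂ)
    (hf : ∀ x, f s(x, x) = 0) : ∑ x, ∑ y, f s(x, y) = 2 * ∑ e, f e := by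
  rw [← Finset.sum_product', Finset.univ_product_univ,
    ← Finset.sum_fiberwise (Finset.univ : Finset (ι × ι)) (fun z => s(z.1, z.2)), Finset.mul_sum]
  refine Finset.sum_congr rfl fun e _ => ?_
  rw [Finset.sum_congr rfl (g := fun _ => f e) fun z hz => by
    rw [(Finset.mem_filter.1 hz).2], Finset.sum_const, nsmul_eq_mul]
  induction e with | h x y =>
  by_cases hxy : x = y
  · subst hxy
    simp [hf]
  · have : (Finset.univ.filter fun z : ι × ι => s(z.1, z.2) = s(x, y)) = {(x, y), (y, x)} := by
      ext ⟨u, v⟩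
      simp
    rw [this, Finset.card_pair (by simpa using fun h => absurd h hxy)]
    norm_num

variable {d L : ℕ}

/-- The square roots of the entries of `μ`. -/
def sqrtMass (p : Params d) (x : Box d L) : ℝ := Real.sqrt (1 / (2 * p.m x))

theorem hL_apply (p : Params d) (x y : Box d L) :
    hL p L x y = sqrtMass p x * h0 p L x y * sqrtMass p y := by
  simp [hL, sqrtMu, sqrtMass, Matrix.diagonal_mul, Matrix.mul_diagonal]

theorem siteDist_self (x : Site d) : siteDist x x = 0 := by simp [siteDist]

/-- Over ordered pairs, `λ(q_x - q_y)²` is shared equally as `λ(q_x² - q_x q_y)` and its mirror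
image. The squares give the coupling part of the diagonal of `h0`, the products its entries `-λ`. -/
theorem hamiltonianOp_apply_eq (p : Params d) (φ : 𝓢(Config d L, ℂ)) :
    hamiltonianOp p L φ = ∑ x : Box d L, ((1 / (2 * p.m x) : ℝ) : ℂ) • momOp x (momOp x φ)
      + ∑ x, ∑ y, (h0 p L x y : ℂ) • posOp x (posOp y φ) := by
  have hsym : ∀ q : Config d L, ∑ e : Sym2 (Box d L), (Sym2.lift ⟨fun x y : Box d L =>
        if siteDist (x : Site d) y = 1 then
          ((p.lam s(↑x, ↑y) : ℝ) : ℂ) • (posOp x - posOp y) ^ 2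
        else 0, fun x y => by
          beta_reduce
          rw [siteDist_comm, Sym2.eq_swap, ← neg_sub (posOp y) (posOp x), neg_sq]⟩ e :
            Module.End ℂ 𝓢(Config d L, ℂ)) φ q
      = ∑ x : Box d L, ∑ y : Box d L, (if siteDist (x : Site d) y = 1 then (p.lam s(↑x, ↑y) : ℂ)
          else 0) * ((q x : ℂ) * q x - (q x : ℂ) * q y) * φ q := by
    intro q
    have h1 := sum_sym2_eq (fun e : Sym2 (Box d L) => (Sym2.lift ⟨fun x y : Box d L =>
        if siteDist (x : Site d) y = 1 then
          ((p.lam s(↑x, ↑y) : ℝ) : ℂ) • (posOp x - posOp y) ^ 2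
        else 0, fun x y => by
          beta_reduce
          rw [siteDist_comm, Sym2.eq_swap, ← neg_sub (posOp y) (posOp x), neg_sq]⟩ e :
            Module.End ℂ 𝓢(Config d L, ℂ)) φ q) (fun x => by simp [siteDist_self])
    have h2 : (2 : ℂ) ≠ 0 := two_ne_zero
    refine mul_left_cancel₀ h2 (h1.symm.trans ?_)
    have h3 : ∀ x y : Box d L, (Sym2.lift ⟨fun x y : Box d L =>
        if siteDist (x : Site d) y = 1 then
          ((p.lam s(↑x, ↑y) : ℝ) : ℂ) • (posOp x - posOp y) ^ 2
        else 0, fun x y => by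
          beta_reduce
          rw [siteDist_comm, Sym2.eq_swap, ← neg_sub (posOp y) (posOp x), neg_sq]⟩ s(x, y) :
            Module.End ℂ 𝓢(Config d L, ℂ)) φ q
        = (if siteDist (x : Site d) y = 1 then (p.lam s(↑x, ↑y) : ℂ) else 0)
            * ((q x : ℂ) * q x - (q x : ℂ) * q y) * φ q
          + (if siteDist (y : Site d) x = 1 then (p.lam s(↑y, ↑x) : ℂ) else 0)
            * ((q y : ℂ) * q y - (q y : ℂ) * q x) * φ q := by
      intro x y
      rw [Sym2.lift_mk, siteDist_comm (y : Site d), Sym2.eq_swap (a := (y : Site d))]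
      by_cases hd : siteDist (x : Site d) y = 1
      · simp only [hd, if_true, pow_two, LinearMap.smul_apply, Module.End.mul_apply,
          LinearMap.sub_apply, map_sub, smul_apply, sub_apply, posOp_apply, smul_eq_mul]
        ring
      · simp [hd]
    simp only [h3, Finset.sum_add_distrib]
    rw [Finset.sum_comm (f := fun x y : Box d L =>
      (if siteDist (y : Site d) x = 1 then (p.lam s(↑y, ↑x) : ℂ) else 0)
            * ((q y : ℂ) * q y - (q y : ℂ) * q x) * φ q)]
    ring
  ext q
  rw [hamiltonianOp, LinearMap.add_apply, add_apply, LinearMap.sum_apply, LinearMap.sum_apply,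
    sum_apply, sum_apply, hsym, add_apply, sum_apply, sum_apply, ← Finset.sum_add_distrib,
    ← Finset.sum_add_distrib]
  refine Finset.sum_congr rfl fun x _ => ?_
  simp only [pow_two, LinearMap.add_apply, LinearMap.smul_apply, Module.End.mul_apply, add_apply,
    smul_apply, sum_apply, posOp_apply, smul_eq_mul]
  rw [add_assoc]
  congr 1
  have h4 : ∀ y : Box d L, (h0 p L x y : ℂ) * ((q x : ℂ) * ((q y : ℂ) * φ q)) =
      (if x = y then ((p.k x / 2 + ∑ u : Box d L, if siteDist (x : Site d) u = 1
        then p.lam s(↑x, ↑u) else 0 : ℝ) : ℂ) * ((q x : ℂ) * ((q x : ℂ) * φ q)) else 0) -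
      (if siteDist (x : Site d) y = 1 then (p.lam s(↑x, ↑y) : ℂ) else 0)
        * ((q x : ℂ) * ((q y : ℂ) * φ q)) := by
    intro y
    simp only [h0, Matrix.of_apply]
    by_cases hxy : x = y
    · subst hxy
      simp [siteDist_self]
    · rw [if_neg hxy, if_neg hxy]
      split_ifs <;> push_cast <;> ring
  rw [Finset.sum_congr rfl fun y _ => h4 y, Finset.sum_sub_distrib, Finset.sum_ite_eq]
  simp only [Finset.mem_univ, if_true, mul_sub, sub_mul, Finset.sum_sub_distrib]
  push_cast
  have h5 : ∀ u : Box d L, (((if siteDist (x : Site d) u = 1 then p.lam s(↑x, ↑u) else 0 : ℝ)) : ℂ)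
      = if siteDist (x : Site d) u = 1 then (p.lam s(↑x, ↑u) : ℂ) else 0 := by
    intro u
    split_ifs <;> simp
  simp only [h5, add_mul, Finset.sum_mul, mul_assoc]
  ring

/-- The position vectors of the normal modes. -/
def modePos (p : Params d) (L : ℕ) (j : Box d L) : Config d L :=
  WithLp.toLp 2 fun x => (hL_isHermitian p L).eigenvectorBasis j x / sqrtMass p x

/-- The momentum vectors of the normal modes. -/
def modeMom (p : Params d) (L : ℕ) (j : Box d L) : Config d L :=
  WithLp.toLp 2 fun x => sqrtMass p x * (hL_isHermitian p L).eigenvectorBasis j x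

/-- The frequencies of the normal modes. -/
def modeFreq (p : Params d) (L : ℕ) (j : Box d L) : ℝ :=
  Real.sqrt ((hL_isHermitian p L).eigenvalues j)

theorem hL_posDef {p : Params d} (hm : ∀ x, 0 < p.m x) (h : (h0 p L).PosDef) :
    (hL p L).PosDef := by
  have hD : (sqrtMu p L).conjTranspose = sqrtMu p L := by simp [sqrtMu]
  have hu : Function.Injective (sqrtMu p L).mulVec := by
    rw [Matrix.mulVec_injective_iff_isUnit, sqrtMu, Matrix.isUnit_diagonal, Pi.isUnit_iff]
    intro x
    have := hm x
    exact (Real.sqrt_pos.2 (by positivity)).ne'.isUnit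
  have := h.conjTranspose_mul_mul_same hu
  rwa [hD] at this

/-- Scaling momenta by `μ^{1/2}` and positions by its inverse is canonical, makes the kinetic energy
the identity form and turns `h0` into `hL`; the orthonormal eigenbasis of `hL` then decouples the
modes, with squared frequencies equal to the eigenvalues. -/
theorem isNormalModes {p : Params d} (hm : ∀ x, 0 < p.m x) (h : (h0 p L).PosDef) :
    IsNormalModes p (modePos p L) (modeMom p L) (modeFreq p L) := by
  set hA := hL_isHermitian p L with hAdef
  have hE : ∀ j, 0 < hA.eigenvalues j := (hL_posDef hm h).eigenvalues_pos
  have hs : ∀ x : Box d L, 0 < sqrtMass p x := fun x => by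
    have := hm x
    exact Real.sqrt_pos.2 (by positivity)
  refine ⟨fun j => Real.sqrt_pos.2 (hE j), ?_, ?_, ?_, ?_⟩
  · intro j k
    rw [← sum_eigenvectorBasis_mul' hA j k]
    simp only [PiLp.inner_apply, modePos, modeMom, RCLike.inner_apply, conj_trivial]
    refine Finset.sum_congr rfl fun x _ => ?_
    have := (hs x).ne'
    field_simp
  · intro a
    ext x
    simp only [PiLp.inner_apply, modePos, modeMom, RCLike.inner_apply, conj_trivial,
      WithLp.ofLp_sum, WithLp.ofLp_smul, Finset.sum_apply, Pi.smul_apply, smul_eq_mul,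
      Finset.sum_mul]
    rw [Finset.sum_comm]
    have : ∀ y, ∑ j, a y * (sqrtMass p y * hA.eigenvectorBasis j y) *
        (hA.eigenvectorBasis j x / sqrtMass p x) =
        a y * sqrtMass p y / sqrtMass p x * if y = x then 1 else 0 := by
      intro y
      rw [← sum_eigenvectorBasis_mul hA y x, Finset.mul_sum]
      exact Finset.sum_congr rfl fun j _ => by ring
    rw [Finset.sum_congr rfl fun y _ => this y]
    have := (hs x).ne'
    simp [this]
  · intro a
    ext x
    simp only [PiLp.inner_apply, modePos, modeMom, RCLike.inner_apply, conj_trivial,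
      WithLp.ofLp_sum, WithLp.ofLp_smul, Finset.sum_apply, Pi.smul_apply, smul_eq_mul,
      Finset.sum_mul]
    rw [Finset.sum_comm]
    have : ∀ y, ∑ j, a y * (hA.eigenvectorBasis j y / sqrtMass p y) *
        (sqrtMass p x * hA.eigenvectorBasis j x) =
        a y / sqrtMass p y * sqrtMass p x * if y = x then 1 else 0 := by
      intro y
      rw [← sum_eigenvectorBasis_mul hA y x, Finset.mul_sum]
      exact Finset.sum_congr rfl fun j _ => by ring
    rw [Finset.sum_congr rfl fun y _ => this y]
    have := (hs x).ne'
    simp [this]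
  · intro φ
    rw [hamiltonianOp_apply_eq, Finset.sum_add_distrib]
    congr 1
    · have h1 : ∀ j, momV (modeMom p L j) (momV (modeMom p L j) φ) = ∑ x, ∑ y,
          ((modeMom p L j x * modeMom p L j y : ℝ) : ℂ) • momOp x (momOp y φ) := by
        intro j
        simp only [momV, LinearMap.sum_apply, LinearMap.smul_apply, map_sum, map_smul,
          Finset.smul_sum, smul_smul, Complex.ofReal_mul]
        rw [Finset.sum_comm]
        exact Finset.sum_congr rfl fun x _ => Finset.sum_congr rfl fun y _ => by rw [mul_comm]
      simp only [h1]
      rw [Finset.sum_comm]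
      refine Finset.sum_congr rfl fun x _ => ?_
      rw [Finset.sum_comm]
      have h2 : ∀ y, ∑ j, ((modeMom p L j x * modeMom p L j y : ℝ) : ℂ) • momOp x (momOp y φ)
          = if x = y then ((1 / (2 * p.m x) : ℝ) : ℂ) • momOp x (momOp x φ) else 0 := by
        intro y
        rw [← Finset.sum_smul, ← Complex.ofReal_sum]
        have h3 : ∑ j, modeMom p L j x * modeMom p L j y
            = sqrtMass p x * sqrtMass p y * if x = y then 1 else 0 := by
          rw [← sum_eigenvectorBasis_mul hA x y, Finset.mul_sum]
          refine Finset.sum_congr rfl fun j _ => ?_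
          simp only [modeMom]
          ring
        rw [h3]
        split_ifs with hxy
        · subst hxy
          have := hm x
          rw [mul_one, sqrtMass, Real.mul_self_sqrt (by positivity)]
        · simp
      rw [Finset.sum_congr rfl fun y _ => h2 y, Finset.sum_ite_eq]
      simp
    · have h1 : ∀ j, posV (modePos p L j) (posV (modePos p L j) φ) = ∑ x, ∑ y,
          ((modePos p L j x * modePos p L j y : ℝ) : ℂ) • posOp x (posOp y φ) := by
        intro j
        simp only [posV, LinearMap.sum_apply, LinearMap.smul_apply, map_sum, map_smul,
          Finset.smul_sum, smul_smul, Complex.ofReal_mul]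
        rw [Finset.sum_comm]
        exact Finset.sum_congr rfl fun x _ => Finset.sum_congr rfl fun y _ => by rw [mul_comm]
      simp only [h1, Finset.smul_sum]
      rw [Finset.sum_comm (s := Finset.univ (α := Box d L)) (t := Finset.univ (α := Box d L))
        (f := fun j x => ∑ y, (modeFreq p L j : ℂ) ^ 2 •
          ((modePos p L j x * modePos p L j y : ℝ) : ℂ) • posOp x (posOp y φ))]
      refine Finset.sum_congr rfl fun x _ => ?_
      rw [Finset.sum_comm]
      refine Finset.sum_congr rfl fun y _ => ?_
      simp only [smul_smul]
      rw [← Finset.sum_smul]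
      congr 1
      have h3 : h0 p L x y = ∑ j, modeFreq p L j ^ 2 * (modePos p L j x * modePos p L j y) := by
        have h4 := hL_apply p x y
        rw [← sum_eigenvalues_mul hA x y] at h4
        have h5 : h0 p L x y = (∑ j, hA.eigenvalues j * hA.eigenvectorBasis j x *
            hA.eigenvectorBasis j y) / (sqrtMass p x * sqrtMass p y) := by
          have := (hs x).ne'
          have := (hs y).ne'
          rw [h4]
          field_simp
        rw [h5, Finset.sum_div]
        refine Finset.sum_congr rfl fun j _ => ?_
        rw [modeFreq, Real.sq_sqrt (hE j).le]
        simp only [modePos]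
        ring
      rw [h3]
      push_cast
      rfl

end Diagonalization

/-! ### The propagation kernels -/

section Kernel

/-- The three functions of the one-particle operator that enter the classical flow:
`cos (2 t √s)`, `sin (2 t √s) / √s` and `√s sin (2 t √s)`. -/
def flowFun (i : Fin 3) (t s : ℝ) : ℝ :=
  ![Real.cos (2 * √s * t), (√s)⁻¹ * Real.sin (2 * √s * t), √s * Real.sin (2 * √s * t)] i

theorem continuous_flowFun (i : Fin 3) (s : ℝ) : Continuous fun t => flowFun i t s := by
  fin_cases i <;> simp only [flowFun] <;> simp <;> fun_prop

/-- Multiplication by `√s` gives `√s cos`, `sin` and `s sin`, all bounded on `(0, B]` uniformly in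
time. The singular second function is the reason for the exponent `-1/2` in the correlators. -/
theorem abs_sqrt_mul_flowFun_le (i : Fin 3) (t : ℝ) {s B : ℝ} (hs : 0 < s) (hB : s ≤ B) :
    |√s * flowFun i t s| ≤ 1 + B := by
  have h0 : 0 < √s := Real.sqrt_pos.2 hs
  have h1 : √s * √s = s := Real.mul_self_sqrt hs.le
  have h2 : √s ≤ 1 + B := by nlinarith [sq_nonneg (√s - 1)]
  have hc := Real.abs_cos_le_one (2 * √s * t)
  have hsn := Real.abs_sin_le_one (2 * √s * t)
  fin_cases i
  · simp only [flowFun, Fin.zero_eta, Matrix.cons_val_zero]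
    rw [abs_mul, abs_of_pos h0]
    nlinarith [abs_nonneg (Real.cos (2 * √s * t))]
  · simp only [flowFun, Fin.mk_one, Matrix.cons_val_one]
    simp only [Matrix.cons_val_zero]
    rw [mul_inv_cancel_left₀ h0.ne']
    linarith
  · simp only [flowFun, Fin.reduceFinMk, Matrix.cons_val]
    rw [← mul_assoc, h1, abs_mul, abs_of_pos hs]
    nlinarith [abs_nonneg (Real.sin (2 * √s * t))]

/-- All three functions are even in `√s`, hence power series in `s`; the third starts at degree one,
whence the shifted exponent. -/
theorem exists_hasSum_flowFun (i : Fin 3) (t : ℝ) : ∃ (c : ℕ → ℝ) (e : ℕ → ℕ), ∀ s, 0 < s →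
    HasSum (fun n => c n * s ^ e n) (flowFun i t s) := by
  have h1 : ∀ s : ℝ, 0 < s → ∀ n : ℕ, √s ^ (2 * n) = s ^ n := fun s hs n => by
    rw [pow_mul, Real.sq_sqrt hs.le]
  fin_cases i
  · refine ⟨fun n => (-1) ^ n * (2 * t) ^ (2 * n) / ((2 * n).factorial : ℝ), fun n => n,
      fun s hs => ?_⟩
    refine HasSum.congr_fun (Real.hasSum_cos (2 * √s * t)) fun n => ?_
    rw [show 2 * √s * t = 2 * t * √s by ring, mul_pow (2 * t), h1 s hs]
    ring
  · refine ⟨fun n => (-1) ^ n * (2 * t) ^ (2 * n + 1) / ((2 * n + 1).factorial : ℝ), fun n => n,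
      fun s hs => ?_⟩
    refine HasSum.congr_fun ((Real.hasSum_sin (2 * √s * t)).mul_left (√s)⁻¹) fun n => ?_
    have h0 : 0 < √s := Real.sqrt_pos.2 hs
    rw [show 2 * √s * t = 2 * t * √s by ring, mul_pow (2 * t), pow_succ (√s), h1 s hs]
    field_simp
  · refine ⟨fun n => (-1) ^ n * (2 * t) ^ (2 * n + 1) / ((2 * n + 1).factorial : ℝ),
      fun n => n + 1, fun s hs => ?_⟩
    refine HasSum.congr_fun ((Real.hasSum_sin (2 * √s * t)).mul_left (√s)) fun n => ?_
    rw [show 2 * √s * t = 2 * t * √s by ring, mul_pow (2 * t), pow_succ (√s), h1 s hs, pow_succ s]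
    nth_rewrite 2 [← Real.mul_self_sqrt hs.le]
    ring

variable {n : Type*} [Fintype n] [DecidableEq n] {A : Matrix n n ℝ} (hA : A.IsHermitian)

/-- The matrix elements of `flowFun i t A`. -/
def flowKernel (i : Fin 3) (t : ℝ) (x y : n) : ℝ :=
  ∑ j, flowFun i t (hA.eigenvalues j) * hA.eigenvectorBasis j x * hA.eigenvectorBasis j y

theorem continuous_flowKernel (i : Fin 3) (x y : n) :
    Continuous fun t => flowKernel hA i t x y :=
  continuous_finsetSum _ fun j _ =>
    ((continuous_flowFun i (hA.eigenvalues j)).mul continuous_const).mul continuous_const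

theorem hasSum_flowKernel {i : Fin 3} {t : ℝ} {c : ℕ → ℝ} {e : ℕ → ℕ}
    (h : ∀ s, 0 < s → HasSum (fun n => c n * s ^ e n) (flowFun i t s))
    (hpos : ∀ j, 0 < hA.eigenvalues j) (x y : n) :
    HasSum (fun m => c m * (A ^ e m) x y) (flowKernel hA i t x y) := by
  refine HasSum.congr_fun (hasSum_sum (s := Finset.univ) fun j _ =>
    ((h _ (hpos j)).mul_right (hA.eigenvectorBasis j x)).mul_right (hA.eigenvectorBasis j y)) fun m => ?_
  rw [← sum_eigenvalues_pow_mul hA, Finset.mul_sum]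
  exact Finset.sum_congr rfl fun j _ => by ring

theorem enorm_le_iSup_rat {φ : ℝ → ℝ} (hφ : Continuous φ) (r t : ℝ) :
    ‖φ t‖ₑ ^ r ≤ ⨆ q : ℚ, ‖φ q‖ₑ ^ r := by
  have hc : Continuous fun t => ‖φ t‖ₑ ^ r :=
    (ENNReal.continuous_rpow_const).comp hφ.enorm
  have hcl : IsClosed {t | ‖φ t‖ₑ ^ r ≤ ⨆ q : ℚ, ‖φ q‖ₑ ^ r} := isClosed_le hc continuous_const
  have hsub : Set.range ((↑) : ℚ → ℝ) ⊆ {t | ‖φ t‖ₑ ^ r ≤ ⨆ q : ℚ, ‖φ q‖ₑ ^ r} := by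
    rintro _ ⟨q, rfl⟩
    exact le_iSup (fun q : ℚ => ‖φ q‖ₑ ^ r) q
  exact hcl.closure_subset_iff.2 hsub (Rat.denseRange_cast (𝕜 := ℝ) t)

/-- Gershgorin's bound in terms of the row sums. -/
theorem eigenvalues_le_of_sum_abs_le {B : ℝ} (h : ∀ x, ∑ y, |A x y| ≤ B) (j : n) :
    hA.eigenvalues j ≤ B := by
  have hev : Module.End.HasEigenvalue (Matrix.toLin' A) (hA.eigenvalues j) := by
    refine Module.End.hasEigenvalue_of_hasEigenvector
      (x := (hA.eigenvectorBasis j : n → ℝ)) ⟨?_, ?_⟩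
    · rw [Module.End.mem_eigenspace_iff, Matrix.toLin'_apply, hA.mulVec_eigenvectorBasis]
    · intro h0
      have h1 := hA.eigenvectorBasis.orthonormal.ne_zero j
      exact h1 (by ext x; exact congrFun h0 x)
  obtain ⟨k, hk⟩ := eigenvalue_mem_ball hev
  rw [mem_closedBall_iff_norm, Real.norm_eq_abs] at hk
  have h1 := h k
  rw [← Finset.add_sum_erase _ _ (Finset.mem_univ k)] at h1
  simp only [Real.norm_eq_abs] at hk
  have := le_abs_self (hA.eigenvalues j - A k k)
  have := le_abs_self (A k k)
  linarith

end Kernel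

/-! ### Elementary inequalities for powers with exponent at most one -/

theorem sum_rpow_le_sum_rpow {ι : Type*} (s : Finset ι) (f : ι → ℝ≥0∞) {r : ℝ} (h0 : 0 < r)
    (h1 : r ≤ 1) : (∑ i ∈ s, f i) ^ r ≤ ∑ i ∈ s, f i ^ r := by
  classical
  induction s using Finset.induction_on with
  | empty => simp [h0]
  | insert a s ha ih =>
    rw [Finset.sum_insert ha, Finset.sum_insert ha]
    exact (ENNReal.rpow_add_le_add_rpow _ _ h0.le h1).trans (add_le_add_right ih _)

/-- For `|σ| ≤ 1` the Lipschitz bound `|σ|` is at most `|σ|^r`; for larger `σ` the trivial bound `2`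
suffices. -/
theorem enorm_exp_I_mul_sub_one_le (σ : ℝ) {r : ℝ} (h0 : 0 < r) (h1 : r ≤ 1) :
    ‖Complex.exp (Complex.I * σ) - 1‖ₑ ≤ 2 * ‖σ‖ₑ ^ r := by
  rcases le_total ‖σ‖ₑ 1 with h | h
  · refine Real.enorm_exp_I_mul_ofReal_sub_one_le.trans ?_
    calc ‖σ‖ₑ = ‖σ‖ₑ ^ (1 : ℝ) := (ENNReal.rpow_one _).symm
      _ ≤ ‖σ‖ₑ ^ r := ENNReal.rpow_le_rpow_of_exponent_ge h h1
      _ ≤ 2 * ‖σ‖ₑ ^ r := le_mul_of_one_le_left' one_le_two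
  · calc ‖Complex.exp (Complex.I * σ) - 1‖ₑ
        ≤ ‖Complex.exp (Complex.I * σ)‖ₑ + ‖(1 : ℂ)‖ₑ := enorm_sub_le
      _ = 2 := by
        rw [← ofReal_norm, mul_comm, Complex.norm_exp_ofReal_mul_I]
        simp [one_add_one_eq_two]
      _ ≤ 2 * ‖σ‖ₑ ^ r := le_mul_of_one_le_right' (ENNReal.one_le_rpow h h0)

/-! ### Bounds on the one-particle operators that are uniform in the volume -/

section Uniform

variable {d L : ℕ}

/-- Neighbours lie in the cube of side three around `x`. The count is crude; what matters is that it
does not depend on `L`. -/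
theorem card_neighbors_le (x : Box d L) :
    (Finset.univ.filter fun u : Box d L => siteDist (x : Site d) u = 1).card ≤ 3 ^ d := by
  have h1 : (Finset.univ.filter fun u : Box d L => siteDist (x : Site d) u = 1).card ≤
      (Finset.Icc (fun i => (x : Site d) i - 1) (fun i => (x : Site d) i + 1)).card := by
    refine Finset.card_le_card_of_injOn (fun u => (u : Site d)) ?_ Subtype.val_injective.injOn
    intro u hu
    have hu' : siteDist (x : Site d) u = 1 := by simpa using hu
    have h2 : ∀ i, ((x : Site d) i - (u : Site d) i).natAbs ≤ 1 := fun i => by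
      rw [← hu', siteDist]
      exact Finset.single_le_sum (f := fun i => ((x : Site d) i - (u : Site d) i).natAbs)
        (fun _ _ => Nat.zero_le _) (Finset.mem_univ i)
    simp only [Finset.coe_Icc, Set.mem_Icc, Pi.le_def]
    exact ⟨fun i => by have := h2 i; omega, fun i => by have := h2 i; omega⟩
  refine h1.trans (le_of_eq ?_)
  rw [Pi.card_Icc]
  have : ∀ i, (Finset.Icc ((x : Site d) i - 1) ((x : Site d) i + 1)).card = 3 := fun i => by
    rw [Int.card_Icc]; omega
  simp [this]

variable {p : Params d} {mMin mMax kMax lamMax : ℝ}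

theorem sum_neighbors_le (hp : p.Bounds mMin mMax kMax lamMax) (x : Box d L) :
    ∑ u : Box d L, (if siteDist (x : Site d) u = 1 then p.lam s(↑x, ↑u) else 0)
      ≤ 3 ^ d * |lamMax| := by
  rw [← Finset.sum_filter]
  calc _ ≤ ∑ u ∈ Finset.univ.filter (fun u : Box d L => siteDist (x : Site d) u = 1), |lamMax| :=
        Finset.sum_le_sum fun u hu =>
          ((hp.lam_mem _ _ (Finset.mem_filter.1 hu).2).2).trans (le_abs_self _)
    _ ≤ 3 ^ d * |lamMax| := by
      rw [Finset.sum_const, nsmul_eq_mul]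
      exact mul_le_mul_of_nonneg_right (by exact_mod_cast card_neighbors_le x) (abs_nonneg _)

theorem sum_abs_h0_le (hp : p.Bounds mMin mMax kMax lamMax) (x : Box d L) :
    ∑ y, |h0 p L x y| ≤ kMax / 2 + 2 * (3 ^ d * |lamMax|) := by
  have hn : ∀ u : Box d L, 0 ≤ if siteDist (x : Site d) u = 1 then p.lam s(↑x, ↑u) else 0 :=
    fun u => by
      split_ifs with h
      exacts [(hp.lam_mem _ _ h).1, le_rfl]
  have h1 : ∀ y, |h0 p L x y| ≤ (if x = y then p.k x / 2 + ∑ u : Box d L,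
        (if siteDist (x : Site d) u = 1 then p.lam s(↑x, ↑u) else 0) else 0) +
      (if siteDist (x : Site d) y = 1 then p.lam s(↑x, ↑y) else 0) := by
    intro y
    simp only [h0, Matrix.of_apply]
    by_cases hxy : x = y
    · rw [if_pos hxy, if_pos hxy, abs_of_nonneg]
      · linarith [hn y]
      · have := (hp.k_mem x).1
        have := Finset.sum_nonneg fun u (_ : u ∈ Finset.univ) => hn u
        positivity
    · rw [if_neg hxy, if_neg hxy, zero_add]
      have := hn y
      split_ifs with h
      · rw [if_pos h] at this
        rw [abs_neg, abs_of_nonneg this]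
      · simp
  refine (Finset.sum_le_sum fun y _ => h1 y).trans ?_
  rw [Finset.sum_add_distrib, Finset.sum_ite_eq]
  have h2 := sum_neighbors_le hp x
  have h3 := (hp.k_mem x).2
  simp only [Finset.mem_univ, if_true]
  linarith

theorem sqrtMass_pos (hp : p.Bounds mMin mMax kMax lamMax) (x : Box d L) : 0 < sqrtMass p x := by
  have := hp.mMin_pos.trans_le (hp.m_mem x).1
  exact Real.sqrt_pos.2 (by positivity)

theorem sqrtMass_le (hp : p.Bounds mMin mMax kMax lamMax) (x : Box d L) :
    sqrtMass p x ≤ √(1 / (2 * mMin)) := by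
  have h1 := (hp.m_mem x).1
  have h2 := hp.mMin_pos
  exact Real.sqrt_le_sqrt (by gcongr)

theorem inv_sqrtMass_le (hp : p.Bounds mMin mMax kMax lamMax) (x : Box d L) :
    (sqrtMass p x)⁻¹ ≤ √(2 * mMax) := by
  have h1 := (hp.m_mem x).2
  rw [sqrtMass, ← Real.sqrt_inv, one_div, inv_inv]
  exact Real.sqrt_le_sqrt (by gcongr)

/-- A bound for the eigenvalues of all the operators `h_L`. -/
def eigenBound (d : ℕ) (mMin kMax lamMax : ℝ) : ℝ :=
  1 / (2 * mMin) * (kMax / 2 + 2 * (3 ^ d * |lamMax|))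

theorem eigenvalues_hL_le (hp : p.Bounds mMin mMax kMax lamMax) (j : Box d L) :
    (hL_isHermitian p L).eigenvalues j ≤ eigenBound d mMin kMax lamMax := by
  refine eigenvalues_le_of_sum_abs_le _ (fun x => ?_) j
  have hmin := hp.mMin_pos
  have hs := Real.mul_self_sqrt (show 0 ≤ 1 / (2 * mMin) by positivity)
  calc ∑ y, |hL p L x y| ≤ ∑ y, 1 / (2 * mMin) * |h0 p L x y| := by
        refine Finset.sum_le_sum fun y _ => ?_
        rw [hL_apply, abs_mul, abs_mul, abs_of_pos (sqrtMass_pos hp x),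
          abs_of_pos (sqrtMass_pos hp y), ← hs, mul_right_comm]
        gcongr
        exacts [(sqrtMass_pos hp y).le, sqrtMass_le hp x, sqrtMass_le hp y]
    _ ≤ _ := by
      rw [← Finset.mul_sum, eigenBound]
      exact mul_le_mul_of_nonneg_left (sum_abs_h0_le hp x) (by positivity)

theorem eigenBound_nonneg (hp : p.Bounds mMin mMax kMax lamMax) :
    0 ≤ eigenBound d mMin kMax lamMax := by
  have h1 := hp.mMin_pos
  have h2 := (hp.k_mem 0).1.trans (hp.k_mem 0).2
  rw [eigenBound]
  positivity

/-- The propagation kernels are dominated by the eigenfunction correlators. -/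
theorem enorm_flowKernel_rpow_le (hp : p.Bounds mMin mMax kMax lamMax)
    (hpd : (hL p L).PosDef) (i : Fin 3) (t : ℝ) (x y : Box d L) {r : ℝ} (hr : 0 < r) :
    ‖flowKernel (hL_isHermitian p L) i t x y‖ₑ ^ r ≤
      ENNReal.ofReal ((1 + eigenBound d mMin kMax lamMax) ^ r)
        * eigenCorrelator (-1 / 2) r p L x y := by
  set B := eigenBound d mMin kMax lamMax with hB
  have hB0 : 0 < 1 + B := by have := eigenBound_nonneg hp; linarith
  -- The correlator admits only `|u| ≤ 1` on the whole line, so `√s` times the flow function is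
  -- normalised and cut off outside `(0, B]`; all eigenvalues lie inside, so the cutoff is
  -- invisible.
  set u : ℝ → ℂ := fun s => if 0 < s ∧ s ≤ B then ((√s * flowFun i t s / (1 + B) : ℝ) : ℂ) else 0
    with hu
  have hu1 : ∀ s, ‖u s‖ ≤ 1 := by
    intro s
    simp only [hu]
    split_ifs with h
    · rw [Complex.norm_real, Real.norm_eq_abs, abs_div, abs_of_pos hB0, div_le_one hB0]
      exact abs_sqrt_mul_flowFun_le i t h.1 h.2
    · simp
  have hE : ∀ j, 0 < (hL_isHermitian p L).eigenvalues j := hpd.eigenvalues_pos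
  have hmat : ((1 + B : ℝ) : ℂ) * matFun (hL_isHermitian p L)
      (fun s => ((s ^ (-1 / 2 : ℝ) : ℝ) : ℂ) * u s) x y
      = (flowKernel (hL_isHermitian p L) i t x y : ℂ) := by
    rw [matFun, Matrix.of_apply, flowKernel, Complex.ofReal_sum, Finset.mul_sum]
    refine Finset.sum_congr rfl fun j _ => ?_
    have hj := hE j
    have hs0 := (Real.sqrt_pos.2 hj).ne'
    have hc : 0 < (hL_isHermitian p L).eigenvalues j ∧ (hL_isHermitian p L).eigenvalues j ≤ B :=
      ⟨hj, eigenvalues_hL_le hp j⟩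
    simp only [hu]
    rw [if_pos hc, show (-1 / 2 : ℝ) = -(1 / 2) by ring, Real.rpow_neg hj.le, ← Real.sqrt_eq_rpow]
    norm_cast
    field_simp
  have h1 : ‖flowKernel (hL_isHermitian p L) i t x y‖ₑ = ENNReal.ofReal (1 + B) *
      ‖matFun (hL_isHermitian p L) (fun s => ((s ^ (-1 / 2 : ℝ) : ℝ) : ℂ) * u s) x y‖ₑ := by
    have h2 : ∀ a : ℝ, ‖(a : ℂ)‖ₑ = ‖a‖ₑ := fun a => by
      rw [← ofReal_norm, ← ofReal_norm, Complex.norm_real]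
    rw [← Real.enorm_eq_ofReal hB0.le, ← h2, ← hmat, enorm_mul, h2]
  rw [h1, ENNReal.mul_rpow_of_nonneg _ _ hr.le, ENNReal.ofReal_rpow_of_pos hB0]
  refine mul_le_mul_right ?_ _
  exact le_iSup₂ (f := fun (u : ℝ → ℂ) (_ : ∀ s, ‖u s‖ ≤ 1) =>
    ‖matFun (hL_isHermitian p L) (fun s => ((s ^ (-1 / 2 : ℝ) : ℝ) : ℂ) * u s) x y‖ₑ ^ r) u hu1

end Uniform

/-! ### Measurability of the propagation kernels -/

section Measurability

variable {d L : ℕ} {Ω : Type*} [MeasurableSpace Ω] {P : Measure Ω} {p : Ω → Params d}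

theorem measurable_hL_pow (hm : ∀ x, Measurable fun ω => (p ω).m x)
    (hk : ∀ x, Measurable fun ω => (p ω).k x)
    (hlam : ∀ x y, siteDist x y = 1 → Measurable fun ω => (p ω).lam s(x, y))
    (n : ℕ) (x y : Box d L) : Measurable fun ω => (hL (p ω) L ^ n) x y := by
  have h1 : ∀ x y : Box d L, Measurable fun ω => hL (p ω) L x y := by
    intro x y
    simp only [hL_apply]
    have h2 : ∀ x : Box d L, Measurable fun ω => sqrtMass (p ω) x := fun x =>
      (((hm x).const_mul 2).const_div 1).sqrt
    have h3 : ∀ x u : Box d L, Measurable fun ω =>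
        if siteDist (x : Site d) u = 1 then (p ω).lam s(↑x, ↑u) else 0 := fun x u => by
      split_ifs with h
      exacts [hlam _ _ h, measurable_const]
    refine ((h2 x).mul ?_).mul (h2 y)
    simp only [h0, Matrix.of_apply]
    split_ifs with hxy h
    · exact ((hk x).div_const 2).add (Finset.measurable_fun_sum _ fun u _ => h3 x u)
    · exact (hlam _ _ h).neg
    · exact measurable_const
  induction n generalizing x with
  | zero => simp
  | succ n ih =>
    simp only [pow_succ', Matrix.mul_apply]
    exact Finset.measurable_fun_sum _ fun z _ => (h1 x z).mul (ih z)

theorem aemeasurable_flowKernel (hm : ∀ x, Measurable fun ω => (p ω).m x)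
    (hk : ∀ x, Measurable fun ω => (p ω).k x)
    (hlam : ∀ x y, siteDist x y = 1 → Measurable fun ω => (p ω).lam s(x, y))
    (hpd : ∀ᵐ ω ∂P, (hL (p ω) L).PosDef) (i : Fin 3) (t : ℝ) (x y : Box d L) :
    AEMeasurable (fun ω => flowKernel (hL_isHermitian (p ω) L) i t x y) P := by
  obtain ⟨c, e, hce⟩ := exists_hasSum_flowFun i t
  refine aemeasurable_of_tendsto_metrizable_ae'
    (f := fun N ω => ∑ n ∈ Finset.range N, c n * (hL (p ω) L ^ e n) x y) (fun N => ?_) ?_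
  · exact (Finset.measurable_fun_sum _ fun n _ =>
      (measurable_hL_pow hm hk hlam (e n) x y).const_mul (c n)).aemeasurable
  · filter_upwards [hpd] with ω hω
    exact (hasSum_flowKernel _ hce hω.eigenvalues_pos x y).tendsto_sum_nat

end Measurability

/-! ### The symplectic form along the classical flow -/

section Symplectic

variable {d L : ℕ}

theorem sum_flowFun_mul {n : Type*} [Fintype n] [DecidableEq n] {A : Matrix n n ℝ}
    (hA : A.IsHermitian) (i : Fin 3) (t : ℝ) (u w : n → ℝ) :
    ∑ j, flowFun i t (hA.eigenvalues j) * (∑ x, u x * hA.eigenvectorBasis j x)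
        * (∑ y, w y * hA.eigenvectorBasis j y)
      = ∑ x, ∑ y, u x * w y * flowKernel hA i t x y := by
  calc _ = ∑ j, ∑ x, ∑ y, u x * w y * (flowFun i t (hA.eigenvalues j) * hA.eigenvectorBasis j x
        * hA.eigenvectorBasis j y) := by
        refine Finset.sum_congr rfl fun j _ => ?_
        rw [mul_assoc, Finset.sum_mul_sum, Finset.mul_sum]
        refine Finset.sum_congr rfl fun x _ => ?_
        rw [Finset.mul_sum]
        exact Finset.sum_congr rfl fun y _ => by ring
    _ = _ := by
      rw [Finset.sum_comm]
      refine Finset.sum_congr rfl fun x _ => ?_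
      rw [Finset.sum_comm]
      exact Finset.sum_congr rfl fun y _ => (Finset.mul_sum _ _ _).symm

/-- The pairing of the flowed vector with a second one, rewritten from normal modes to lattice
sites: the diagonal mode sums become the three kernels, and the mass factors stay with the vectors.
-/
theorem inner_flowMom_sub_inner_flowPos (p : Params d) (a b c e : Config d L) (t : ℝ) :
    ⟪c, flowMom (modePos p L) (modeMom p L) (modeFreq p L) a b t⟫_ℝ
        - ⟪flowPos (modePos p L) (modeMom p L) (modeFreq p L) a b t, e⟫_ℝ
      = ∑ x, ∑ y,
        ((b x / sqrtMass p x * (sqrtMass p y * c y) - sqrtMass p x * a x * (e y / sqrtMass p y))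
            * flowKernel (hL_isHermitian p L) 0 t x y
          + sqrtMass p x * a x * (sqrtMass p y * c y) * flowKernel (hL_isHermitian p L) 1 t x y
          + b x / sqrtMass p x * (e y / sqrtMass p y)
            * flowKernel (hL_isHermitian p L) 2 t x y) := by
  have hpos : ∀ (a : Config d L) j, ⟪modePos p L j, a⟫_ℝ
      = ∑ x, a x / sqrtMass p x * (hL_isHermitian p L).eigenvectorBasis j x := fun a j => by
    simp only [PiLp.inner_apply, modePos, RCLike.inner_apply, conj_trivial]
    exact Finset.sum_congr rfl fun x _ => by ring
  have hmom : ∀ (a : Config d L) j, ⟪modeMom p L j, a⟫_ℝ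
      = ∑ x, sqrtMass p x * a x * (hL_isHermitian p L).eigenvectorBasis j x := fun a j => by
    simp only [PiLp.inner_apply, modeMom, RCLike.inner_apply, conj_trivial]
    exact Finset.sum_congr rfl fun x _ => by ring
  have h1 : ⟪c, flowMom (modePos p L) (modeMom p L) (modeFreq p L) a b t⟫_ℝ
        - ⟪flowPos (modePos p L) (modeMom p L) (modeFreq p L) a b t, e⟫_ℝ
      = ∑ j, flowFun 0 t ((hL_isHermitian p L).eigenvalues j) * ⟪modePos p L j, b⟫_ℝ
            * ⟪modeMom p L j, c⟫_ℝ
        - ∑ j, flowFun 0 t ((hL_isHermitian p L).eigenvalues j) * ⟪modeMom p L j, a⟫_ℝ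
            * ⟪modePos p L j, e⟫_ℝ
        + ∑ j, flowFun 1 t ((hL_isHermitian p L).eigenvalues j) * ⟪modeMom p L j, a⟫_ℝ
            * ⟪modeMom p L j, c⟫_ℝ
        + ∑ j, flowFun 2 t ((hL_isHermitian p L).eigenvalues j) * ⟪modePos p L j, b⟫_ℝ
            * ⟪modePos p L j, e⟫_ℝ := by
    rw [flowMom, flowPos, inner_sum, sum_inner, ← Finset.sum_sub_distrib,
      ← Finset.sum_sub_distrib, ← Finset.sum_add_distrib, ← Finset.sum_add_distrib]
    refine Finset.sum_congr rfl fun j _ => ?_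
    rw [real_inner_smul_right, real_inner_smul_left, real_inner_comm (modeMom p L j) c]
    simp only [posCoeff, momCoeff, flowFun, modeFreq, Matrix.cons_val]
    ring
  simp only [h1, hpos, hmom, sum_flowFun_mul, ← Finset.sum_sub_distrib, ← Finset.sum_add_distrib]
  exact Finset.sum_congr rfl fun x _ => Finset.sum_congr rfl fun y _ => by ring

variable {p : Params d} {mMin mMax kMax lamMax : ℝ}

/-- A bound for the numbers `(2 m_x)^{-1/2}` and their inverses. -/
def massBound (mMin mMax : ℝ) : ℝ := √(1 / (2 * mMin)) + √(2 * mMax)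

theorem abs_symplectic_le (hp : p.Bounds mMin mMax kMax lamMax) (f g : Box d L → ℂ) (t : ℝ) :
    |⟪reV g, flowMom (modePos p L) (modeMom p L) (modeFreq p L) (reV f) (imV f) t⟫_ℝ
        - ⟪flowPos (modePos p L) (modeMom p L) (modeFreq p L) (reV f) (imV f) t, imV g⟫_ℝ|
      ≤ ∑ z : Box d L × Box d L × Fin 3, 2 * massBound mMin mMax ^ 2 * ‖f z.1‖ * ‖g z.2.1‖
          * |flowKernel (hL_isHermitian p L) z.2.2 t z.1 z.2.1| := by
  rw [inner_flowMom_sub_inner_flowPos]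
  simp only [Fintype.sum_prod_type]
  refine (Finset.abs_sum_le_sum_abs _ _).trans (Finset.sum_le_sum fun x _ => ?_)
  refine (Finset.abs_sum_le_sum_abs _ _).trans (Finset.sum_le_sum fun y _ => ?_)
  set D := massBound mMin mMax with hD
  have hs1 : ∀ x : Box d L, sqrtMass p x ≤ D := fun x =>
    (sqrtMass_le hp x).trans (le_add_of_nonneg_right (Real.sqrt_nonneg _))
  have hs2 : ∀ x : Box d L, (sqrtMass p x)⁻¹ ≤ D := fun x =>
    (inv_sqrtMass_le hp x).trans (le_add_of_nonneg_left (Real.sqrt_nonneg _))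
  have hs0 : ∀ x : Box d L, 0 < sqrtMass p x := sqrtMass_pos hp
  have hD0 : 0 ≤ D := (hs0 x).le.trans (hs1 x)
  have hmul : ∀ (f : Box d L → ℂ) (x : Box d L) (v : ℝ), |v| ≤ ‖f x‖ →
      |sqrtMass p x * v| ≤ D * ‖f x‖ := fun f x v hv => by
    rw [abs_mul, abs_of_pos (hs0 x)]
    exact mul_le_mul (hs1 x) hv (abs_nonneg _) hD0
  have hdiv : ∀ (f : Box d L → ℂ) (x : Box d L) (v : ℝ), |v| ≤ ‖f x‖ →
      |v / sqrtMass p x| ≤ D * ‖f x‖ := fun f x v hv => by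
    rw [div_eq_inv_mul, abs_mul, abs_of_pos (inv_pos.2 (hs0 x))]
    exact mul_le_mul (hs2 x) hv (abs_nonneg _) hD0
  have hre : ∀ (f : Box d L → ℂ) (x : Box d L), |reV f x| ≤ ‖f x‖ := fun f x =>
    Complex.abs_re_le_norm (f x)
  have him : ∀ (f : Box d L → ℂ) (x : Box d L), |imV f x| ≤ ‖f x‖ := fun f x =>
    Complex.abs_im_le_norm (f x)
  have hprod : ∀ u v : ℝ, |u| ≤ D * ‖f x‖ → |v| ≤ D * ‖g y‖ →
      |u * v| ≤ D ^ 2 * ‖f x‖ * ‖g y‖ := fun u v hu hv => by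
    rw [abs_mul]
    calc |u| * |v| ≤ (D * ‖f x‖) * (D * ‖g y‖) :=
          mul_le_mul hu hv (abs_nonneg _) (by positivity)
      _ = _ := by ring
  have hN : 0 ≤ D ^ 2 * ‖f x‖ * ‖g y‖ := by positivity
  rw [Fin.sum_univ_three]
  refine (abs_add_le _ _).trans (add_le_add ((abs_add_le _ _).trans (add_le_add ?_ ?_)) ?_)
  · rw [abs_mul]
    -- The cosine kernel carries two products, which is the origin of the factor `2` used for all
    -- three kernels.
    refine mul_le_mul_of_nonneg_right ((abs_sub _ _).trans ?_) (abs_nonneg _)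
    linarith [hprod _ _ (hdiv f x _ (him f x)) (hmul g y _ (hre g y)),
      hprod _ _ (hmul f x _ (hre f x)) (hdiv g y _ (him g y))]
  · rw [abs_mul]
    refine mul_le_mul_of_nonneg_right ?_ (abs_nonneg _)
    linarith [hprod _ _ (hmul f x _ (hre f x)) (hmul g y _ (hre g y))]
  · rw [abs_mul]
    refine mul_le_mul_of_nonneg_right ?_ (abs_nonneg _)
    linarith [hprod _ _ (hdiv f x _ (him f x)) (hdiv g y _ (him g y))]

theorem enorm_lie_heisenberg_weyl_le (hp : p.Bounds mMin mMax kMax lamMax)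
    (hpd : (h0 p L).PosDef) (f g : Box d L → ℂ) (t : ℝ) {r : ℝ} (hr0 : 0 < r) (hr1 : r ≤ 1) :
    ‖⁅heisenberg p L t (weyl f), weyl g⁆‖ₑ ≤ ∑ z : Box d L × Box d L × Fin 3,
      ENNReal.ofReal (2 * (2 * massBound mMin mMax ^ 2) ^ r * (‖f z.1‖ ^ r * ‖g z.2.1‖ ^ r))
        * ‖flowKernel (hL_isHermitian p L) z.2.2 t z.1 z.2.1‖ₑ ^ r := by
  have hm : ∀ x, 0 < p.m x := fun x => hp.mMin_pos.trans_le (hp.m_mem x).1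
  rw [weyl_eq f, weyl_eq g, (isNormalModes hm hpd).heisenberg_weylL2]
  set σ := ⟪reV g, flowMom (modePos p L) (modeMom p L) (modeFreq p L) (reV f) (imV f) t⟫_ℝ
        - ⟪flowPos (modePos p L) (modeMom p L) (modeFreq p L) (reV f) (imV f) t, imV g⟫_ℝ with hσ
  calc _ ≤ ‖Complex.exp (Complex.I * σ) - 1‖ₑ :=
        enorm_le_iff_norm_le.2 (norm_lie_weylL2_le _ _ _ _ _ _)
    _ ≤ 2 * ‖σ‖ₑ ^ r := enorm_exp_I_mul_sub_one_le σ hr0 hr1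
    _ ≤ 2 * (∑ z : Box d L × Box d L × Fin 3,
          ENNReal.ofReal (2 * massBound mMin mMax ^ 2 * ‖f z.1‖ * ‖g z.2.1‖
          * |flowKernel (hL_isHermitian p L) z.2.2 t z.1 z.2.1|)) ^ r := by
      gcongr
      rw [← ENNReal.ofReal_sum_of_nonneg fun z _ => by positivity, ← ofReal_norm]
      exact ENNReal.ofReal_le_ofReal (abs_symplectic_le hp f g t)
    _ ≤ 2 * ∑ z : Box d L × Box d L × Fin 3,
          ENNReal.ofReal (2 * massBound mMin mMax ^ 2 * ‖f z.1‖ * ‖g z.2.1‖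
          * |flowKernel (hL_isHermitian p L) z.2.2 t z.1 z.2.1|) ^ r := by
      gcongr
      exact sum_rpow_le_sum_rpow _ _ hr0 hr1
    _ = _ := by
      rw [Finset.mul_sum]
      refine Finset.sum_congr rfl fun z _ => ?_
      rw [ENNReal.ofReal_mul (by positivity), ENNReal.mul_rpow_of_nonneg _ _ hr0.le,
        ← Real.norm_eq_abs, ofReal_norm, ENNReal.ofReal_rpow_of_nonneg (by positivity) hr0.le,
        Real.mul_rpow (by positivity) (by positivity), Real.mul_rpow (by positivity) (by positivity),
        ← mul_assoc, mul_assoc (2 : ℝ), ENNReal.ofReal_mul zero_le_two, mul_assoc (_ ^ r)]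
      simp

end Symplectic

/-! ### Averaged commutator bounds -/

section Main

variable {d : ℕ} {Ω : Type*} [MeasurableSpace Ω] {P : Measure Ω} {p : Ω → Params d}
  {mMin mMax kMax lamMax r : ℝ}

/-- The correlator, a supremum over uncountably many functions, is not known to be measurable;
pulling out a finite constant does not require it. -/
theorem lintegral_iSup_flowKernel_le {L : ℕ} (hA1 : ∀ᵐ ω ∂P, (p ω).Bounds mMin mMax kMax lamMax)
    (hA2 : ∀ᵐ ω ∂P, (hL (p ω) L).PosDef) (hr0 : 0 < r) (i : Fin 3) (x y : Box d L) :
    ∫⁻ ω, ⨆ q : ℚ, ‖flowKernel (hL_isHermitian (p ω) L) i q x y‖ₑ ^ r ∂P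
      ≤ ENNReal.ofReal ((1 + eigenBound d mMin kMax lamMax) ^ r)
        * ∫⁻ ω, eigenCorrelator (-1 / 2) r (p ω) L x y ∂P := by
  rw [← lintegral_const_mul' _ _ ENNReal.ofReal_ne_top]
  refine lintegral_mono_ae ?_
  filter_upwards [hA1, hA2] with ω h1 h2
  exact iSup_le fun q => enorm_flowKernel_rpow_le h1 h2 i q x y hr0

/-- Suprema over all times are only bounded from above. Exchanging the integral with the finite sum
needs measurable summands, which is why the kernels enter through suprema over rational times. -/
theorem lintegral_iSup_lie_weyl_le {L : ℕ} (hm : ∀ x, Measurable fun ω => (p ω).m x)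
    (hk : ∀ x, Measurable fun ω => (p ω).k x)
    (hlam : ∀ x y, siteDist x y = 1 → Measurable fun ω => (p ω).lam s(x, y))
    (hA1 : ∀ᵐ ω ∂P, (p ω).Bounds mMin mMax kMax lamMax)
    (hA2 : ∀ᵐ ω ∂P, (h0 (p ω) L).PosDef) (hr0 : 0 < r) (hr1 : r ≤ 1) (f g : Box d L → ℂ) :
    ∫⁻ ω, ⨆ t : ℝ, ‖⁅heisenberg (p ω) L t (weyl f), weyl g⁆‖ₑ ∂P
      ≤ ∑ z : Box d L × Box d L × Fin 3,
        ENNReal.ofReal (2 * (2 * massBound mMin mMax ^ 2) ^ r * (‖f z.1‖ ^ r * ‖g z.2.1‖ ^ r))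
          * (ENNReal.ofReal ((1 + eigenBound d mMin kMax lamMax) ^ r)
            * ∫⁻ ω, eigenCorrelator (-1 / 2) r (p ω) L z.1 z.2.1 ∂P) := by
  have hpd : ∀ᵐ ω ∂P, (hL (p ω) L).PosDef := by
    filter_upwards [hA1, hA2] with ω h1 h2
    exact hL_posDef (fun x => h1.mMin_pos.trans_le (h1.m_mem x).1) h2
  have hmeas : ∀ z : Box d L × Box d L × Fin 3, AEMeasurable (fun ω => ⨆ q : ℚ,
      ‖flowKernel (hL_isHermitian (p ω) L) z.2.2 q z.1 z.2.1‖ₑ ^ r) P := fun z =>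
    AEMeasurable.iSup fun q =>
      (aemeasurable_flowKernel hm hk hlam hpd z.2.2 q z.1 z.2.1).enorm.pow_const r
  calc _ ≤ ∫⁻ ω, ∑ z : Box d L × Box d L × Fin 3,
        ENNReal.ofReal (2 * (2 * massBound mMin mMax ^ 2) ^ r * (‖f z.1‖ ^ r * ‖g z.2.1‖ ^ r))
          * ⨆ q : ℚ, ‖flowKernel (hL_isHermitian (p ω) L) z.2.2 q z.1 z.2.1‖ₑ ^ r ∂P := by
        refine lintegral_mono_ae ?_
        filter_upwards [hA1, hA2] with ω h1 h2
        refine iSup_le fun t => (enorm_lie_heisenberg_weyl_le h1 h2 f g t hr0 hr1).trans ?_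
        refine Finset.sum_le_sum fun z _ => ?_
        gcongr
        exact enorm_le_iSup_rat (continuous_flowKernel _ _ _ _) r t
    _ = ∑ z : Box d L × Box d L × Fin 3,
        ENNReal.ofReal (2 * (2 * massBound mMin mMax ^ 2) ^ r * (‖f z.1‖ ^ r * ‖g z.2.1‖ ^ r))
          * ∫⁻ ω, ⨆ q : ℚ, ‖flowKernel (hL_isHermitian (p ω) L) z.2.2 q z.1 z.2.1‖ₑ ^ r ∂P := by
        rw [lintegral_finsetSum' _ fun z _ => (hmeas z).const_mul _]
        exact Finset.sum_congr rfl fun z _ => lintegral_const_mul'' _ (hmeas z)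
    _ ≤ _ := by
        gcongr with z
        exact lintegral_iSup_flowKernel_le hA1 hpd hr0 _ _ _

end Main

end OscillatorSystem

end

theorem theorem3p3 {d : ℕ} (hd : 1 ≤ d) {Ω : Type*} [MeasurableSpace Ω]
    (P : Measure Ω) [IsProbabilityMeasure P] (p : Ω → Params d)
    (hm_meas : ∀ x, Measurable fun ω => (p ω).m x)
    (hk_meas : ∀ x, Measurable fun ω => (p ω).k x)
    (hlam_meas : ∀ x y, siteDist x y = 1 → Measurable fun ω => (p ω).lam s(x, y))
    {mMin mMax kMax lamMax : ℝ}
    (hA1 : ∀ᵐ ω ∂P, (p ω).Bounds mMin mMax kMax lamMax)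
    (hA2 : ∀ᵐ ω ∂P, ∀ L : ℕ, 1 ≤ L → (h0 (p ω) L).PosDef)
    {r : ℝ} (hr0 : 0 < r) (hr1 : r ≤ 1)
    (hcorr : ExpDecayingCorrelators P p (-1 / 2) r) :
    ∃ C' μ' : ℝ, 0 < μ' ∧ ∀ L : ℕ, 1 ≤ L → ∀ f g : Box d L → ℂ,
      ∫⁻ ω, ⨆ t : ℝ, ‖⁅heisenberg (p ω) L t (weyl f), weyl g⁆‖ₑ ∂P
        ≤ ENNReal.ofReal (C' * ∑ x : Box d L, ∑ y : Box d L,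
            ‖f x‖ ^ r * ‖g y‖ ^ r * Real.exp (-μ' * siteDist (x : Site d) y)) := by
  obtain ⟨C, μ, hμ, hC⟩ := hcorr
  -- A single sample point satisfying the bounds yields the sign of the deterministic constant.
  obtain ⟨ω₀, hω₀⟩ := hA1.exists
  have hB : 0 ≤ 1 + eigenBound d mMin kMax lamMax := by
    have := eigenBound_nonneg hω₀
    linarith
  -- The `6` is the `2` from `2|σ|^r` times the three kernels; `|C|` is used because the sign of `C`
  -- is not prescribed. The decay rate is unchanged.
  refine ⟨6 * (2 * massBound mMin mMax ^ 2) ^ r * (1 + eigenBound d mMin kMax lamMax) ^ r * |C|,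
    μ, hμ, fun L hL f g => ?_⟩
  refine (lintegral_iSup_lie_weyl_le hm_meas hk_meas hlam_meas hA1
    (hA2.mono fun ω h => h L hL) hr0 hr1 f g).trans ?_
  calc _ ≤ ∑ z : Box d L × Box d L × Fin 3, ENNReal.ofReal
        (2 * (2 * massBound mMin mMax ^ 2) ^ r * (‖f z.1‖ ^ r * ‖g z.2.1‖ ^ r)
          * ((1 + eigenBound d mMin kMax lamMax) ^ r
            * (|C| * Real.exp (-μ * siteDist (z.1 : Site d) z.2.1)))) := by
        refine Finset.sum_le_sum fun z _ => ?_
        rw [ENNReal.ofReal_mul (q := (1 + eigenBound d mMin kMax lamMax) ^ r * _) (by positivity),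
          ENNReal.ofReal_mul (p := (1 + eigenBound d mMin kMax lamMax) ^ r) (by positivity)]
        gcongr
        refine (hC L hL z.1 z.2.1).trans (ENNReal.ofReal_le_ofReal ?_)
        gcongr
        exact le_abs_self C
    _ = _ := by
        rw [← ENNReal.ofReal_sum_of_nonneg fun z _ => by positivity]
        congr 1
        simp only [Fintype.sum_prod_type, Finset.sum_const, Finset.card_univ, Fintype.card_fin,
          Finset.mul_sum, nsmul_eq_mul]
        refine Finset.sum_congr rfl fun x _ => Finset.sum_congr rfl fun y _ => ?_
        push_cast
        ring
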